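/- **Notation.** $\mathsf Z_n$ is the cyclic group of order $n$; $\mathrm D_{2n}$ is the dihedral group of order $2n$ ($n\ge 2$, so $\mathrm D_4=\mathsf Z_2^2$); for $n\ge 2$, $\mathrm Q_{4n}=\langle a,c\mid a^{2n}=1,\ a^n=c^2,\ a^c=a^{-1}\rangle$ is the generalized quaternion group. Conjugation is $a^b=b^{-1}ab$. $A{:}B$ denotes a semidirect product with normal factor $A$, and $\mathrm{Hol}(N)=N{:}\mathrm{Aut}(N)$ is the holomorph. For $\ell\ge 2$, $$\mathrm{SD}_{2^{\ell+2}}=\langle a\rangle{:}\langle b\rangle,\quad |a|=2^{\ell+1},\ |b|=2,\ a^b=a^{2^\ell-1}.$$ In $\mathsf Z_{2^{k}}{:}\mathrm{Aut}(\mathsf Z_{2^{k+1}})$ the automorphism $x\mapsto x^i$ of $\mathsf Z_{2^{k+1}}$ acts on $\mathsf Z_{2^k}$ by $y\mapsto y^i$. $A\circ B$ is the central product $(A\times B)/\{(c,c^\varphi)\mid c\in C_1\}$, where $\varphi:C_1\to C_2$ is an isomorphism between subgroups $C_1\le \mathrm Z(A)$, $C_2\le\mathrm Z(B)$ such that $C_1=\mathrm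 Z(A)$ or $C_2=\mathrm Z(B)$. An involution is an element of order $2$. A *reversing triple* of $G$ is a triple $(x,y,z)$ of (not necessarily distinct) involutions with $G=\langle x,y,z\rangle$; it is a *regular triple* if moreover $\langle x,z\rangle\cong\mathsf Z_2^2$. A *rotary pair* of $G$ is a pair $(\alpha,z)$ with $|z|=2$ and $G=\langle\alpha,z\rangle$. **Theorem 1.1.** Let $G$ be a finite $2$-group with $|G|\neq 2$ that has a cyclic or dihedral maximal subgroup. Then $G$ is isomorphic to one of the groups listed in the following two tables (with some $\ell\ge 2$ in Table 1). Moreover, for each listed group (and every $\ell\geq 2$ in Table 1), $\mathrm{Aut}(G)$ is as shown, and $G$ has a reversing triple, a regular triple, a rotary pair if and only if the corresponding column contains $\surd$. Table 1 ($\ell\ge 2$; $\mathrm{Aut}(G)$ is a $2$-group): $$\begin{array}{c|c|c|c|c} G&\mathrm{Aut}(G)&\text{reversing triple}&\text{regular triple}&\text{rotary pair}\\ \hline \mathsf Z_{2^\ell}&\mathsf Z_{2^{\ell-2}}\times\mathsf Z_2&\times&\times&\surd\\ \mathsf Z_4\times\mathsf Z_2&\mathrm D_8&\times&\times&\surd\\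 \mathsf Z_{2^{\ell+1}}\times\mathsf Z_2&(\mathsf Z_{2^{\ell-1}}\circ\mathrm D_8)\times\mathsf Z_2&\times&\times&\surd\\ \mathrm D_{2^{\ell+1}}&\mathrm{Hol}(\mathsf Z_{2^\ell})&\surd&\surd&\surd\\ \mathrm{SD}_{2^{\ell+2}}&\mathsf Z_{2^\ell}{:}\mathrm{Aut}(\mathsf Z_{2^{\ell+1}})&\times&\times&\surd\\ \mathsf Z_{2^{\ell+1}}{:}\mathsf Z_2=\langle a\rangle{:}\langle b\rangle,\ a^b=a^{2^\ell+1}&(\mathsf Z_{2^{\ell-1}}\circ\mathrm D_8)\times\mathsf Z_2&\times&\times&\surd\\ \mathrm Q_{2^{\ell+2}}&\mathrm{Hol}(\mathsf Z_{2^{\ell+1}})&\times&\times&\times\\ \mathrm Q_{2^{\ell+2}}\circ\mathsf Z_4&\mathrm{Aut}(\mathrm Q_{2^{\ell+2}})\times\mathsf Z_2&\surd&\times&\times\\ \mathrm D_{2^{\ell+1}}\times\mathsf Z_2&H.(\mathrm D_8\times\mathsf Z_2),\ H\cong\mathsf Z_{2^{\ell-1}}{:}\mathrm{Aut}(\mathsf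 Z_{2^\ell})&\surd&\surd&\times\\ \mathsf Z_{2^{\ell+1}}{:}\mathsf Z_2^2=\langle a\rangle{:}\langle b,c\rangle,\ a^b=a^{-1},\ a^c=a^{2^\ell+1}&(\mathrm{Aut}(\mathrm{SD}_{2^{\ell+2}})\times\mathsf Z_2){:}\mathsf Z_2&\surd&\surd&\times \end{array}$$ Here $\mathrm{Aut}(G)=H.K$ means that $\mathrm{Aut}(G)$ has a normal subgroup $H$ with $\mathrm{Aut}(G)/H\cong K$, and in the last row $(\mathrm{Aut}(\mathrm{SD}_{2^{\ell+2}})\times\mathsf Z_2){:}\mathsf Z_2$ means a semidirect product for some action of $\mathsf Z_2$. Table 2 ($\mathrm{Aut}(G)$ is not a $2$-group): $$\begin{array}{c|c|c|c|c} G&\mathrm{Aut}(G)&\text{reversing triple}&\text{regular triple}&\text{rotary pair}\\ \hline \mathsf Z_2^2&\mathrm S_3&\surd&\surd&\surd\\ \mathrm Q_8&\mathrm S_4&\times&\times&\times\\ \mathsf Z_2^3&\mathrm{GL}_3(2)&\surd&\surd&\times\\ \mathrm Q_8\circ\mathsf Z_4&\mathrm S_4\times\mathsf Z_2&\surd&\times&\times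 \end{array}$$ -/

import Mathlib

/-- The cyclic group `Z_n` of order `n` (for `n > 0`), written multiplicatively. -/
abbrev Cyc (n : ℕ) : Type := Multiplicative (ZMod n)

/-- The identification `Aut(Z_n) ≅ (ℤ/n)ˣ`. -/
def autCyc (n : ℕ) : MulAut (Cyc n) ≃* (ZMod n)ˣ :=
  (MulAutMultiplicative (ZMod n)).trans (ZMod.AddAutEquivUnits n).toMultiplicative

/-- Under this identification a unit `u` is the automorphism `g ↦ g ^ u`. -/
theorem autCyc_symm_apply (n : ℕ) (u : (ZMod n)ˣ) (x : ZMod n) :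
    (autCyc n).symm u (Multiplicative.ofAdd x) = Multiplicative.ofAdd ((u : ZMod n) * x) :=
  rfl

/-- For `m ∣ n`, the natural action of `Aut(Z_n)` on `Z_m`: the automorphism `g ↦ g ^ k` of `Z_n`
acts on `Z_m` as `h ↦ h ^ k`. -/
def powerAction {m n : ℕ} (h : m ∣ n) : MulAut (Cyc n) →* MulAut (Cyc m) :=
  (autCyc m).symm.toMonoidHom.comp ((ZMod.unitsMap h).comp (autCyc n).toMonoidHom)

theorem powerAction_apply {m n : ℕ} (h : m ∣ n) (u : (ZMod n)ˣ) (x : ZMod m) :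
    powerAction h ((autCyc n).symm u) (Multiplicative.ofAdd x) =
      Multiplicative.ofAdd (ZMod.castHom h (ZMod m) (u : ZMod n) * x) := by
  have : powerAction h ((autCyc n).symm u) = (autCyc m).symm (ZMod.unitsMap h u) := by
    simp [powerAction]
  rw [this, autCyc_symm_apply]
  rfl

/-- The semidirect product `Z_{2^k} : Aut(Z_{2^(k+1)})` with respect to the natural action. -/
abbrev CycByAut (k : ℕ) : Type :=
  Cyc (2 ^ k) ⋊[powerAction (pow_dvd_pow 2 (Nat.le_succ k))] MulAut (Cyc (2 ^ (k + 1)))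

/-- The holomorph `Hol(N) = N : Aut(N)`. -/
abbrev Holomorph (N : Type*) [Group N] : Type _ := N ⋊[MonoidHom.id (MulAut N)] MulAut N

/-- The homomorphism from `Z_2` sending the generator to an element `u` with `u ^ 2 = 1`. -/
def involutionHom {U : Type*} [Group U] (u : U) (hu : u ^ 2 = 1) : Cyc 2 →* U where
  toFun x := u ^ (x.toAdd).val
  map_one' := by simp
  map_mul' x y := by
    rw [← pow_add, toAdd_mul, ZMod.val_add]
    exact (pow_eq_pow_mod _ hu).symm

theorem involutionHom_gen {U : Type*} [Group U] (u : U) (hu : u ^ 2 = 1) :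
    involutionHom u hu (Multiplicative.ofAdd 1) = u :=
  pow_one u

theorem two_pow_sq_eq_zero (ℓ : ℕ) (hℓ : 2 ≤ ℓ) : ((2 : ZMod (2 ^ (ℓ + 1))) ^ ℓ) ^ 2 = 0 := by
  have h0 : (2 : ZMod (2 ^ (ℓ + 1))) ^ (ℓ + 1) = 0 := by
    exact_mod_cast ZMod.natCast_self (2 ^ (ℓ + 1))
  have h1 : ℓ * 2 = (ℓ + 1) + (ℓ - 1) := by omega
  calc ((2 : ZMod (2 ^ (ℓ + 1))) ^ ℓ) ^ 2 = 2 ^ (ℓ + 1) * 2 ^ (ℓ - 1) := by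
        rw [← pow_mul, h1]; exact pow_add _ _ _
    _ = 0 := by rw [h0, zero_mul]

theorem two_mul_two_pow_eq_zero (ℓ : ℕ) : 2 * (2 : ZMod (2 ^ (ℓ + 1))) ^ ℓ = 0 := by
  rw [← pow_succ']
  exact_mod_cast ZMod.natCast_self (2 ^ (ℓ + 1))

theorem semidihedral_sq (ℓ : ℕ) (hℓ : 2 ≤ ℓ) :
    ((2 : ZMod (2 ^ (ℓ + 1))) ^ ℓ - 1) * (2 ^ ℓ - 1) = 1 := by
  linear_combination two_pow_sq_eq_zero ℓ hℓ - two_mul_two_pow_eq_zero ℓ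

theorem modular_sq (ℓ : ℕ) (hℓ : 2 ≤ ℓ) :
    ((2 : ZMod (2 ^ (ℓ + 1))) ^ ℓ + 1) * (2 ^ ℓ + 1) = 1 := by
  linear_combination two_pow_sq_eq_zero ℓ hℓ + two_mul_two_pow_eq_zero ℓ

/-- The unit `2^ℓ - 1` modulo `2^(ℓ+1)`. -/
def semidihedralUnit (ℓ : ℕ) (hℓ : 2 ≤ ℓ) : (ZMod (2 ^ (ℓ + 1)))ˣ :=
  ⟨2 ^ ℓ - 1, 2 ^ ℓ - 1, semidihedral_sq ℓ hℓ, semidihedral_sq ℓ hℓ⟩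

/-- The unit `2^ℓ + 1` modulo `2^(ℓ+1)`. -/
def modularUnit (ℓ : ℕ) (hℓ : 2 ≤ ℓ) : (ZMod (2 ^ (ℓ + 1)))ˣ :=
  ⟨2 ^ ℓ + 1, 2 ^ ℓ + 1, modular_sq ℓ hℓ, modular_sq ℓ hℓ⟩

theorem semidihedralUnit_sq (ℓ : ℕ) (hℓ : 2 ≤ ℓ) : semidihedralUnit ℓ hℓ ^ 2 = 1 :=
  Units.ext (by rw [sq]; exact semidihedral_sq ℓ hℓ)

theorem modularUnit_sq (ℓ : ℕ) (hℓ : 2 ≤ ℓ) : modularUnit ℓ hℓ ^ 2 = 1 :=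
  Units.ext (by rw [sq]; exact modular_sq ℓ hℓ)

/-- The semidihedral group `SD_{2^(ℓ+2)} = ⟨a⟩ : ⟨b⟩`, where `a` has order `2^(ℓ+1)`, `b` has
order `2` and `a^b = a^(2^ℓ - 1)`. -/
abbrev SemiDihedral (ℓ : ℕ) (hℓ : 2 ≤ ℓ) : Type :=
  Cyc (2 ^ (ℓ + 1)) ⋊[(autCyc (2 ^ (ℓ + 1))).symm.toMonoidHom.comp
    (involutionHom (semidihedralUnit ℓ hℓ) (semidihedralUnit_sq ℓ hℓ))] Cyc 2

/-- The modular group `Z_{2^(ℓ+1)} : Z_2 = ⟨a⟩ : ⟨b⟩`, where `a` has order `2^(ℓ+1)`, `b` has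
order `2` and `a^b = a^(2^ℓ + 1)`. -/
abbrev ModularGrp (ℓ : ℕ) (hℓ : 2 ≤ ℓ) : Type :=
  Cyc (2 ^ (ℓ + 1)) ⋊[(autCyc (2 ^ (ℓ + 1))).symm.toMonoidHom.comp
    (involutionHom (modularUnit ℓ hℓ) (modularUnit_sq ℓ hℓ))] Cyc 2

/-- The group `Z_{2^(ℓ+1)} : Z_2^2 = ⟨a⟩ : ⟨b, c⟩`, where `a` has order `2^(ℓ+1)`, `b` and `c` are
commuting involutions, `a^b = a^(-1)` and `a^c = a^(2^ℓ + 1)`.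
Thus `⟨a, b⟩` is dihedral and, since `a^(bc) = a^(2^ℓ - 1)`, `⟨a, bc⟩` is semidihedral. -/
abbrev CycByKlein (ℓ : ℕ) (hℓ : 2 ≤ ℓ) : Type :=
  Cyc (2 ^ (ℓ + 1)) ⋊[(autCyc (2 ^ (ℓ + 1))).symm.toMonoidHom.comp
    ((involutionHom (-1 : (ZMod (2 ^ (ℓ + 1)))ˣ) (by simp)).coprod
      (involutionHom (modularUnit ℓ hℓ) (modularUnit_sq ℓ hℓ)))] (Cyc 2 × Cyc 2)

/-- Data for a central product of `A` and `B`: subgroups `C₁ ≤ Z(A)` and `C₂ ≤ Z(B)` together with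
an isomorphism `φ : C₁ ≅ C₂`. -/
structure CentralGluing (A B : Type*) [Group A] [Group B] where
  C₁ : Subgroup A
  C₂ : Subgroup B
  le₁ : C₁ ≤ Subgroup.center A
  le₂ : C₂ ≤ Subgroup.center B
  φ : C₁ ≃* C₂

namespace CentralGluing

variable {A B : Type*} [Group A] [Group B]

/-- The subgroup `C = {(c, φ c) | c ∈ C₁}` of `A × B`. -/
def graph (d : CentralGluing A B) : Subgroup (A × B) :=
  (d.C₁.subtype.prod (d.C₂.subtype.comp d.φ.toMonoidHom)).range

theorem mem_graph (d : CentralGluing A B) (p : A × B) :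
    p ∈ d.graph ↔ ∃ c : d.C₁, ((c : A), ((d.φ c : d.C₂) : B)) = p :=
  Iff.rfl

instance graph_normal (d : CentralGluing A B) : d.graph.Normal where
  conj_mem := by
    rintro _ ⟨c, rfl⟩ g
    refine ⟨c, ?_⟩
    have h₁ := Subgroup.mem_center_iff.1 (d.le₁ c.2) g.1
    have h₂ := Subgroup.mem_center_iff.1 (d.le₂ (d.φ c).2) g.2
    ext
    · simp [h₁]
    · simp [h₂]

/-- The central product `(A × B) / C`. -/
abbrev Product (d : CentralGluing A B) : Type _ := (A × B) ⧸ d.graph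

/-- The amalgamated subgroup is the whole centre of one of the two factors; this is the convention
under which the central product is written `A ∘ B`. -/
def IsFull (d : CentralGluing A B) : Prop :=
  d.C₁ = Subgroup.center A ∨ d.C₂ = Subgroup.center B

end CentralGluing

/-- `P` is a central product `A ∘ B`, with amalgamated subgroup the centre of one of the factors. -/
def IsCentralProduct (P A B : Type*) [Group P] [Group A] [Group B] : Prop :=
  ∃ d : CentralGluing A B, d.IsFull ∧ Nonempty (P ≃* d.Product)

/-- `M` is a dihedral group `D_{2n}`, `n ≥ 2` (the Klein four-group being `D_4`). -/
def IsDihedralGroup (M : Type*) [Group M] : Prop :=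
  ∃ n : ℕ, 2 ≤ n ∧ Nonempty (M ≃* DihedralGroup n)

section Triples

variable {G : Type*} [Group G]

/-- A reversing triple: three (not necessarily distinct) involutions generating `G`. -/
def IsReversingTriple (x y z : G) : Prop :=
  orderOf x = 2 ∧ orderOf y = 2 ∧ orderOf z = 2 ∧ Subgroup.closure {x, y, z} = ⊤

/-- A regular triple: a reversing triple `(x, y, z)` with `⟨x, z⟩ ≅ Z_2^2`. -/
def IsRegularTriple (x y z : G) : Prop :=
  IsReversingTriple x y z ∧ Nonempty (Subgroup.closure {x, z} ≃* Cyc 2 × Cyc 2)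

/-- A rotary pair: an element and an involution that together generate `G`. -/
def IsRotaryPair (α z : G) : Prop :=
  orderOf z = 2 ∧ Subgroup.closure {α, z} = ⊤

end Triples

def HasReversingTriple (G : Type*) [Group G] : Prop := ∃ x y z : G, IsReversingTriple x y z

def HasRegularTriple (G : Type*) [Group G] : Prop := ∃ x y z : G, IsRegularTriple x y z

def HasRotaryPair (G : Type*) [Group G] : Prop := ∃ α z : G, IsRotaryPair α z

/-!
Every listed group except the smallest ones is an extension by a group of order two of a cyclic
group (`IsCyclicExt`) or of a dihedral or quaternion group (`IsTwoExt`): it is the union of a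
subgroup and of a coset `{m * c}`, with prescribed action of `c` and prescribed `c ^ 2`. These data
determine the group up to isomorphism (`IsTwoExt.nonempty_mulEquiv`), and homomorphisms can be
defined by their values on generators (`IsTwoExt.exists_hom`).

*Classification* (`isListed_of_isCoatom`). A maximal subgroup of a `2`-group has index two. If it is
cyclic, then `b` acts on it by a square root `u` of one modulo `2 ^ (κ + 1)`, which is `±1` or
`±1 + 2 ^ κ`; the exponent `s` of `b ^ 2` satisfies `u * s = s`, and replacing `b` by `E t * b` adds
`t + u * t` to it, which leaves one or two groups for each `u`. If it is dihedral, then the square of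
`c` is a rotation, and after replacing `c` by `sr 0 * c` if needed, `c` acts on the rotations
trivially or as the power map with exponent `1 + 2 ^ κ`. Either the group has a cyclic subgroup of
index two after all, or it is a direct product with `Z_2`, a central product with `Z_4`, or
`Z_{2 ^ (κ + 1)} : Z_2 ^ 2`.

*Automorphism groups.* They are computed from the possible images of generators
(`exists_hom_mulAut`, `nonempty_mulAut_mulEquiv`).
* Dihedral, semidihedral and large quaternion groups: the elements outside of the cyclic subgroup
  have small order, so that it is characteristic, and the images `E v` and `E k * b` of `E 1` and `b`
  give a semidirect product.
* `Z_{2 ^ (ℓ + 1)} × Z_2` and the modular groups: there are the diagonal automorphisms and the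
  transvection `E 1 ↦ E 1 * b`. The transvection and its transpose `b ↦ E (2 ^ ℓ) * b` generate a
  dihedral group of order eight, whose centre lies in the cyclic group generated by
  `E 1 ↦ E 5`; the sign provides the direct factor `Z_2`.
* Dihedral times `Z_2`: the normal subgroup is the kernel of the action on the Frattini quotient and
  on the centre (`frattiniAction`); the image is the full group of unitriangular matrices over the
  field of two elements, which is dihedral, times `Z_2`.
* `Z_{2 ^ (ℓ + 1)} : Z_2 ^ 2`: the automorphisms preserving the dihedral subgroup form a subgroup of
  index two, complemented by the involution of `IsTwoExt.exists_swap`.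
* Quaternion central `Z_4`: the quaternion subgroup is characteristic, being generated by the
  noncentral square roots of the central involution.
* The exceptional groups: automorphisms of `Q_8` permute its six elements of order four in the way
  the symmetric group permutes the six `4`-cycles, and elementary abelian groups have general linear
  automorphism groups.

*Generating sets.* Where a triple or pair exists it is written down. Otherwise a nontrivial character
kills all involutions (`not_hasReversingTriple`), or the group maps onto the elementary abelian group
of order eight, which is not generated by two elements (`not_hasRotaryPair_of_surjective`,
`closure_ne_top_of_two`), or all involutions are central in a nonabelian group
(`not_hasRotaryPair_of_central`).
-/

/-! ### Arithmetic in `ZMod (2 ^ (ℓ + 1))` -/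

/-- Reduction modulo `2`. -/
def parity (ℓ : ℕ) : ZMod (2 ^ (ℓ + 1)) →+* ZMod 2 :=
  ZMod.castHom (dvd_pow_self 2 (Nat.succ_ne_zero ℓ)) (ZMod 2)

theorem parity_natCast (ℓ k : ℕ) : parity ℓ (k : ZMod (2 ^ (ℓ + 1))) = k := map_natCast _ _

theorem parity_eq_zero_or_one {ℓ : ℕ} (x : ZMod (2 ^ (ℓ + 1))) : parity ℓ x = 0 ∨ parity ℓ x = 1 := by
  generalize parity ℓ x = y
  revert y; decide

theorem parity_eq_zero_iff {ℓ : ℕ} {x : ZMod (2 ^ (ℓ + 1))} : parity ℓ x = 0 ↔ ∃ y, x = 2 * y := by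
  constructor
  · obtain ⟨k, rfl⟩ := ZMod.natCast_zmod_surjective x
    rw [parity_natCast, ZMod.natCast_eq_zero_iff]
    rintro ⟨y, rfl⟩
    exact ⟨y, by push_cast; rfl⟩
  · rintro ⟨y, rfl⟩
    rw [map_mul, map_ofNat, show (2 : ZMod 2) = 0 from rfl, zero_mul]

theorem parity_eq_one_iff {ℓ : ℕ} {x : ZMod (2 ^ (ℓ + 1))} : parity ℓ x = 1 ↔ IsUnit x := by
  constructor
  · obtain ⟨k, rfl⟩ := ZMod.natCast_zmod_surjective x
    rw [parity_natCast, ZMod.natCast_eq_one_iff_odd, ZMod.isUnit_iff_coprime]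
    intro h
    exact (Nat.coprime_two_right.2 h).pow_right _
  · intro h
    have := h.map (parity ℓ)
    revert this
    generalize parity ℓ x = y
    revert y; decide

theorem parity_unit {ℓ : ℕ} (v : (ZMod (2 ^ (ℓ + 1)))ˣ) : parity ℓ v = 1 :=
  parity_eq_one_iff.2 v.isUnit

theorem two_mul_two_pow (ℓ : ℕ) : 2 * (2 : ZMod (2 ^ (ℓ + 1))) ^ ℓ = 0 := two_mul_two_pow_eq_zero ℓ

theorem two_pow_mul_two (ℓ : ℕ) : (2 : ZMod (2 ^ (ℓ + 1))) ^ ℓ * 2 = 0 := by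
  rw [mul_comm, two_mul_two_pow]

theorem two_pow_add_two_pow (ℓ : ℕ) : (2 : ZMod (2 ^ (ℓ + 1))) ^ ℓ + 2 ^ ℓ = 0 := by
  rw [← two_mul, two_mul_two_pow]

theorem neg_two_pow (ℓ : ℕ) : -(2 : ZMod (2 ^ (ℓ + 1))) ^ ℓ = 2 ^ ℓ := by
  linear_combination -two_mul_two_pow ℓ

theorem two_pow_ne_zero (ℓ : ℕ) : (2 : ZMod (2 ^ (ℓ + 1))) ^ ℓ ≠ 0 := by
  intro h
  have h' : ((2 ^ ℓ : ℕ) : ZMod (2 ^ (ℓ + 1))) = 0 := by exact_mod_cast h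
  rw [ZMod.natCast_eq_zero_iff] at h'
  have := (Nat.pow_dvd_pow_iff_le_right (by norm_num)).1 h'
  omega

theorem two_ne_zero_of_pos {ℓ : ℕ} (hℓ : 1 ≤ ℓ) : (2 : ZMod (2 ^ (ℓ + 1))) ≠ 0 := by
  intro h
  apply two_pow_ne_zero ℓ
  rw [h, zero_pow (by omega)]

theorem four_ne_zero_of_two_le {ℓ : ℕ} (hℓ : 2 ≤ ℓ) : (4 : ZMod (2 ^ (ℓ + 1))) ≠ 0 := by
  intro h
  apply two_pow_ne_zero ℓ
  obtain ⟨k, rfl⟩ := Nat.exists_eq_add_of_le hℓ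
  linear_combination (2 : ZMod (2 ^ (2 + k + 1))) ^ k * h

theorem two_pow_mul_of_even {ℓ : ℕ} {x : ZMod (2 ^ (ℓ + 1))} (h : parity ℓ x = 0) :
    2 ^ ℓ * x = 0 := by
  obtain ⟨y, rfl⟩ := parity_eq_zero_iff.1 h
  linear_combination y * two_mul_two_pow ℓ

theorem two_pow_mul_of_odd {ℓ : ℕ} {x : ZMod (2 ^ (ℓ + 1))} (h : parity ℓ x = 1) :
    2 ^ ℓ * x = 2 ^ ℓ := by
  have : parity ℓ (x - 1) = 0 := by rw [map_sub, h, map_one, sub_self]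
  linear_combination two_pow_mul_of_even this

theorem two_pow_mul_unit {ℓ : ℕ} (v : (ZMod (2 ^ (ℓ + 1)))ˣ) : 2 ^ ℓ * (v : ZMod (2 ^ (ℓ + 1))) = 2 ^ ℓ :=
  two_pow_mul_of_odd (parity_unit v)

theorem parity_two_pow {ℓ : ℕ} (hℓ : 1 ≤ ℓ) : parity ℓ (2 ^ ℓ) = 0 := by
  rw [map_pow, map_ofNat, show (2 : ZMod 2) = 0 from rfl, zero_pow (by omega)]

theorem two_pow_mul_two_pow {ℓ : ℕ} (hℓ : 1 ≤ ℓ) : (2 : ZMod (2 ^ (ℓ + 1))) ^ ℓ * 2 ^ ℓ = 0 :=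
  two_pow_mul_of_even (parity_two_pow hℓ)

theorem two_mul_eq_zero_iff {ℓ : ℕ} {x : ZMod (2 ^ (ℓ + 1))} : 2 * x = 0 ↔ x = 0 ∨ x = 2 ^ ℓ := by
  constructor
  · obtain ⟨k, rfl⟩ := ZMod.natCast_zmod_surjective x
    intro h
    have h' : ((2 * k : ℕ) : ZMod (2 ^ (ℓ + 1))) = 0 := by exact_mod_cast h
    rw [ZMod.natCast_eq_zero_iff, pow_succ', Nat.mul_dvd_mul_iff_left (by norm_num)] at h'
    obtain ⟨y, rfl⟩ := h'
    rcases parity_eq_zero_or_one (y : ZMod (2 ^ (ℓ + 1))) with h | h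
    · left; push_cast; exact two_pow_mul_of_even h
    · right; push_cast; exact two_pow_mul_of_odd h
  · rintro (rfl | rfl)
    · exact mul_zero _
    · exact two_mul_two_pow ℓ

theorem parity_two (ℓ : ℕ) : parity ℓ 2 = 0 := by rw [map_ofNat]; rfl

/-- The square roots of `1` modulo a power of `2`. -/
theorem sq_eq_one_cases {ℓ : ℕ} {u : ZMod (2 ^ (ℓ + 1))} (hu : u * u = 1) :
    u = 1 ∨ u = 1 + 2 ^ ℓ ∨ u = -1 ∨ u = -1 + 2 ^ ℓ := by
  have h1 : parity ℓ (u - 1) = 0 := by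
    rw [map_sub, parity_eq_one_iff.2 (IsUnit.of_mul_eq_one u hu), map_one, sub_self]
  obtain ⟨v, hv⟩ := parity_eq_zero_iff.1 h1
  have h4 : v * (2 * (2 * (v + 1))) = 0 := by linear_combination hu - (u + 2 * v + 1) * hv
  -- one of the consecutive elements `v`, `v + 1` is odd, hence invertible
  rcases parity_eq_zero_or_one v with hp | hp
  · have : IsUnit (v + 1) := parity_eq_one_iff.1 (by rw [map_add, hp, map_one, zero_add])
    have h5 : 2 * (2 * v) = 0 := by
      refine (this.mul_left_eq_zero).1 ?_
      linear_combination h4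
    rcases two_mul_eq_zero_iff.1 h5 with h | h
    · left; linear_combination hv + h
    · right; left; linear_combination hv + h
  · have h5 := ((parity_eq_one_iff.1 hp).mul_right_eq_zero).1 h4
    rcases two_mul_eq_zero_iff.1 h5 with h | h
    · right; right; left; linear_combination hv + h
    · right; right; right; linear_combination hv + h

theorem exists_unit_five {ℓ : ℕ} : ∃ f : (ZMod (2 ^ (ℓ + 1)))ˣ, (f : ZMod (2 ^ (ℓ + 1))) = 5 := by
  have : IsUnit (5 : ZMod (2 ^ (ℓ + 1))) := by
    apply parity_eq_one_iff.1; rw [map_ofNat]; rfl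
  exact ⟨this.unit, rfl⟩

/-- The involution in the cyclic group of units generated by `5`. -/
theorem five_pow {ℓ : ℕ} (hℓ : 2 ≤ ℓ) : (5 : ZMod (2 ^ (ℓ + 1))) ^ 2 ^ (ℓ - 2) = 1 + 2 ^ ℓ := by
  obtain ⟨m, rfl⟩ := Nat.exists_eq_add_of_le' hℓ
  have h5 := ZMod.orderOf_five (m + 1)
  simp only [Nat.add_sub_cancel]
  have h1 : (5 : ZMod (2 ^ (m + 2 + 1))) ^ 2 ^ m * 5 ^ 2 ^ m = 1 := by
    rw [← pow_add, ← two_mul, ← pow_succ', ← h5]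
    exact pow_orderOf_eq_one _
  have h2 : (5 : ZMod (2 ^ (m + 2 + 1))) ^ 2 ^ m ≠ 1 := by
    intro h
    have := orderOf_dvd_of_pow_eq_one h
    rw [show orderOf (5 : ZMod (2 ^ (m + 2 + 1))) = 2 ^ (m + 1) from h5] at this
    have := (Nat.pow_dvd_pow_iff_le_right (by norm_num)).1 this
    omega
  -- modulo `4` every power of `5` is `1`
  have h3 : ∃ y, (5 : ZMod (2 ^ (m + 2 + 1))) ^ 2 ^ m = 1 + 4 * y := by
    have : ∀ k : ℕ, ∃ y, (5 : ZMod (2 ^ (m + 2 + 1))) ^ k = 1 + 4 * y := by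
      intro k
      induction k with
      | zero => exact ⟨0, by simp⟩
      | succ k ih => obtain ⟨y, hy⟩ := ih; exact ⟨1 + 5 * y, by linear_combination 5 * hy⟩
    exact this _
  have h8 : (2 : ZMod (2 ^ (m + 2 + 1))) ≠ 0 := two_ne_zero_of_pos (by omega)
  obtain ⟨y, hy⟩ := h3
  have h4 := four_ne_zero_of_two_le (ℓ := m + 2) (by omega)
  have key : ∀ w, (4 * w : ZMod (2 ^ (m + 2 + 1))) ≠ 2 ∧ (4 * w : ZMod (2 ^ (m + 2 + 1))) ≠ -2 := by
    intro w
    constructor <;> intro h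
    · have : 2 * (2 * w - 1) = 0 := by linear_combination h
      have hu : IsUnit (2 * w - 1) := parity_eq_one_iff.1 (by simp [parity_two])
      exact h8 ((hu.mul_left_eq_zero).1 this)
    · have : 2 * (2 * w + 1) = 0 := by linear_combination h
      have hu : IsUnit (2 * w + 1) := parity_eq_one_iff.1 (by simp [parity_two])
      exact h8 ((hu.mul_left_eq_zero).1 this)
  rcases sq_eq_one_cases h1 with h | h | h | h
  · exact absurd h h2
  · exact h
  · exact absurd (by linear_combination h - hy) (key y).2
  · exfalso
    obtain ⟨t, ht⟩ : ∃ t, (2 : ZMod (2 ^ (m + 2 + 1))) ^ (m + 2) = 4 * t := ⟨2 ^ m, by ring⟩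
    exact (key (y - t)).2 (by linear_combination h - hy + ht)

/-! ### Homomorphisms out of a cyclic group -/

/-- The homomorphism from the cyclic group of order `n` that sends the generator to `g`. -/
def cycHom {H : Type*} [Group H] {n : ℕ} (g : H) (hg : g ^ n = 1) : Cyc n →* H :=
  AddMonoidHom.toMultiplicativeLeft (ZMod.lift n ⟨zmultiplesHom (Additive H) (Additive.ofMul g), by
    simp [← ofMul_pow, hg]⟩)

theorem cycHom_natCast {H : Type*} [Group H] {n : ℕ} (g : H) (hg : g ^ n = 1) (k : ℕ) :
    cycHom g hg (Multiplicative.ofAdd (k : ZMod n)) = g ^ k := by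
  have := ZMod.lift_coe n (⟨zmultiplesHom (Additive H) (Additive.ofMul g), by
    simp [← ofMul_pow, hg]⟩ : { f : ℤ →+ Additive H // f n = 0 }) (k : ℤ)
  simp only [Int.cast_natCast] at this
  change Additive.toMul (ZMod.lift n _ (k : ZMod n)) = _
  rw [this]
  simp

theorem cycHom_one {H : Type*} [Group H] {n : ℕ} (g : H) (hg : g ^ n = 1) :
    cycHom g hg (Multiplicative.ofAdd (1 : ZMod n)) = g := by
  have := cycHom_natCast g hg 1
  simpa using this

theorem cycHom_injective {H : Type*} [Group H] {n : ℕ} [NeZero n] (g : H) (hg : g ^ n = 1)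
    (ho : orderOf g = n) : Function.Injective (cycHom g hg) := by
  rw [injective_iff_map_eq_one]
  intro x hx
  obtain ⟨k, hk⟩ := ZMod.natCast_zmod_surjective x.toAdd
  have hx' : x = Multiplicative.ofAdd (k : ZMod n) := by rw [hk]; rfl
  rw [hx', cycHom_natCast] at hx
  rw [hx', (ZMod.natCast_eq_zero_iff k n).2 (ho ▸ orderOf_dvd_of_pow_eq_one hx)]
  rfl

theorem cyc_two_cases (y : Cyc 2) : y = 1 ∨ y = Multiplicative.ofAdd 1 := by
  revert y; decide

theorem cyc_two_mul_self (y : Cyc 2) : y * y = 1 := by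
  revert y; decide

theorem card_cyc (n : ℕ) : Nat.card (Cyc n) = n := by
  rw [Nat.card_congr Multiplicative.toAdd, Nat.card_zmod]

theorem card_units_two_pow (ℓ : ℕ) : Nat.card (ZMod (2 ^ (ℓ + 1)))ˣ = 2 ^ ℓ := by
  rw [Nat.card_eq_fintype_card, ZMod.card_units_eq_totient, Nat.totient_prime_pow_succ Nat.prime_two]
  simp

theorem card_mulAut_cyc_two_pow (ℓ : ℕ) : Nat.card (MulAut (Cyc (2 ^ (ℓ + 1)))) = 2 ^ ℓ := by
  rw [Nat.card_congr (autCyc _).toEquiv, card_units_two_pow]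

/-- Modulo `2 ^ (ℓ + 1)`, `ℓ ≥ 1`, the units are the product of the cyclic group generated by `5`,
of order `2 ^ (ℓ - 1)`, and the group generated by `-1`. -/
theorem units_bijective {ℓ : ℕ} (hℓ : 1 ≤ ℓ) (v : (ZMod (2 ^ (ℓ + 1)))ˣ)
    (hv : (v : ZMod (2 ^ (ℓ + 1))) = 5) :
    ∃ h5 : v ^ 2 ^ (ℓ - 1) = 1,
    Function.Bijective ((cycHom v h5).coprod (cycHom (n := 2) (-1 : (ZMod (2 ^ (ℓ + 1)))ˣ) (by simp))) := by
  obtain ⟨m, rfl⟩ := Nat.exists_eq_add_of_le' hℓ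
  have ho : orderOf v = 2 ^ m := by
    rw [← orderOf_units, hv]; exact ZMod.orderOf_five m
  have h5 : v ^ 2 ^ (m + 1 - 1) = 1 := by
    rw [Nat.add_sub_cancel, ← ho]; exact pow_orderOf_eq_one v
  refine ⟨h5, ?_⟩
  rw [Nat.bijective_iff_injective_and_card]
  refine ⟨?_, ?_⟩
  · rw [injective_iff_map_eq_one]
    rintro ⟨x, y⟩ hxy
    simp only [MonoidHom.coprod_apply] at hxy
    obtain ⟨k, hk⟩ := ZMod.natCast_zmod_surjective x.toAdd
    have hx' : x = Multiplicative.ofAdd (k : ZMod (2 ^ (m + 1 - 1))) := by rw [hk]; rfl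
    rcases cyc_two_cases y with rfl | rfl
    · rw [map_one, mul_one] at hxy
      have := cycHom_injective v h5 ho (hxy.trans (map_one _).symm)
      rw [this]; rfl
    · exfalso
      rw [hx', cycHom_natCast, cycHom_one] at hxy
      have h1 : (5 : ZMod (2 ^ (m + 1 + 1))) ^ k * (-1) = 1 := by
        rw [← hv]; simpa using congrArg Units.val hxy
      -- modulo `4` this says `-1 = 1`
      have h2 := congrArg (ZMod.castHom (show 4 ∣ 2 ^ (m + 1 + 1) from ⟨2 ^ m, by ring⟩) (ZMod 4)) h1
      rw [map_mul, map_pow, map_ofNat, show (OfNat.ofNat 5 : ZMod 4) = 1 from rfl, one_pow, one_mul,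
        map_neg, map_one] at h2
      revert h2; decide
  · rw [Nat.card_prod, card_cyc, card_cyc, card_units_two_pow, Nat.add_sub_cancel, pow_succ]

/-! ### Extensions by a group of order two -/

/-- `G` is an extension of `M` by a group of order `2`: `i` embeds `M` in `G`, the image is a
subgroup of index `2` and `c` is an element outside of it, acting on `M` as `τ` and with
square `s`. -/
structure IsTwoExt {M G : Type*} [Group M] [Group G] (i : M →* G) (c : G) (τ : M → M) (s : M) :
    Prop where
  inj : Function.Injective i
  conj : ∀ m, c * i m = i (τ m) * c
  sq : c * c = i s
  ne : ∀ m, i m ≠ c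
  cover : ∀ g, (∃ m, g = i m) ∨ ∃ m, g = i m * c

namespace IsTwoExt

variable {M G : Type*} [Group M] [Group G] {i : M →* G} {c : G} {τ : M → M} {s : M}

theorem ne_mul (h : IsTwoExt i c τ s) (m m' : M) : i m ≠ i m' * c := fun he =>
  h.ne (m'⁻¹ * m) (by rw [map_mul, map_inv, he, inv_mul_cancel_left])

theorem mulMc (_ : IsTwoExt i c τ s) (m m' : M) : i m * (i m' * c) = i (m * m') * c := by
  rw [map_mul, mul_assoc]

theorem mulcM (h : IsTwoExt i c τ s) (m m' : M) : i m * c * i m' = i (m * τ m') * c := by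
  rw [mul_assoc, h.conj, ← mul_assoc, map_mul]

theorem mulcc (h : IsTwoExt i c τ s) (m m' : M) : i m * c * (i m' * c) = i (m * τ m' * s) := by
  rw [← mul_assoc, h.mulcM, mul_assoc, h.sq, ← map_mul]

theorem inj_iff (h : IsTwoExt i c τ s) {m m' : M} : i m = i m' ↔ m = m' := h.inj.eq_iff

theorem mul_c_inj (h : IsTwoExt i c τ s) {m m' : M} : i m * c = i m' * c ↔ m = m' := by
  rw [mul_left_inj, h.inj_iff]

/-- An extension by a group of order two is determined by its data: a homomorphism on `M` and a
compatible image of `c` extend to `G`. -/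
theorem exists_hom (h : IsTwoExt i c τ s) {H : Type*} [Group H] (f : M →* H) (C : H)
    (hconj : ∀ m, C * f m = f (τ m) * C) (hsq : C * C = f s) :
    ∃ F : G →* H, (∀ m, F (i m) = f m) ∧ F c = C := by
  classical
  have hex : ∀ g : G, ∃ x : H, (∀ m, g = i m → x = f m) ∧ ∀ m, g = i m * c → x = f m * C := by
    intro g
    rcases h.cover g with ⟨m, rfl⟩ | ⟨m, rfl⟩
    · exact ⟨f m, fun m' hm => by rw [h.inj hm], fun m' hm => absurd hm (h.ne_mul _ _)⟩
    · refine ⟨f m * C, fun m' hm => absurd hm.symm (h.ne_mul _ _), fun m' hm => ?_⟩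
      rw [h.inj (mul_right_cancel hm)]
  choose F hF using hex
  have h1 : ∀ m, F (i m) = f m := fun m => (hF _).1 m rfl
  have h2 : ∀ m, F (i m * c) = f m * C := fun m => (hF _).2 m rfl
  refine ⟨MonoidHom.mk' F ?_, h1, ?_⟩
  · intro g g'
    rcases h.cover g with ⟨m, rfl⟩ | ⟨m, rfl⟩ <;> rcases h.cover g' with ⟨m', rfl⟩ | ⟨m', rfl⟩
    · rw [← map_mul, h1, h1, h1, map_mul]
    · rw [← mul_assoc, ← map_mul, h1, h2, h2, map_mul, mul_assoc]
    · rw [mul_assoc, h.conj, ← mul_assoc, ← map_mul, h2, h2, h1, map_mul, mul_assoc, ← hconj,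
        mul_assoc]
    · have : i m * c * (i m' * c) = i (m * τ m' * s) := by
        rw [map_mul, map_mul, ← h.sq, mul_assoc (i m), ← mul_assoc c, h.conj]
        simp only [mul_assoc]
      rw [this, h1, h2, h2, map_mul, map_mul, ← hsq, mul_assoc (f m) C, ← mul_assoc C, hconj]
      simp only [mul_assoc]
  · have := h2 1
    rw [map_one, map_one, one_mul, one_mul] at this
    exact this

theorem hom_ext (h : IsTwoExt i c τ s) {H : Type*} [Group H] {F F' : G →* H}
    (h1 : ∀ m, F (i m) = F' (i m)) (h2 : F c = F' c) : F = F' := by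
  ext g
  rcases h.cover g with ⟨m, rfl⟩ | ⟨m, rfl⟩
  · exact h1 m
  · rw [map_mul, map_mul, h1, h2]

/-- Extensions with the same data are isomorphic. -/
theorem nonempty_mulEquiv (h : IsTwoExt i c τ s) {G' : Type*} [Group G'] {i' : M →* G'} {c' : G'}
    (h' : IsTwoExt i' c' τ s) : Nonempty (G ≃* G') := by
  obtain ⟨F, hF, hc⟩ := h.exists_hom i' c' h'.conj h'.sq
  obtain ⟨F', hF', hc'⟩ := h'.exists_hom i c h.conj h.sq
  exact ⟨MonoidHom.toMulEquiv F F' (h.hom_ext (fun m => by simp [hF, hF']) (by simp [hc, hc']))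
    (h'.hom_ext (fun m => by simp [hF, hF']) (by simp [hc, hc']))⟩

/-- Transport along an isomorphism. -/
theorem map (h : IsTwoExt i c τ s) {G' : Type*} [Group G'] (e : G ≃* G') :
    IsTwoExt (e.toMonoidHom.comp i) (e c) τ s where
  inj := e.injective.comp h.inj
  conj m := by simp [← map_mul, h.conj]
  sq := by simp [← map_mul, h.sq]
  ne m := by simpa using h.ne m
  cover g := by
    rcases h.cover (e.symm g) with ⟨m, hm⟩ | ⟨m, hm⟩
    · exact Or.inl ⟨m, by simp [← hm]⟩
    · exact Or.inr ⟨m, by simp [← map_mul, ← hm]⟩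

end IsTwoExt

/-- A subgroup of index two that is identified with `M` presents `G` as an extension. -/
theorem isTwoExt_of_index_two {M G : Type*} [Group M] [Group G] {K : Subgroup G} (hK : K.index = 2)
    (e : M ≃* K) {c : G} (hc : c ∉ K) :
    ∃ (τ : M ≃* M) (s : M), IsTwoExt (K.subtype.comp e.toMonoidHom) c τ s := by
  have : K.Normal := Subgroup.normal_of_index_eq_two hK
  refine ⟨e.trans ((MulAut.conjNormal c).trans e.symm),
    e.symm ⟨c * c, Subgroup.mul_self_mem_of_index_two hK c⟩, ?_, ?_, ?_, ?_, ?_⟩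
  · exact K.subtype_injective.comp e.injective
  · intro m; simp
  · simp
  · intro m hm
    apply hc
    rw [← hm]
    exact (e m).2
  · intro g
    by_cases hg : g ∈ K
    · exact Or.inl ⟨e.symm ⟨g, hg⟩, by simp⟩
    · right
      have : g * c⁻¹ ∈ K := by
        rw [Subgroup.mul_mem_iff_of_index_two hK, inv_mem_iff]; tauto
      exact ⟨e.symm ⟨_, this⟩, by simp⟩

/-! ### Groups with a cyclic subgroup of index two -/

/-- `G` is the union of a cyclic subgroup `{E x}` of order `n`, parametrized by `ZMod n`, and its
coset `{E x * b}`, where `b` acts on the cyclic subgroup as the power map with exponent `u` and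
`b ^ 2 = E s`. -/
structure IsCyclicExt {G : Type*} [Group G] {n : ℕ} (E : ZMod n → G) (b : G) (u s : ZMod n) :
    Prop where
  add : ∀ x y, E (x + y) = E x * E y
  inj : Function.Injective E
  conj : ∀ x, b * E x = E (u * x) * b
  sq : b * b = E s
  ne : ∀ x, E x ≠ b
  cover : ∀ g, (∃ x, g = E x) ∨ ∃ x, g = E x * b

namespace IsCyclicExt

variable {G : Type*} [Group G] {n : ℕ} {E : ZMod n → G} {b : G} {u s : ZMod n}

theorem zero (h : IsCyclicExt E b u s) : E 0 = 1 := by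
  have := h.add 0 0
  rwa [add_zero, left_eq_mul] at this

theorem neg (h : IsCyclicExt E b u s) (x : ZMod n) : E (-x) = (E x)⁻¹ := by
  rw [eq_inv_iff_mul_eq_one, ← h.add, neg_add_cancel, h.zero]

/-- The parametrization as a homomorphism. -/
def hom (h : IsCyclicExt E b u s) : Cyc n →* G where
  toFun x := E x.toAdd
  map_one' := h.zero
  map_mul' _ _ := h.add _ _

theorem isTwoExt (h : IsCyclicExt E b u s) :
    IsTwoExt h.hom b (fun x => Multiplicative.ofAdd (u * x.toAdd)) (Multiplicative.ofAdd s) where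
  inj _ _ hxy := h.inj hxy
  conj _ := h.conj _
  sq := h.sq
  ne _ := h.ne _
  cover g := h.cover g

theorem mulE (h : IsCyclicExt E b u s) (x y : ZMod n) : E x * E y = E (x + y) := (h.add x y).symm

theorem mulEb (h : IsCyclicExt E b u s) (x y : ZMod n) : E x * (E y * b) = E (x + y) * b := by
  rw [← mul_assoc, h.add]

theorem mulbE (h : IsCyclicExt E b u s) (x y : ZMod n) : E x * b * E y = E (x + u * y) * b := by
  rw [mul_assoc, h.conj, ← mul_assoc, h.add]

theorem mulbb (h : IsCyclicExt E b u s) (x y : ZMod n) :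
    E x * b * (E y * b) = E (x + u * y + s) := by
  rw [← mul_assoc, h.mulbE, mul_assoc, h.sq, h.mulE]

theorem ne_mul (h : IsCyclicExt E b u s) (x y : ZMod n) : E x ≠ E y * b := fun he =>
  h.ne (-y + x) (by rw [h.add, he, ← mul_assoc, ← h.add, neg_add_cancel, h.zero, one_mul])

theorem mul_b_inj (h : IsCyclicExt E b u s) {x y : ZMod n} : E x * b = E y * b ↔ x = y :=
  ⟨fun he => h.inj (mul_right_cancel he), fun he => by rw [he]⟩

theorem inj_iff (h : IsCyclicExt E b u s) {x y : ZMod n} : E x = E y ↔ x = y := h.inj.eq_iff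

theorem eq_one_iff (h : IsCyclicExt E b u s) {x : ZMod n} : E x = 1 ↔ x = 0 := by
  rw [← h.zero, h.inj_iff]

theorem mul_b_ne_one (h : IsCyclicExt E b u s) {x : ZMod n} : E x * b ≠ 1 := by
  rw [← h.zero]; exact (h.ne_mul _ _).symm

theorem b_eq (h : IsCyclicExt E b u s) : E 0 * b = b := by rw [h.zero, one_mul]

theorem pow (h : IsCyclicExt E b u s) (x : ZMod n) (k : ℕ) : E x ^ k = E (k * x) := by
  induction k with
  | zero => simp [h.zero]
  | succ k ih => rw [pow_succ, ih, h.mulE]; congr 1; push_cast; ring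

/-- A homomorphism from `G` is given by images `f x` of the elements of the cyclic subgroup and
a compatible image of `b`. -/
theorem exists_hom (h : IsCyclicExt E b u s) {H : Type*} [Group H] (f : ZMod n → H)
    (hf : ∀ x y, f (x + y) = f x * f y) (B : H) (hconj : ∀ x, B * f x = f (u * x) * B)
    (hsq : B * B = f s) : ∃ F : G →* H, (∀ x, F (E x) = f x) ∧ F b = B := by
  have f0 : f 0 = 1 := by
    have := hf 0 0
    rwa [add_zero, left_eq_mul] at this
  obtain ⟨F, h1, h2⟩ := h.isTwoExt.exists_hom (H := H)
    ⟨⟨fun x => f x.toAdd, f0⟩, fun x y => hf _ _⟩ B (fun x => hconj _) hsq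
  exact ⟨F, fun x => h1 (Multiplicative.ofAdd x), h2⟩

theorem nonempty_mulEquiv (h : IsCyclicExt E b u s) {G' : Type*} [Group G'] {E' : ZMod n → G'}
    {b' : G'} (h' : IsCyclicExt E' b' u s) : Nonempty (G ≃* G') :=
  h.isTwoExt.nonempty_mulEquiv h'.isTwoExt

theorem map (h : IsCyclicExt E b u s) {G' : Type*} [Group G'] (e : G ≃* G') :
    IsCyclicExt (fun x => e (E x)) (e b) u s where
  add x y := by rw [h.add, map_mul]
  inj := e.injective.comp h.inj
  conj x := by rw [← map_mul, ← map_mul, h.conj]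
  sq := by rw [← map_mul, h.sq]
  ne x := by simpa using h.ne x
  cover g := by
    rcases h.cover (e.symm g) with ⟨m, hm⟩ | ⟨m, hm⟩
    · exact Or.inl ⟨m, by simp [← hm]⟩
    · exact Or.inr ⟨m, by simp [← map_mul, ← hm]⟩

/-- The element outside of the cyclic subgroup may be multiplied by an element of it. -/
theorem change (h : IsCyclicExt E b u s) (t : ZMod n) :
    IsCyclicExt E (E t * b) u (t + u * t + s) where
  add := h.add
  inj := h.inj
  conj x := by rw [h.mulbE, h.mulEb, add_comm]
  sq := h.mulbb t t
  ne x := h.ne_mul _ _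
  cover g := by
    rcases h.cover g with h1 | ⟨m, rfl⟩
    · exact Or.inl h1
    · exact Or.inr ⟨m - t, by rw [h.mulEb, sub_add_cancel]⟩

/-- `b ^ 2` lies in the cyclic subgroup, hence acts trivially on it. -/
theorem mul_self_u (h : IsCyclicExt E b u s) : u * u = 1 := by
  have h1 : b * (b * E 1) = b * b * E 1 := by rw [mul_assoc]
  rw [h.conj, ← mul_assoc, h.conj, mul_assoc, h.sq, h.mulE, h.mulE, h.inj_iff] at h1
  linear_combination h1

theorem u_mul_s (h : IsCyclicExt E b u s) : u * s = s := by
  have h1 : b * (b * b) = b * b * b := by rw [mul_assoc]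
  rw [h.sq, h.conj, h.mul_b_inj] at h1
  exact h1

theorem card (h : IsCyclicExt E b u s) [NeZero n] : Nat.card G = 2 * n := by
  have : Function.Bijective (fun x : ZMod n ⊕ ZMod n => Sum.elim E (fun x => E x * b) x) := by
    constructor
    · rintro (x | x) (y | y) hxy
      · exact congrArg _ (h.inj hxy)
      · exact absurd hxy (h.ne_mul _ _)
      · exact absurd hxy.symm (h.ne_mul _ _)
      · exact congrArg _ (h.mul_b_inj.1 hxy)
    · intro g
      rcases h.cover g with ⟨x, rfl⟩ | ⟨x, rfl⟩
      · exact ⟨Sum.inl x, rfl⟩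
      · exact ⟨Sum.inr x, rfl⟩
  rw [← Nat.card_congr (Equiv.ofBijective _ this), Nat.card_sum, Nat.card_zmod, two_mul]

theorem finite (h : IsCyclicExt E b u s) [NeZero n] : Finite G := by
  apply Nat.finite_of_card_ne_zero
  rw [h.card]
  exact mul_ne_zero two_ne_zero (NeZero.ne n)

end IsCyclicExt

/-! ### Automorphism groups from the images of generators -/

/-- A group `A` acts on `G` as soon as the images `p t` of a system of generators `gen` under the
elements `t` of `A` are prescribed consistently. -/
theorem exists_hom_mulAut {G A ι : Type*} [Group G] [Group A] (gen : ι → G)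
    (hgen : ∀ F F' : G →* G, (∀ j, F (gen j) = F' (gen j)) → F = F') (p : A → ι → G)
    (hp : ∀ t, ∃ F : G →* G, ∀ j, F (gen j) = p t j) (h1 : p 1 = gen)
    (hmul : ∀ (t t' : A) (F : G →* G), (∀ j, F (gen j) = p t j) → ∀ j, F (p t' j) = p (t * t') j) :
    ∃ Ψ : A →* MulAut G, ∀ t j, Ψ t (gen j) = p t j := by
  choose F hF using hp
  have hcomp : ∀ t t', (F t).comp (F t') = F (t * t') := fun t t' => hgen _ _ fun j => by
    rw [MonoidHom.comp_apply, hF, hmul t t' _ (hF t), hF]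
  have hone : F 1 = MonoidHom.id G := hgen _ _ fun j => by rw [hF, h1, MonoidHom.id_apply]
  let Ψ : A → MulAut G := fun t => MonoidHom.toMulEquiv (F t) (F t⁻¹)
    (by rw [hcomp, inv_mul_cancel, hone]) (by rw [hcomp, mul_inv_cancel, hone])
  refine ⟨MonoidHom.mk' Ψ fun t t' => ?_, fun t j => hF t j⟩
  ext g
  exact (DFunLike.congr_fun (hcomp t t') g).symm

/-- If every automorphism of `G` sends the generators to exactly one of the prescribed systems,
then `MulAut G ≃* A`. -/
theorem nonempty_mulAut_mulEquiv {G A ι : Type*} [Group G] [Group A] (gen : ι → G)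
    (hgen : ∀ F F' : G →* G, (∀ j, F (gen j) = F' (gen j)) → F = F') (p : A → ι → G)
    (hp : ∀ t, ∃ F : G →* G, ∀ j, F (gen j) = p t j) (h1 : p 1 = gen)
    (hmul : ∀ (t t' : A) (F : G →* G), (∀ j, F (gen j) = p t j) → ∀ j, F (p t' j) = p (t * t') j)
    (hinj : ∀ t, p t = gen → t = 1) (hsurj : ∀ f : MulAut G, ∃ t, ∀ j, f (gen j) = p t j) :
    Nonempty (MulAut G ≃* A) := by
  obtain ⟨Ψ, hΨ⟩ := exists_hom_mulAut gen hgen p hp h1 hmul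
  refine ⟨(MulEquiv.ofBijective Ψ ⟨?_, ?_⟩).symm⟩
  · rw [injective_iff_map_eq_one]
    intro t ht
    apply hinj
    ext j
    rw [← hΨ, ht, MulAut.one_apply]
  · intro f
    obtain ⟨t, ht⟩ := hsurj f
    refine ⟨t, ?_⟩
    have := hgen (Ψ t).toMonoidHom f.toMonoidHom fun j => (hΨ t j).trans (ht j).symm
    ext g
    exact DFunLike.congr_fun this g

/-! ### The listed groups as extensions of cyclic groups -/

theorem isCyclicExt_prod (n : ℕ) :
    IsCyclicExt (n := n) (fun x => ((Multiplicative.ofAdd x, 1) : Cyc n × Cyc 2))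
      (1, Multiplicative.ofAdd 1) 1 0 where
  add x y := by simp
  inj x y h := by simpa using h
  conj x := by simp
  sq := by
    ext
    · simp
    · simp only [Prod.snd_mul]; decide
  ne x h := by
    have := congrArg Prod.snd h
    revert this
    dsimp only
    decide
  cover := by
    rintro ⟨x, y⟩
    rcases cyc_two_cases y with rfl | rfl
    · exact Or.inl ⟨x.toAdd, rfl⟩
    · exact Or.inr ⟨x.toAdd, by simp⟩

theorem isCyclicExt_dihedralGroup (n : ℕ) :
    IsCyclicExt (DihedralGroup.r (n := n)) (DihedralGroup.sr 0) (-1) 0 where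
  add x y := by simp
  inj x y h := by simpa using h
  conj x := by simp
  sq := by simp
  ne x := by simp
  cover := by
    rintro (x | x)
    · exact Or.inl ⟨x, rfl⟩
    · exact Or.inr ⟨-x, by simp⟩

/-- A split extension: `b` is the generator of the complement. -/
theorem isCyclicExt_semidirect {n : ℕ} (φ : Cyc 2 →* MulAut (Cyc n)) (v : ZMod n)
    (hφ : ∀ x, φ (Multiplicative.ofAdd 1) (Multiplicative.ofAdd x) = Multiplicative.ofAdd (v * x)) :
    IsCyclicExt (n := n) (G := Cyc n ⋊[φ] Cyc 2)
      (fun x => SemidirectProduct.inl (Multiplicative.ofAdd x))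
      (SemidirectProduct.inr (Multiplicative.ofAdd 1)) v 0 where
  add x y := by simp
  inj x y h := by simpa using h
  conj x := by
    ext
    · simp [hφ]
    · simp
  sq := by
    ext
    · simp
    · rw [SemidirectProduct.mul_right, SemidirectProduct.right_inr, SemidirectProduct.right_inl]
      rfl
  ne x h := by
    have := congrArg SemidirectProduct.right h
    rw [SemidirectProduct.right_inr, SemidirectProduct.right_inl] at this
    revert this
    decide
  cover := by
    rintro ⟨x, y⟩
    rcases cyc_two_cases y with rfl | rfl
    · exact Or.inl ⟨x.toAdd, rfl⟩
    · refine Or.inr ⟨x.toAdd, ?_⟩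
      ext <;> simp

theorem autCyc_involutionHom {n : ℕ} (v : (ZMod n)ˣ) (hv : v ^ 2 = 1) (x : ZMod n) :
    (autCyc n).symm.toMonoidHom.comp (involutionHom v hv) (Multiplicative.ofAdd 1)
      (Multiplicative.ofAdd x) = Multiplicative.ofAdd ((v : ZMod n) * x) := by
  rw [MonoidHom.comp_apply, involutionHom_gen]
  rfl

theorem isCyclicExt_semiDihedral (ℓ : ℕ) (hℓ : 2 ≤ ℓ) :
    IsCyclicExt (n := 2 ^ (ℓ + 1)) (G := SemiDihedral ℓ hℓ)
      (fun x => SemidirectProduct.inl (Multiplicative.ofAdd x))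
      (SemidirectProduct.inr (Multiplicative.ofAdd 1)) (2 ^ ℓ - 1) 0 :=
  isCyclicExt_semidirect _ _ (autCyc_involutionHom _ (semidihedralUnit_sq ℓ hℓ))

theorem isCyclicExt_modularGrp (ℓ : ℕ) (hℓ : 2 ≤ ℓ) :
    IsCyclicExt (n := 2 ^ (ℓ + 1)) (G := ModularGrp ℓ hℓ)
      (fun x => SemidirectProduct.inl (Multiplicative.ofAdd x))
      (SemidirectProduct.inr (Multiplicative.ofAdd 1)) (2 ^ ℓ + 1) 0 :=
  isCyclicExt_semidirect _ _ (autCyc_involutionHom _ (modularUnit_sq ℓ hℓ))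

theorem isCyclicExt_quaternionGroup {n m : ℕ} (hn : n = 2 * m) :
    IsCyclicExt (n := n) (fun x => QuaternionGroup.a (ZMod.ringEquivCongr hn x))
      (QuaternionGroup.xa 0) (-1) m where
  add x y := by simp
  inj x y h := by simpa using h
  conj x := by simp
  sq := by simp
  ne x := by simp
  cover := by
    rintro (x | x)
    · exact Or.inl ⟨(ZMod.ringEquivCongr hn).symm x, by simp⟩
    · exact Or.inr ⟨(ZMod.ringEquivCongr hn).symm (-x), by simp⟩

theorem isCyclicExt_quaternionGroup_two_pow (ℓ : ℕ) :
    IsCyclicExt (n := 2 ^ (ℓ + 1))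
      (fun x => QuaternionGroup.a (n := 2 ^ ℓ) (ZMod.ringEquivCongr (pow_succ' 2 ℓ) x))
      (QuaternionGroup.xa 0) (-1) (2 ^ ℓ) := by
  have := isCyclicExt_quaternionGroup (pow_succ' 2 ℓ)
  push_cast at this
  exact this

/-! ### Generating triples and pairs -/

section Generation

variable {G : Type*} [Group G]

theorem orderOf_eq_two_iff' {x : G} : orderOf x = 2 ↔ x * x = 1 ∧ x ≠ 1 := by
  rw [orderOf_eq_prime_iff, sq]

/-- A subset of `G` on which a nontrivial homomorphism vanishes does not generate `G`. -/
theorem closure_ne_top {H : Type*} [Group H] (χ : G →* H) (hχ : χ ≠ 1) {s : Set G}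
    (hs : ∀ x ∈ s, χ x = 1) : Subgroup.closure s ≠ ⊤ := by
  intro h
  apply hχ
  have : Subgroup.closure s ≤ χ.ker := (Subgroup.closure_le _).2 hs
  rw [h, top_le_iff] at this
  ext g
  exact (this ▸ Subgroup.mem_top g : g ∈ χ.ker)

/-- A group with a nontrivial homomorphism killing all involutions is not generated by
involutions. -/
theorem not_hasReversingTriple {H : Type*} [Group H] (χ : G →* H) (hχ : χ ≠ 1)
    (h : ∀ x, x * x = 1 → χ x = 1) : ¬ HasReversingTriple G := by
  rintro ⟨x, y, z, hx, hy, hz, hc⟩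
  refine closure_ne_top χ hχ ?_ hc
  simp only [Set.mem_insert_iff, Set.mem_singleton_iff, forall_eq_or_imp, forall_eq]
  exact ⟨h _ (orderOf_eq_two_iff'.1 hx).1, h _ (orderOf_eq_two_iff'.1 hy).1,
    h _ (orderOf_eq_two_iff'.1 hz).1⟩

theorem HasRegularTriple.hasReversingTriple (h : HasRegularTriple G) : HasReversingTriple G := by
  obtain ⟨x, y, z, h, -⟩ := h
  exact ⟨x, y, z, h⟩

/-- Two distinct commuting involutions generate a Klein four-group. -/
theorem closure_pair_mulEquiv {x z : G} (hx : orderOf x = 2) (hz : orderOf z = 2)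
    (hxz : x * z = z * x) (hne : x ≠ z) :
    Nonempty (Subgroup.closure {x, z} ≃* Cyc 2 × Cyc 2) := by
  obtain ⟨hx1, hx2⟩ := orderOf_eq_two_iff'.1 hx
  obtain ⟨hz1, hz2⟩ := orderOf_eq_two_iff'.1 hz
  have hxp : x ^ 2 = 1 := by rw [sq, hx1]
  have hzp : z ^ 2 = 1 := by rw [sq, hz1]
  have hcomm : ∀ (m n : Cyc 2), Commute (cycHom x hxp m) (cycHom z hzp n) := by
    intro m n
    rcases cyc_two_cases m with rfl | rfl <;> rcases cyc_two_cases n with rfl | rfl <;>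
      simp only [map_one, cycHom_one, Commute.one_left, Commute.one_right]
    exact hxz
  let f : Cyc 2 × Cyc 2 →* G := MonoidHom.noncommCoprod _ _ hcomm
  have hf : Function.Injective f := by
    rw [injective_iff_map_eq_one]
    rintro ⟨m, n⟩ hmn
    rcases cyc_two_cases m with rfl | rfl <;> rcases cyc_two_cases n with rfl | rfl <;>
      simp only [f, MonoidHom.noncommCoprod_apply, map_one, cycHom_one, one_mul, mul_one] at hmn
    · rfl
    · exact absurd hmn hz2
    · exact absurd hmn hx2
    · exact absurd (hmn.trans hz1.symm) (by simpa using hne)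
  have hr : f.range = Subgroup.closure {x, z} := by
    apply le_antisymm
    · rintro _ ⟨⟨m, n⟩, rfl⟩
      have hxm : x ∈ Subgroup.closure {x, z} := Subgroup.subset_closure (by simp)
      have hzm : z ∈ Subgroup.closure {x, z} := Subgroup.subset_closure (by simp)
      rcases cyc_two_cases m with rfl | rfl <;> rcases cyc_two_cases n with rfl | rfl <;>
        simp [f, MonoidHom.noncommCoprod_apply, cycHom_one, hxm, hzm, mul_mem hxm hzm]
    · rw [Subgroup.closure_le]
      rintro g (rfl | rfl)
      · exact ⟨(Multiplicative.ofAdd 1, 1), by simp [f, cycHom_one]⟩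
      · exact ⟨(1, Multiplicative.ofAdd 1), by simp [f, cycHom_one]⟩
  exact ⟨((MonoidHom.ofInjective hf).trans (MulEquiv.subgroupCongr hr)).symm⟩

theorem commute_of_closure_pair_mulEquiv {x z : G} (hx : orderOf x = 2)
    (h : Nonempty (Subgroup.closure {x, z} ≃* Cyc 2 × Cyc 2)) : x * z = z * x ∧ x ≠ z := by
  obtain ⟨e⟩ := h
  constructor
  · have hxm : x ∈ Subgroup.closure {x, z} := Subgroup.subset_closure (by simp)
    have hzm : z ∈ Subgroup.closure {x, z} := Subgroup.subset_closure (by simp)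
    have : e (⟨x, hxm⟩ * ⟨z, hzm⟩) = e (⟨z, hzm⟩ * ⟨x, hxm⟩) := by
      rw [map_mul, map_mul, mul_comm]
    exact congrArg Subtype.val (e.injective this)
  · rintro rfl
    have h1 := Nat.card_congr e.toEquiv
    rw [Nat.card_prod, card_cyc, Set.pair_eq_singleton, ← Subgroup.zpowers_eq_closure,
      Nat.card_zpowers, hx] at h1
    omega

theorem hasRegularTriple_of {x y z : G} (hx : orderOf x = 2) (hy : orderOf y = 2)
    (hz : orderOf z = 2) (hc : Subgroup.closure {x, y, z} = ⊤) (hxz : x * z = z * x) (hne : x ≠ z) :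
    HasRegularTriple G :=
  ⟨x, y, z, ⟨hx, hy, hz, hc⟩, closure_pair_mulEquiv hx hz hxz hne⟩

/-- For any two elements of an elementary abelian group of order eight there is a nontrivial
character vanishing on both. -/
theorem exists_character_pair (x y : Cyc 2 × Cyc 2 × Cyc 2) :
    ∃ χ : Cyc 2 × Cyc 2 × Cyc 2 →* Cyc 2, χ ≠ 1 ∧ χ x = 1 ∧ χ y = 1 := by
  have key : ∀ x y : Cyc 2 × Cyc 2 × Cyc 2, ∃ i j k : Fin 2,
      (∃ g : Cyc 2 × Cyc 2 × Cyc 2, g.1 ^ i.val * g.2.1 ^ j.val * g.2.2 ^ k.val ≠ 1) ∧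
      x.1 ^ i.val * x.2.1 ^ j.val * x.2.2 ^ k.val = 1 ∧
      y.1 ^ i.val * y.2.1 ^ j.val * y.2.2 ^ k.val = 1 := by decide
  obtain ⟨i, j, k, ⟨g, hg⟩, hx, hy⟩ := key x y
  refine ⟨⟨⟨fun g => g.1 ^ i.val * g.2.1 ^ j.val * g.2.2 ^ k.val, by simp⟩, fun g g' => ?_⟩,
    fun h => hg (DFunLike.congr_fun h g), hx, hy⟩
  simp only [Prod.fst_mul, Prod.snd_mul, mul_pow]
  rw [mul_mul_mul_comm (g.1 ^ i.val), mul_mul_mul_comm (g.1 ^ i.val * g.2.1 ^ j.val)]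

/-- A set with at most two nontrivial images in an elementary abelian quotient of order eight does
not generate the group. -/
theorem closure_ne_top_of_two {χ : G →* Cyc 2 × Cyc 2 × Cyc 2} (hχ : Function.Surjective χ)
    {s : Set G} (x y : Cyc 2 × Cyc 2 × Cyc 2) (hs : ∀ g ∈ s, χ g = x ∨ χ g = y ∨ χ g = 1) :
    Subgroup.closure s ≠ ⊤ := by
  obtain ⟨ψ, h1, hx, hy⟩ := exists_character_pair x y
  refine closure_ne_top (ψ.comp χ) (fun h => h1 ?_) fun g hg => ?_
  · ext1 t
    obtain ⟨g, rfl⟩ := hχ t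
    exact DFunLike.congr_fun h g
  · rcases hs g hg with h | h | h <;> simp [h, hx, hy]

theorem not_hasRotaryPair_of_surjective {χ : G →* Cyc 2 × Cyc 2 × Cyc 2}
    (hχ : Function.Surjective χ) : ¬ HasRotaryPair G := by
  rintro ⟨α, z, -, hc⟩
  refine closure_ne_top_of_two hχ (χ α) (χ z) ?_ hc
  simp

/-- A non-commutative group whose involutions are central has no rotary pair. -/
theorem not_hasRotaryPair_of_central (hz : ∀ z : G, orderOf z = 2 → ∀ g, g * z = z * g) (x y : G)
    (hxy : x * y ≠ y * x) : ¬ HasRotaryPair G := by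
  rintro ⟨α, z, h2, hc⟩
  have hα : ∀ g, g ∈ Subgroup.centralizer {α} := by
    intro g
    have : Subgroup.closure {α, z} ≤ Subgroup.centralizer {α} := by
      rw [Subgroup.closure_le]
      rintro g (rfl | rfl)
      · simp [Subgroup.mem_centralizer_iff]
      · simp [Subgroup.mem_centralizer_iff, hz _ h2]
    rw [hc] at this
    exact this (Subgroup.mem_top g)
  have hcen : Subgroup.closure {α, z} ≤ Subgroup.center G := by
    rw [Subgroup.closure_le]
    rintro g (rfl | rfl)
    · rw [SetLike.mem_coe, Subgroup.mem_center_iff]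
      intro g'
      have := hα g'
      rw [Subgroup.mem_centralizer_iff] at this
      exact (this _ rfl).symm
    · rw [SetLike.mem_coe, Subgroup.mem_center_iff]
      exact hz _ h2
  rw [hc] at hcen
  exact hxy (Subgroup.mem_center_iff.1 (hcen (Subgroup.mem_top y)) x)

end Generation

/-! ### Automorphism groups that are semidirect products -/

/-- The exponent of the power map `φ`. -/
def expo {n : ℕ} (φ : MulAut (Cyc n)) : ZMod n := ((autCyc n φ : (ZMod n)ˣ) : ZMod n)

theorem expo_mul {n : ℕ} (φ φ' : MulAut (Cyc n)) : expo (φ * φ') = expo φ * expo φ' := by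
  simp [expo]

theorem expo_one (n : ℕ) : expo (1 : MulAut (Cyc n)) = 1 := by simp [expo]

theorem expo_injective {n : ℕ} : Function.Injective (expo (n := n)) := fun _ _ h =>
  (autCyc n).injective (Units.ext h)

theorem exists_expo {n : ℕ} (v : (ZMod n)ˣ) : ∃ φ : MulAut (Cyc n), expo φ = v :=
  ⟨(autCyc n).symm v, by simp [expo]⟩

theorem toAdd_mulAut_apply {n : ℕ} (φ : MulAut (Cyc n)) (x : Cyc n) :
    (φ x).toAdd = expo φ * x.toAdd := by
  obtain ⟨v, rfl⟩ := (autCyc n).symm.surjective φ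
  simp only [expo, MulEquiv.apply_symm_apply]
  rfl

/-- Multiplication by two as an embedding of `ZMod (2 ^ ℓ)` in `ZMod (2 ^ (ℓ + 1))`. -/
def double (ℓ : ℕ) : ZMod (2 ^ ℓ) →+ ZMod (2 ^ (ℓ + 1)) :=
  ZMod.lift (2 ^ ℓ) ⟨zmultiplesHom _ 2, by simpa using two_pow_mul_two ℓ⟩

theorem double_natCast (ℓ k : ℕ) : double ℓ (k : ZMod (2 ^ ℓ)) = 2 * k := by
  have := ZMod.lift_coe (2 ^ ℓ) (⟨zmultiplesHom _ 2, by simpa using two_pow_mul_two ℓ⟩ :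
    { f : ℤ →+ ZMod (2 ^ (ℓ + 1)) // f (2 ^ ℓ : ℕ) = 0 }) (k : ℤ)
  simp only [Int.cast_natCast] at this
  rw [double, this]
  simp [mul_comm]

theorem double_injective (ℓ : ℕ) : Function.Injective (double ℓ) := by
  rw [injective_iff_map_eq_zero]
  intro x hx
  obtain ⟨k, rfl⟩ := ZMod.natCast_zmod_surjective x
  rw [double_natCast] at hx
  have h' : ((2 * k : ℕ) : ZMod (2 ^ (ℓ + 1))) = 0 := by exact_mod_cast hx
  rw [ZMod.natCast_eq_zero_iff, pow_succ', Nat.mul_dvd_mul_iff_left (by norm_num)] at h'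
  rwa [ZMod.natCast_eq_zero_iff]

theorem exists_double_iff {ℓ : ℕ} {x : ZMod (2 ^ (ℓ + 1))} :
    (∃ y, double ℓ y = x) ↔ parity ℓ x = 0 := by
  rw [parity_eq_zero_iff]
  constructor
  · rintro ⟨y, rfl⟩
    obtain ⟨k, rfl⟩ := ZMod.natCast_zmod_surjective y
    exact ⟨k, double_natCast ℓ k⟩
  · rintro ⟨y, rfl⟩
    obtain ⟨k, rfl⟩ := ZMod.natCast_zmod_surjective y
    exact ⟨k, double_natCast ℓ k⟩

theorem parity_double {ℓ : ℕ} (y : ZMod (2 ^ ℓ)) : parity ℓ (double ℓ y) = 0 :=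
  exists_double_iff.1 ⟨y, rfl⟩

theorem double_castHom_mul {ℓ : ℕ} (h : 2 ^ ℓ ∣ 2 ^ (ℓ + 1)) (v : ZMod (2 ^ (ℓ + 1)))
    (x : ZMod (2 ^ ℓ)) : double ℓ (ZMod.castHom h (ZMod (2 ^ ℓ)) v * x) = v * double ℓ x := by
  obtain ⟨k, rfl⟩ := ZMod.natCast_zmod_surjective x
  obtain ⟨w, rfl⟩ := ZMod.natCast_zmod_surjective v
  rw [map_natCast, ← Nat.cast_mul, double_natCast, double_natCast]
  push_cast
  ring

theorem double_powerAction {ℓ : ℕ} (φ : MulAut (Cyc (2 ^ (ℓ + 1)))) (x : Cyc (2 ^ ℓ)) :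
    double ℓ (powerAction (pow_dvd_pow 2 (Nat.le_succ ℓ)) φ x).toAdd =
      expo φ * double ℓ x.toAdd := by
  obtain ⟨v, rfl⟩ := (autCyc _).symm.surjective φ
  rw [← double_castHom_mul (pow_dvd_pow 2 (Nat.le_succ ℓ))]
  simp only [expo, MulEquiv.apply_symm_apply]
  exact congrArg _ (congrArg _ (powerAction_apply _ v x.toAdd))

theorem pow_four_eq {G : Type*} [Group G] (g : G) : g ^ 4 = g * g * (g * g) := by
  simp only [pow_succ, pow_zero, one_mul, mul_assoc]

namespace IsCyclicExt

variable {G : Type*} [Group G] {n : ℕ} {E : ZMod n → G} {b : G} {u s : ZMod n}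

theorem map_E [NeZero n] (h : IsCyclicExt E b u s) {f : G →* G} {v : ZMod n} (hf : f (E 1) = E v)
    (x : ZMod n) : f (E x) = E (v * x) := by
  obtain ⟨k, rfl⟩ := ZMod.natCast_zmod_surjective x
  have : E (k : ZMod n) = E 1 ^ k := by rw [h.pow, mul_one]
  rw [this, map_pow, hf, h.pow, mul_comm]

theorem hom_ext [NeZero n] (h : IsCyclicExt E b u s) {H : Type*} [Group H] {F F' : G →* H}
    (h1 : F (E 1) = F' (E 1)) (h2 : F b = F' b) : F = F' := by
  apply h.isTwoExt.hom_ext _ h2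
  intro x
  change F (E x.toAdd) = F' (E x.toAdd)
  obtain ⟨k, hk⟩ := ZMod.natCast_zmod_surjective x.toAdd
  have : E x.toAdd = E 1 ^ k := by rw [h.pow, mul_one, hk]
  rw [this, map_pow, map_pow, h1]

/-- If the `m`-th powers of the elements outside of the cyclic subgroup are trivial while that of
`E 1` is not, then the cyclic subgroup is characteristic. -/
theorem mulAut_apply [NeZero n] (h : IsCyclicExt E b u s) (m : ℕ) (hm : (m : ZMod n) ≠ 0)
    (hb : ∀ x, (E x * b) ^ m = 1) (f : MulAut G) :
    ∃ (v : (ZMod n)ˣ) (k : ZMod n), (∀ x, f (E x) = E (v * x)) ∧ f b = E k * b := by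
  have key : ∀ f : MulAut G, ∃ v, ∀ x, f (E x) = E (v * x) := by
    intro f
    rcases h.cover (f (E 1)) with ⟨v, hv⟩ | ⟨v, hv⟩
    · exact ⟨v, h.map_E (f := f.toMonoidHom) hv⟩
    · have h1 : f (E m) = 1 := by
        have : E (m : ZMod n) = E 1 ^ m := by rw [h.pow, mul_one]
        rw [this, map_pow, hv, hb]
      exact absurd (h.eq_one_iff.1 ((map_eq_one_iff f f.injective).1 h1)) hm
  obtain ⟨v, hv⟩ := key f
  obtain ⟨w, hw⟩ := key f⁻¹
  have hwv : w * v = 1 := by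
    have h1 : f⁻¹ (f (E 1)) = E 1 := by rw [← MulAut.mul_apply, inv_mul_cancel, MulAut.one_apply]
    rw [hv, hw, h.inj_iff, mul_one] at h1
    exact h1
  refine ⟨⟨v, w, by rw [mul_comm, hwv], hwv⟩, ?_⟩
  rcases h.cover (f b) with ⟨k, hk⟩ | ⟨k, hk⟩
  · have h1 : f⁻¹ (f b) = b := by rw [← MulAut.mul_apply, inv_mul_cancel, MulAut.one_apply]
    rw [hk, hw] at h1
    exact absurd h1 (h.ne _)
  · exact ⟨k, hv, hk⟩

/-- If the cyclic subgroup is characteristic, the automorphisms are the maps `E 1 ↦ E v`,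
`b ↦ E k * b` with `v` a unit and `k` such that `(E k * b) ^ 2 = b ^ 2`. These `k` form a group,
here parametrized by `δ`, on which the units act by multiplication. -/
theorem nonempty_mulAut_mulEquiv [NeZero n] (h : IsCyclicExt E b u s) (m : ℕ)
    (hm : (m : ZMod n) ≠ 0) (hb : ∀ x, (E x * b) ^ m = 1) (hs : ∀ v : (ZMod n)ˣ, (v : ZMod n) * s = s)
    {N : Type*} [Group N] (ψ : MulAut (Cyc n) →* MulAut N) (δ : N → ZMod n)
    (hδ : ∀ x y, δ (x * y) = δ x + δ y) (hinj : Function.Injective δ)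
    (hψ : ∀ φ x, δ (ψ φ x) = expo φ * δ x) (hr : ∀ k, (∃ x, δ x = k) ↔ k + u * k = 0) :
    Nonempty (MulAut G ≃* N ⋊[ψ] MulAut (Cyc n)) := by
  have δ1 : δ 1 = 0 := by
    have := hδ 1 1
    rwa [mul_one, left_eq_add] at this
  refine _root_.nonempty_mulAut_mulEquiv ![E 1, b] ?_
    (fun t => ![E (expo t.right), E (δ t.left) * b]) ?_ ?_ ?_ ?_ ?_
  · intro F F' hF
    exact h.hom_ext (hF 0) (hF 1)
  · intro t
    have hk := (hr _).1 ⟨t.left, rfl⟩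
    obtain ⟨F, h1, h2⟩ := h.exists_hom (fun x => E (expo t.right * x))
      (fun x y => by rw [mul_add, h.add]) (E (δ t.left) * b)
      (fun x => by rw [h.mulbE, h.mulEb, add_comm]; congr 3; ring)
      (by rw [h.mulbb, hk, zero_add, expo, hs])
    refine ⟨F, Fin.forall_fin_two.2 ⟨?_, h2⟩⟩
    simpa using h1 1
  · simp only [SemidirectProduct.one_right, SemidirectProduct.one_left, expo_one, δ1, h.b_eq]
  · intro t t' F hF
    have h1 := h.map_E (hF 0)
    have h2 : F b = E (δ t.left) * b := hF 1
    refine Fin.forall_fin_two.2 ⟨?_, ?_⟩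
    · simp [h1, expo_mul]
    · simp only [Matrix.cons_val_one, Matrix.cons_val_fin_one, map_mul, h1, h2,
        h.mulEb, SemidirectProduct.mul_left, hδ, hψ]
      rw [add_comm]
  · intro t ht
    have h1 : E (expo t.right) = E 1 := congrFun ht 0
    have h2 : E (δ t.left) * b = b := congrFun ht 1
    rw [h.inj_iff, ← expo_one] at h1
    rw [mul_eq_right, h.eq_one_iff, ← δ1] at h2
    exact SemidirectProduct.ext (hinj h2) (expo_injective h1)
  · intro f
    obtain ⟨v, k, h1, h2⟩ := h.mulAut_apply m hm hb f
    obtain ⟨φ, hφ⟩ := exists_expo v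
    have hk : k + u * k = 0 := by
      have h3 : f (b * b) = f (E s) := by rw [h.sq]
      rw [map_mul, h2, h.mulbb, h1, hs, h.inj_iff] at h3
      linear_combination h3
    obtain ⟨x, rfl⟩ := (hr k).2 hk
    refine ⟨⟨x, φ⟩, Fin.forall_fin_two.2 ⟨?_, h2⟩⟩
    simp [h1, hφ]

theorem nonempty_mulAut_mulEquiv_holomorph [NeZero n] (h : IsCyclicExt E b (-1) s) (m : ℕ)
    (hm : (m : ZMod n) ≠ 0) (hb : ∀ x, (E x * b) ^ m = 1)
    (hs : ∀ v : (ZMod n)ˣ, (v : ZMod n) * s = s) : Nonempty (MulAut G ≃* Holomorph (Cyc n)) :=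
  h.nonempty_mulAut_mulEquiv m hm hb hs _ Multiplicative.toAdd (fun _ _ => rfl)
    (fun _ _ h => h) toAdd_mulAut_apply
    (fun k => ⟨fun _ => by ring, fun _ => ⟨Multiplicative.ofAdd k, rfl⟩⟩)

theorem nonempty_mulAut_mulEquiv_cycByAut {ℓ : ℕ} (hℓ : 2 ≤ ℓ) {E : ZMod (2 ^ (ℓ + 1)) → G}
    (h : IsCyclicExt E b (2 ^ ℓ - 1) 0) : Nonempty (MulAut G ≃* CycByAut ℓ) := by
  refine h.nonempty_mulAut_mulEquiv 4 (four_ne_zero_of_two_le hℓ) ?_ (by simp) _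
    (fun x => double ℓ x.toAdd) (fun x y => by simp) (fun x y hxy => ?_) double_powerAction ?_
  · intro x
    rw [pow_four_eq, h.mulbb, h.mulE, h.eq_one_iff]
    linear_combination x * two_mul_two_pow ℓ
  · exact double_injective ℓ hxy
  · intro k
    have h1 : k + (2 ^ ℓ - 1) * k = 2 ^ ℓ * k := by ring
    rw [h1]
    constructor
    · rintro ⟨x, rfl⟩
      exact two_pow_mul_of_even (parity_double _)
    · intro hk
      rcases parity_eq_zero_or_one k with hp | hp
      · obtain ⟨y, hy⟩ := exists_double_iff.2 hp
        exact ⟨Multiplicative.ofAdd y, hy⟩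
      · rw [two_pow_mul_of_odd hp] at hk
        exact absurd hk (two_pow_ne_zero ℓ)

end IsCyclicExt

theorem isPGroup_of_mulEquiv_of_card {A B : Type*} [Group A] [Group B] (k : ℕ)
    (h : Nonempty (A ≃* B)) (hB : Nat.card B = 2 ^ k) : IsPGroup 2 A := by
  obtain ⟨e⟩ := h
  exact IsPGroup.of_card ((Nat.card_congr e.toEquiv).trans hB)

theorem card_holomorph_cyc (ℓ : ℕ) : Nat.card (Holomorph (Cyc (2 ^ (ℓ + 1)))) = 2 ^ (ℓ + 1 + ℓ) := by
  rw [SemidirectProduct.card, card_cyc, card_mulAut_cyc_two_pow, ← pow_add]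

theorem card_cycByAut (ℓ : ℕ) : Nat.card (CycByAut ℓ) = 2 ^ (ℓ + ℓ) := by
  rw [SemidirectProduct.card, card_cyc, card_mulAut_cyc_two_pow, ← pow_add]

/-- `Aut (Z_{2 ^ ℓ})` is the group of units modulo `2 ^ ℓ`. -/
theorem nonempty_mulAut_cyc_mulEquiv {ℓ : ℕ} (hℓ : 2 ≤ ℓ) :
    Nonempty (MulAut (Cyc (2 ^ ℓ)) ≃* Cyc (2 ^ (ℓ - 2)) × Cyc 2) := by
  obtain ⟨m, rfl⟩ := Nat.exists_eq_add_of_le' hℓ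
  obtain ⟨v, hv⟩ := exists_unit_five (ℓ := m + 1)
  obtain ⟨h5, hbij⟩ := units_bijective (by omega) v hv
  exact ⟨(autCyc _).trans (MulEquiv.ofBijective _ hbij).symm⟩

/-! ### Central products over a subgroup of order two -/

theorem mem_zpowers_of_orderOf_eq_two {A : Type*} [Group A] {z : A} (hz : orderOf z = 2) {x : A} :
    x ∈ Subgroup.zpowers z ↔ x = 1 ∨ x = z := by
  classical
  constructor
  · intro hx
    have hf : IsOfFinOrder z := orderOf_pos_iff.1 (by omega)
    rw [hf.mem_zpowers_iff_mem_range_orderOf, hz] at hx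
    simp only [Finset.mem_image, Finset.mem_range] at hx
    obtain ⟨k, hk, rfl⟩ := hx
    interval_cases k
    · exact Or.inl (pow_zero z)
    · exact Or.inr (pow_one z)
  · rintro (rfl | h)
    · exact one_mem _
    · exact h ▸ Subgroup.mem_zpowers z

/-- Amalgamation of central subgroups of order two. -/
theorem exists_centralGluing {A B : Type*} [Group A] [Group B] {x : A} {y : B} (hx : orderOf x = 2)
    (hy : orderOf y = 2) (hxc : x ∈ Subgroup.center A) (hyc : y ∈ Subgroup.center B) :
    ∃ d : CentralGluing A B, d.C₁ = Subgroup.zpowers x ∧ d.C₂ = Subgroup.zpowers y ∧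
      ∀ p, p ∈ d.graph ↔ p = 1 ∨ p = (x, y) := by
  have : Fact (Nat.Prime 2) := ⟨Nat.prime_two⟩
  let φ : Subgroup.zpowers x ≃* Subgroup.zpowers y :=
    mulEquivOfPrimeCardEq (p := 2) (by rw [Nat.card_zpowers, hx]) (by rw [Nat.card_zpowers, hy])
  have hφ : (φ ⟨x, Subgroup.mem_zpowers x⟩ : B) = y := by
    rcases (mem_zpowers_of_orderOf_eq_two hy).1 (φ ⟨x, Subgroup.mem_zpowers x⟩).2 with h | h
    · exfalso
      have h1 : φ ⟨x, Subgroup.mem_zpowers x⟩ = 1 := Subtype.ext h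
      rw [map_eq_one_iff φ φ.injective] at h1
      exact (orderOf_eq_two_iff'.1 hx).2 (congrArg Subtype.val h1)
    · exact h
  refine ⟨⟨_, _, Subgroup.zpowers_le.2 hxc, Subgroup.zpowers_le.2 hyc, φ⟩, rfl, rfl, fun p => ?_⟩
  rw [CentralGluing.mem_graph]
  constructor
  · rintro ⟨⟨c, hc⟩, rfl⟩
    rcases (mem_zpowers_of_orderOf_eq_two hx).1 hc with rfl | rfl
    · left
      have : φ ⟨1, hc⟩ = 1 := map_one φ
      rw [this]; rfl
    · right
      rw [hφ]
  · rintro (rfl | rfl)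
    · refine ⟨1, ?_⟩
      rw [map_one]; rfl
    · exact ⟨⟨x, Subgroup.mem_zpowers x⟩, by rw [hφ]⟩

theorem CentralGluing.card_product {A B : Type*} [Group A] [Group B] (d : CentralGluing A B) :
    Nat.card d.Product * Nat.card d.C₁ = Nat.card A * Nat.card B := by
  rw [← Nat.card_prod A B, Subgroup.card_eq_card_quotient_mul_card_subgroup d.graph]
  congr 1
  refine Nat.card_congr (MonoidHom.ofInjective (f := _) ?_).toEquiv
  intro c c' h
  exact Subtype.ext (congrArg Prod.fst h)

/-- Commuting homomorphisms on `A`, `B`, `C` that agree up to inversion on the amalgamated subgroup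
of the central product of `A` and `B`. -/
theorem CentralGluing.exists_hom {A B C X : Type*} [Group A] [Group B] [Group C] [Group X]
    (d : CentralGluing A B) (f : A →* X) (g : B →* X) (k : C →* X)
    (hfg : ∀ a b, Commute (f a) (g b)) (hfk : ∀ a c, Commute (f a) (k c))
    (hgk : ∀ b c, Commute (g b) (k c)) (hd : ∀ p ∈ d.graph, f p.1 * g p.2 = 1) :
    ∃ Φ : d.Product × C →* X, ∀ a b c, Φ (((a, b) : A × B), c) = f a * g b * k c := by
  let Φ₁ : d.Product →* X := QuotientGroup.lift d.graph (MonoidHom.noncommCoprod f g hfg) hd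
  have h1 : ∀ a b, Φ₁ ((a, b) : A × B) = f a * g b := fun a b => rfl
  refine ⟨MonoidHom.noncommCoprod Φ₁ k ?_, fun a b c => ?_⟩
  · intro q c
    induction q using QuotientGroup.induction_on with
    | H p => exact Commute.mul_left (hfk _ _) (hgk _ _)
  · rw [MonoidHom.noncommCoprod_apply, h1]

/-! ### Homomorphisms out of a dihedral group -/

theorem exists_dihedral_hom {H : Type*} [Group H] {n : ℕ} [NeZero n] (ρ σ : H) (hρ : ρ ^ n = 1)
    (hσ : σ * σ = 1) (hc : σ * ρ = ρ⁻¹ * σ) :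
    ∃ F : DihedralGroup n →* H, F (DihedralGroup.r 1) = ρ ∧ F (DihedralGroup.sr 0) = σ := by
  obtain ⟨F, h1, h2⟩ := (isCyclicExt_dihedralGroup n).exists_hom
    (fun x => cycHom ρ hρ (Multiplicative.ofAdd x)) (fun x y => by rw [ofAdd_add, map_mul]) σ
    (fun x => by
      obtain ⟨k, rfl⟩ := ZMod.natCast_zmod_surjective x
      rw [neg_one_mul, ofAdd_neg, map_inv, cycHom_natCast]
      have h3 : (σ * ρ * σ⁻¹) ^ k = σ * ρ ^ k * σ⁻¹ := conj_pow
      rw [hc, mul_inv_cancel_right, inv_pow] at h3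
      rw [h3, inv_mul_cancel_right]) (by rw [hσ, ofAdd_zero, map_one])
  exact ⟨F, by rw [h1, cycHom_one], h2⟩

/-- An endomorphism whose square is the identity is an automorphism. -/
theorem exists_mulAut_of_involutive {G : Type*} [Group G] (F : G →* G)
    (hF : F.comp F = MonoidHom.id G) : ∃ σ : MulAut G, (∀ g, σ g = F g) ∧ σ * σ = 1 :=
  ⟨MonoidHom.toMulEquiv F F hF hF, fun _ => rfl, by ext g; exact DFunLike.congr_fun hF g⟩

/-! ### Automorphisms of the abelian groups of rank two and of the modular groups -/

/-- The embedding of the group of order two in `ZMod (2 ^ (ℓ + 1))`. -/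
def half (ℓ : ℕ) (y : Cyc 2) : ZMod (2 ^ (ℓ + 1)) := if y = 1 then 0 else 2 ^ ℓ

theorem half_one (ℓ : ℕ) : half ℓ 1 = 0 := if_pos rfl

theorem half_gen (ℓ : ℕ) : half ℓ (Multiplicative.ofAdd 1) = 2 ^ ℓ := if_neg (by decide)

theorem half_mul (ℓ : ℕ) (x y : Cyc 2) : half ℓ (x * y) = half ℓ x + half ℓ y := by
  rcases cyc_two_cases x with rfl | rfl <;> rcases cyc_two_cases y with rfl | rfl
  · simp [half_one]
  · simp [half_one]
  · simp [half_one]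
  · rw [show (Multiplicative.ofAdd 1 * Multiplicative.ofAdd 1 : Cyc 2) = 1 from rfl, half_one,
      half_gen, two_pow_add_two_pow]

theorem half_injective (ℓ : ℕ) : Function.Injective (half ℓ) := by
  intro x y h
  rcases cyc_two_cases x with rfl | rfl <;> rcases cyc_two_cases y with rfl | rfl
  · rfl
  · rw [half_one, half_gen] at h; exact absurd h.symm (two_pow_ne_zero ℓ)
  · rw [half_one, half_gen] at h; exact absurd h (two_pow_ne_zero ℓ)
  · rfl

theorem unit_mul_half {ℓ : ℕ} (v : (ZMod (2 ^ (ℓ + 1)))ˣ) (y : Cyc 2) : v * half ℓ y = half ℓ y := by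
  rcases cyc_two_cases y with rfl | rfl
  · rw [half_one, mul_zero]
  · rw [half_gen, mul_comm, two_pow_mul_unit]

theorem two_mul_half (ℓ : ℕ) (y : Cyc 2) : 2 * half ℓ y = 0 := by
  rcases cyc_two_cases y with rfl | rfl
  · rw [half_one, mul_zero]
  · rw [half_gen, two_mul_two_pow]

theorem exists_half_iff {ℓ : ℕ} {x : ZMod (2 ^ (ℓ + 1))} : (∃ y, half ℓ y = x) ↔ 2 * x = 0 := by
  constructor
  · rintro ⟨y, rfl⟩; exact two_mul_half ℓ y
  · intro h
    rcases two_mul_eq_zero_iff.1 h with rfl | rfl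
    · exact ⟨1, half_one ℓ⟩
    · exact ⟨_, half_gen ℓ⟩

theorem parity_half {ℓ : ℕ} (hℓ : 1 ≤ ℓ) (y : Cyc 2) : parity ℓ (half ℓ y) = 0 := by
  rcases cyc_two_cases y with rfl | rfl
  · rw [half_one, map_zero]
  · rw [half_gen, parity_two_pow hℓ]

namespace IsCyclicExt

variable {G : Type*} [Group G] {ℓ : ℕ} {E : ZMod (2 ^ (ℓ + 1)) → G} {b : G}
  {w : ZMod (2 ^ (ℓ + 1))}

theorem mulAut_ext (h : IsCyclicExt E b w 0) {f f' : MulAut G} (h1 : f (E 1) = f' (E 1))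
    (h2 : f b = f' b) : f = f' := by
  have := h.hom_ext (F := f.toMonoidHom) (F' := f'.toMonoidHom) h1 h2
  ext g
  exact DFunLike.congr_fun this g

/-- The exponent `w` is `1` for the direct product and `1 + 2 ^ ℓ` for the modular group. -/
theorem two_mul_of_modular (hw : w = 1 ∨ w = 1 + 2 ^ ℓ ∧ 2 ≤ ℓ) : 2 * w = 2 := by
  rcases hw with rfl | ⟨rfl, -⟩
  · exact mul_one 2
  · linear_combination two_mul_two_pow ℓ

theorem pow_two_pow (h : IsCyclicExt E b w 0) (hℓ : 1 ≤ ℓ) (hw : w = 1 ∨ w = 1 + 2 ^ ℓ ∧ 2 ≤ ℓ)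
    (x : ZMod (2 ^ (ℓ + 1))) : (E x * b) ^ 2 ^ ℓ = E (2 ^ ℓ * x) := by
  obtain ⟨m, rfl⟩ := Nat.exists_eq_add_of_le' hℓ
  rw [show 2 ^ (m + 1) = 2 * 2 ^ m from pow_succ' 2 m, pow_mul, pow_two (E x * b), h.mulbb, h.pow]
  congr 1
  push_cast
  rcases hw with rfl | ⟨rfl, h2⟩
  · ring
  · obtain ⟨k, rfl⟩ := Nat.exists_eq_add_of_le' (show 1 ≤ m by omega)
    have := two_pow_mul_two (k + 1 + 1)
    linear_combination (2 ^ k * x) * this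

/-- The automorphisms `E 1 ↦ E v`, `b ↦ E κ * b` with `v` a unit and `2 * κ = 0`. -/
theorem exists_diagonal_hom (h : IsCyclicExt E b w 0) :
    ∃ α : (ZMod (2 ^ (ℓ + 1)))ˣ × Cyc 2 →* MulAut G, ∀ t,
      (∀ x, α t (E x) = E (t.1 * x)) ∧ α t b = E (half ℓ t.2) * b := by
  have hpw : parity ℓ w = 1 := parity_eq_one_iff.2 (IsUnit.of_mul_eq_one _ h.mul_self_u)
  have hwh : ∀ y, w * half ℓ y = half ℓ y := fun y =>
    unit_mul_half (parity_eq_one_iff.1 hpw).unit y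
  suffices hΨ : ∃ Ψ : (ZMod (2 ^ (ℓ + 1)))ˣ × Cyc 2 →* MulAut G, ∀ t j,
      Ψ t ((![E 1, b] : Fin 2 → G) j) = (![E t.1, E (half ℓ t.2) * b] : Fin 2 → G) j by
    obtain ⟨α, hα⟩ := hΨ
    exact ⟨α, fun t => ⟨fun x => h.map_E (f := (α t).toMonoidHom) (hα t 0) x, hα t 1⟩⟩
  refine exists_hom_mulAut ![E 1, b] (fun F F' hF => h.hom_ext (hF 0) (hF 1))
    (fun t : (ZMod (2 ^ (ℓ + 1)))ˣ × Cyc 2 => ![E t.1, E (half ℓ t.2) * b]) ?_ ?_ ?_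
  · intro t
    obtain ⟨F, h1, h2⟩ := h.exists_hom (fun x => E (t.1 * x))
      (fun x y => by rw [mul_add, h.add]) (E (half ℓ t.2) * b)
      (fun x => by rw [h.mulbE, h.mulEb, add_comm]; congr 3; ring)
      (by rw [h.mulbb, hwh, add_zero, ← two_mul, two_mul_half, mul_zero])
    refine ⟨F, Fin.forall_fin_two.2 ⟨?_, h2⟩⟩
    simpa using h1 1
  · simp only [Prod.fst_one, Prod.snd_one, Units.val_one, half_one, h.b_eq]
  · intro t t' F hF
    have h1 := h.map_E (hF 0)
    have h2 : F b = E (half ℓ t.2) * b := hF 1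
    refine Fin.forall_fin_two.2 ⟨?_, ?_⟩
    · simp [h1]
    · simp only [Matrix.cons_val_one, Matrix.cons_val_fin_one, map_mul, h1, h2, h.mulEb, Prod.snd_mul,
        half_mul]
      rw [unit_mul_half, add_comm]

/-- The automorphism `E 1 ↦ E 1 * b`, `b ↦ b`. -/
theorem exists_transvection (h : IsCyclicExt E b w 0) (hℓ : 1 ≤ ℓ)
    (hw : w = 1 ∨ w = 1 + 2 ^ ℓ ∧ 2 ≤ ℓ) :
    ∃ σ : MulAut G, (∀ k : ℕ, σ (E k) = (E 1 * b) ^ k) ∧ σ b = b ∧ σ * σ = 1 := by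
  have h2w := two_mul_of_modular hw
  have hww := h.mul_self_u
  have hg : (E 1 * b) ^ 2 ^ (ℓ + 1) = 1 := by
    have h2 : ∀ g : G, g ^ 2 ^ (ℓ + 1) = g ^ 2 ^ ℓ * g ^ 2 ^ ℓ := fun g => by
      rw [pow_succ, pow_mul, pow_two]
    rw [h2, h.pow_two_pow hℓ hw, h.mulE, mul_one, two_pow_add_two_pow, h.zero]
  have hk := cycHom_natCast (E 1 * b) hg
  have hwd : cycHom (E 1 * b) hg (Multiplicative.ofAdd w) = E w * b := by
    have hd : cycHom (E 1 * b) hg (Multiplicative.ofAdd (w - 1)) = E (w - 1) := by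
      rcases hw with rfl | ⟨rfl, h2⟩
      · rw [sub_self, ofAdd_zero, map_one, h.zero]
      · have := hk (2 ^ ℓ)
        push_cast at this
        rw [add_sub_cancel_left, this, h.pow_two_pow hℓ (Or.inr ⟨rfl, h2⟩), mul_one]
    rw [← add_sub_cancel (1 : ZMod (2 ^ (ℓ + 1))) w, ofAdd_add, map_mul, hd, cycHom_one, h.mulbE]
    congr 2
    linear_combination hww - h2w
  have hb1 : b * (E 1 * b) * b⁻¹ = E w * b := by
    rw [← mul_assoc, h.conj, mul_one, mul_inv_cancel_right]
  obtain ⟨F, h1, h2⟩ := h.exists_hom (fun x => cycHom (E 1 * b) hg (Multiplicative.ofAdd x))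
    (fun x y => by rw [ofAdd_add, map_mul]) b
    (fun x => by
      obtain ⟨k, rfl⟩ := ZMod.natCast_zmod_surjective x
      have h3 : Multiplicative.ofAdd (w * k) = Multiplicative.ofAdd w ^ k := by
        rw [← ofAdd_nsmul, nsmul_eq_mul, mul_comm]
      rw [hk, h3, map_pow, hwd, ← hb1, conj_pow, inv_mul_cancel_right])
    (by rw [ofAdd_zero, map_one, h.sq, h.zero])
  have h3 : ∀ k : ℕ, F (E k) = (E 1 * b) ^ k := fun k => by rw [h1, hk]
  have h4 : F (E 1) = E 1 * b := by simpa using h3 1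
  obtain ⟨σ, hσ, hσσ⟩ := exists_mulAut_of_involutive F (h.hom_ext
    (by rw [MonoidHom.comp_apply, h4, map_mul, h4, h2, mul_assoc, h.sq, h.zero, mul_one]; rfl)
    (by rw [MonoidHom.comp_apply, h2, h2]; rfl))
  exact ⟨σ, fun k => by rw [hσ, h3], by rw [hσ, h2], hσσ⟩

/-- Every automorphism sends `E 1` to some `E v` or `E v * b` with `v` a unit, and `b` to some
`E κ * b` with `2 * κ = 0`. -/
theorem mulAut_apply_of_modular (h : IsCyclicExt E b w 0) (hℓ : 1 ≤ ℓ)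
    (hw : w = 1 ∨ w = 1 + 2 ^ ℓ ∧ 2 ≤ ℓ) (f : MulAut G) :
    ∃ (v : (ZMod (2 ^ (ℓ + 1)))ˣ) (y : Cyc 2),
      (f (E 1) = E v ∨ f (E 1) = E v * b) ∧ f b = E (half ℓ y) * b := by
  have hz : f (E (2 ^ ℓ)) = f (E 1) ^ 2 ^ ℓ := by
    rw [← map_pow, h.pow, mul_one]; push_cast; rfl
  obtain ⟨v, hv, hfz⟩ : ∃ v, (f (E 1) = E v ∨ f (E 1) = E v * b) ∧ f (E (2 ^ ℓ)) = E (2 ^ ℓ * v) := by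
    rcases h.cover (f (E 1)) with ⟨v, hv⟩ | ⟨v, hv⟩
    · exact ⟨v, Or.inl hv, by rw [hz, hv, h.pow]; push_cast; rfl⟩
    · exact ⟨v, Or.inr hv, by rw [hz, hv, h.pow_two_pow hℓ hw]⟩
  have hne : f (E (2 ^ ℓ)) ≠ 1 := by
    rw [Ne, map_eq_one_iff f f.injective, h.eq_one_iff]; exact two_pow_ne_zero ℓ
  have hpv : parity ℓ v = 1 := by
    rcases parity_eq_zero_or_one v with hp | hp
    · rw [hfz, two_pow_mul_of_even hp, h.zero] at hne; exact absurd rfl hne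
    · exact hp
  rw [two_pow_mul_of_odd hpv] at hfz
  obtain ⟨v, rfl⟩ := parity_eq_one_iff.1 hpv
  have hbb : f b * f b = 1 := by rw [← map_mul, h.sq, h.zero, map_one]
  rcases h.cover (f b) with ⟨k, hk⟩ | ⟨k, hk⟩
  · exfalso
    rw [hk, h.mulE, h.eq_one_iff, ← two_mul] at hbb
    rcases two_mul_eq_zero_iff.1 hbb with rfl | rfl
    · rw [h.zero, map_eq_one_iff f f.injective] at hk
      exact h.ne 0 (by rw [h.zero, hk])
    · rw [← hfz] at hk
      exact h.ne _ (f.injective hk).symm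
  · rw [hk, h.mulbb, h.eq_one_iff] at hbb
    have h2k : 2 * k = 0 := by
      rcases hw with rfl | ⟨rfl, h2⟩
      · linear_combination hbb
      · have hu : IsUnit (1 + 2 ^ (ℓ - 1) : ZMod (2 ^ (ℓ + 1))) := by
          apply parity_eq_one_iff.1
          rw [map_add, map_one, map_pow, parity_two, zero_pow (by omega), add_zero]
        refine hu.mul_right_eq_zero.1 ?_
        obtain ⟨m, rfl⟩ := Nat.exists_eq_add_of_le' hℓ
        rw [Nat.add_sub_cancel]
        linear_combination hbb
    obtain ⟨y, rfl⟩ := exists_half_iff.2 h2k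
    exact ⟨v, y, hv, hk⟩

/-- Coordinates for the automorphisms: a diagonal one, possibly times the transvection. -/
theorem exists_mulAut_coordinates (h : IsCyclicExt E b w 0) (hℓ : 1 ≤ ℓ)
    (hw : w = 1 ∨ w = 1 + 2 ^ ℓ ∧ 2 ≤ ℓ) {α : (ZMod (2 ^ (ℓ + 1)))ˣ × Cyc 2 →* MulAut G}
    (hα : ∀ t, (∀ x, α t (E x) = E (t.1 * x)) ∧ α t b = E (half ℓ t.2) * b) {σ : MulAut G}
    (hσ : σ (E 1) = E 1 * b) (hσb : σ b = b) :
    (∀ f : MulAut G, ∃ t, f = α t ∨ f = α t * σ) ∧ Nat.card (MulAut G) = 2 ^ (ℓ + 2) := by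
  have hα1 : ∀ t, α t (E 1) = E t.1 := fun t => by rw [(hα t).1, mul_one]
  have hασ1 : ∀ t, (α t * σ) (E 1) = E (t.1 + half ℓ t.2) * b := fun t => by
    rw [MulAut.mul_apply, hσ, map_mul, hα1, (hα t).2, h.mulEb]
  have hασb : ∀ t, (α t * σ) b = E (half ℓ t.2) * b := fun t => by
    rw [MulAut.mul_apply, hσb, (hα t).2]
  have hcov : ∀ f : MulAut G, ∃ t, f = α t ∨ f = α t * σ := by
    intro f
    obtain ⟨v, y, h1 | h1, h2⟩ := h.mulAut_apply_of_modular hℓ hw f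
    · exact ⟨(v, y), Or.inl (h.mulAut_ext (by rw [h1, hα1]) (by rw [h2, (hα _).2]))⟩
    · obtain ⟨v', hv'⟩ : IsUnit ((v : ZMod (2 ^ (ℓ + 1))) + half ℓ y) := by
        rw [← parity_eq_one_iff, map_add, parity_unit, parity_half hℓ, add_zero]
      refine ⟨(v', y), Or.inr (h.mulAut_ext ?_ (by rw [h2, hασb]))⟩
      rw [h1, hασ1, h.mul_b_inj, hv']
      linear_combination -two_mul_half ℓ y
  refine ⟨hcov, ?_⟩
  have hbij : Function.Bijective (fun x : ((ZMod (2 ^ (ℓ + 1)))ˣ × Cyc 2) ⊕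
      ((ZMod (2 ^ (ℓ + 1)))ˣ × Cyc 2) => Sum.elim (fun t => α t) (fun t => α t * σ) x) := by
    constructor
    · have hinj : ∀ t t', α t = α t' → t = t' := by
        intro t t' he
        have h1 := DFunLike.congr_fun he (E 1)
        have h2 := DFunLike.congr_fun he b
        rw [hα1, hα1, h.inj_iff] at h1
        rw [(hα _).2, (hα _).2, h.mul_b_inj] at h2
        exact Prod.ext (Units.ext h1) (half_injective ℓ h2)
      have hne : ∀ t t', α t ≠ α t' * σ := by
        intro t t' he
        have h1 := DFunLike.congr_fun he (E 1)
        rw [hα1, hασ1] at h1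
        exact h.ne_mul _ _ h1
      rintro (x | x) (y | y) hxy
      · exact congrArg _ (hinj _ _ hxy)
      · exact absurd hxy (hne _ _)
      · exact absurd hxy.symm (hne _ _)
      · exact congrArg _ (hinj _ _ (mul_right_cancel hxy))
    · intro f
      obtain ⟨t, rfl | rfl⟩ := hcov f
      · exact ⟨Sum.inl t, rfl⟩
      · exact ⟨Sum.inr t, rfl⟩
  rw [← Nat.card_congr (Equiv.ofBijective _ hbij), Nat.card_sum, Nat.card_prod, card_cyc,
    card_units_two_pow]
  ring

/-- The transvection and its transpose `E 1 ↦ E 1`, `b ↦ E (2 ^ ℓ) * b` generate a dihedral group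
of order eight, whose centre is generated by the power map with exponent `1 + 2 ^ ℓ`. -/
theorem exists_dihedral_hom_mulAut (h : IsCyclicExt E b w 0) (hℓ : 1 ≤ ℓ)
    {α : (ZMod (2 ^ (ℓ + 1)))ˣ × Cyc 2 →* MulAut G}
    (hα : ∀ t, (∀ x, α t (E x) = E (t.1 * x)) ∧ α t b = E (half ℓ t.2) * b) {σ : MulAut G}
    (hσ : σ (E 1) = E 1 * b) (hσz : σ (E (2 ^ ℓ)) = E (2 ^ ℓ)) (hσb : σ b = b) (hσσ : σ * σ = 1)
    (ζ : (ZMod (2 ^ (ℓ + 1)))ˣ) (hζ : (ζ : ZMod (2 ^ (ℓ + 1))) = 1 + 2 ^ ℓ) :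
    ∃ g : DihedralGroup 4 →* MulAut G, g (DihedralGroup.sr 0) = σ ∧
      g (DihedralGroup.sr 1) = α (1, Multiplicative.ofAdd 1) ∧ g (DihedralGroup.r 2) = α (ζ, 1) := by
  set τ := α (1, Multiplicative.ofAdd 1) with hτ
  have hτE : ∀ x, τ (E x) = E x := fun x => by rw [(hα _).1]; simp
  have hτb : τ b = E (2 ^ ℓ) * b := by rw [(hα _).2, half_gen]
  have hττ : τ * τ = 1 := by
    rw [hτ, ← map_mul, ← map_one α]
    exact congrArg α (Prod.ext (one_mul 1) (cyc_two_mul_self _))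
  have hζζ : α (ζ, 1) * α (ζ, 1) = 1 := by
    rw [← map_mul, ← map_one α]
    congr 1
    refine Prod.ext (Units.ext ?_) rfl
    simp only [Prod.mk_mul_mk, Units.val_mul, hζ, Prod.fst_one, Units.val_one]
    linear_combination two_pow_mul_two_pow hℓ + two_mul_two_pow ℓ
  have hρ2 : σ * τ * (σ * τ) = α (ζ, 1) := by
    apply h.mulAut_ext
    · simp only [MulAut.mul_apply, hτE, hσ, map_mul, hτb, hσb, hσz, (hα _).1]
      have hpw : parity ℓ w = 1 := parity_eq_one_iff.2 (IsUnit.of_mul_eq_one _ h.mul_self_u)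
      rw [h.mulbb, hζ, mul_comm w, two_pow_mul_of_odd hpw, add_zero, mul_one]
    · simp only [MulAut.mul_apply, hτE, map_mul, hτb, hσb, hσz, (hα _).2, half_one]
      rw [h.mulEb, two_pow_add_two_pow]
  obtain ⟨g, hg1, hg2⟩ := exists_dihedral_hom (n := 4) (σ * τ) σ
    (by rw [pow_four_eq, hρ2, hζζ]) hσσ
    (by rw [eq_comm, inv_mul_eq_iff_eq_mul]
        simp only [mul_assoc]
        rw [← mul_assoc σ σ, hσσ, one_mul, hττ, mul_one])
  refine ⟨g, hg2, ?_, ?_⟩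
  · have : (DihedralGroup.sr 1 : DihedralGroup 4) = DihedralGroup.sr 0 * DihedralGroup.r 1 := by simp
    rw [this, map_mul, hg1, hg2, ← mul_assoc, hσσ, one_mul]
  · have : (DihedralGroup.r 2 : DihedralGroup 4) = DihedralGroup.r 1 * DihedralGroup.r 1 := by
      rw [DihedralGroup.r_mul_r]; rfl
    rw [this, map_mul, hg1, hρ2]

end IsCyclicExt

theorem center_dihedralGroup_four :
    Subgroup.center (DihedralGroup 4) = Subgroup.zpowers (DihedralGroup.r 2) := by
  have ho : orderOf (DihedralGroup.r 2 : DihedralGroup 4) = 2 := by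
    rw [orderOf_eq_two_iff']; decide
  ext x
  rw [mem_zpowers_of_orderOf_eq_two ho, Subgroup.mem_center_iff]
  revert x
  decide

theorem dihedralGroup_four_cases (x : DihedralGroup 4) : ∃ (k : ℕ) (e : ℕ),
    x = (DihedralGroup.sr 0 * DihedralGroup.sr 1) ^ k * DihedralGroup.sr 0 ^ e := by
  have : ∀ x : DihedralGroup 4, ∃ (k : Fin 4) (e : Fin 2),
    x = (DihedralGroup.sr 0 * DihedralGroup.sr 1) ^ k.val * DihedralGroup.sr 0 ^ e.val := by decide
  obtain ⟨k, e, h⟩ := this x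
  exact ⟨k, e, h⟩

theorem commute_dihedral_four {X : Type*} [Group X] {g : DihedralGroup 4 →* X} {x : X}
    (h0 : Commute x (g (DihedralGroup.sr 0))) (h1 : Commute x (g (DihedralGroup.sr 1)))
    (y : DihedralGroup 4) : Commute x (g y) := by
  obtain ⟨k, e, rfl⟩ := dihedralGroup_four_cases y
  rw [map_mul, map_pow, map_pow, map_mul]
  exact ((h0.mul_right h1).pow_right _).mul_right (h0.pow_right _)

theorem commute_cycHom {X : Type*} [Group X] {n : ℕ} [NeZero n] {g : X} (hg : g ^ n = 1) {x : X}
    (h : Commute g x) (y : Cyc n) : Commute (cycHom g hg y) x := by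
  obtain ⟨k, hk⟩ := ZMod.natCast_zmod_surjective y.toAdd
  have hy : y = Multiplicative.ofAdd (k : ZMod n) := by rw [hk]; rfl
  rw [hy, cycHom_natCast]
  exact h.pow_left k

namespace IsCyclicExt

variable {G : Type*} [Group G] {b : G}

/-- The automorphism group of `Z_{2 ^ (ℓ + 1)} × Z_2` and of the modular groups. The power map
with exponent `5` is amalgamated with the dihedral group generated by the transvections, and the
direct factor `Z_2` is generated by `E 1 ↦ E (-1)`, `b ↦ E (w - 1) * b`. -/
theorem nonempty_mulAut_mulEquiv_product {ℓ : ℕ} {E : ZMod (2 ^ (ℓ + 1)) → G}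
    {w : ZMod (2 ^ (ℓ + 1))} (h : IsCyclicExt E b w 0) (hℓ : 2 ≤ ℓ) (hw : w = 1 ∨ w = 1 + 2 ^ ℓ) :
    IsPGroup 2 (MulAut G) ∧ ∃ d : CentralGluing (Cyc (2 ^ (ℓ - 1))) (DihedralGroup 4), d.IsFull ∧
      Nonempty (MulAut G ≃* d.Product × Cyc 2) := by
  have hw' : w = 1 ∨ w = 1 + 2 ^ ℓ ∧ 2 ≤ ℓ := hw.imp id fun h => ⟨h, hℓ⟩
  have h2w := two_mul_of_modular hw'
  have hpw : parity ℓ w = 1 := parity_eq_one_iff.2 (IsUnit.of_mul_eq_one _ h.mul_self_u)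
  obtain ⟨α, hα⟩ := h.exists_diagonal_hom
  obtain ⟨σ, hσ, hσb, hσσ⟩ := h.exists_transvection (by omega) hw'
  have hσ1 : σ (E 1) = E 1 * b := by simpa using hσ 1
  have hσz : σ (E (2 ^ ℓ)) = E (2 ^ ℓ) := by
    have := hσ (2 ^ ℓ)
    rw [h.pow_two_pow (by omega) hw', mul_one] at this
    push_cast at this
    exact this
  obtain ⟨hcov, hcard⟩ := h.exists_mulAut_coordinates (by omega) hw' hα hσ1 hσb
  obtain ⟨v, hv⟩ := exists_unit_five (ℓ := ℓ)
  obtain ⟨h5, hbij⟩ := units_bijective (by omega) v hv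
  have hv' : ((v ^ 2 ^ (ℓ - 2) : (ZMod (2 ^ (ℓ + 1)))ˣ) : ZMod (2 ^ (ℓ + 1))) = 1 + 2 ^ ℓ := by
    push_cast; rw [hv, five_pow hℓ]
  obtain ⟨g, hg0, hg1, hg2⟩ :=
    h.exists_dihedral_hom_mulAut (by omega) hα hσ1 hσz hσb hσσ (v ^ 2 ^ (ℓ - 2)) hv'
  -- the generator `E 1 ↦ E (-1)`, `b ↦ E (w - 1) * b` of the direct factor; `w - 1` is `0` or `2 ^ ℓ`
  obtain ⟨y, hy⟩ : ∃ y, half ℓ y = w - 1 := exists_half_iff.2 (by linear_combination h2w)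
  have hκσ : Commute (α (-1, y)) σ := by
    have hneg : σ (E (-1)) = E (-w) * b := by
      rw [h.neg, map_inv, hσ1, inv_eq_iff_mul_eq_one, h.mulbb, h.eq_one_iff]
      have := h.mul_self_u
      linear_combination -this
    apply h.mulAut_ext
    · simp only [MulAut.mul_apply, hσ1, map_mul, (hα _).1, (hα _).2, hy]
      rw [h.mulEb]
      simp only [Units.val_neg, Units.val_one, mul_one]
      rw [hneg, h.mul_b_inj]
      linear_combination h2w
    · simp only [MulAut.mul_apply, hσb, map_mul, (hα _).2, hy]
      congr 1
      rcases hw with rfl | rfl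
      · rw [sub_self, h.zero, map_one]
      · rw [add_sub_cancel_left, hσz]
  have hακ : ∀ t, Commute (α (-1, y)) (α t) := fun t => by
    rw [Commute, SemiconjBy, ← map_mul, ← map_mul, mul_comm]
  have h5σ : Commute (α (v, 1)) σ := by
    have hσ5 : σ (E 5) = E 5 * b := by
      have := hσ 5
      push_cast at this
      rw [this, pow_succ, pow_four_eq, h.mulbb, h.mulE, h.mulEb, h.mul_b_inj]
      linear_combination h2w
    apply h.mulAut_ext
    · simp only [MulAut.mul_apply, hσ1, map_mul, (hα _).1, (hα _).2, half_one, h.b_eq, hv, mul_one,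
        hσ5]
    · simp only [MulAut.mul_apply, hσb, (hα _).2, half_one, h.b_eq]
  have h5α : ∀ t, Commute (α (v, 1)) (α t) := fun t => by
    rw [Commute, SemiconjBy, ← map_mul, ← map_mul, mul_comm]
  have hα5 : α (v, 1) ^ 2 ^ (ℓ - 1) = 1 := by
    rw [← map_pow, Prod.pow_mk, h5, one_pow]; exact map_one α
  have hκ2 : α (-1, y) ^ 2 = 1 := by
    rw [← map_pow, Prod.pow_mk, neg_one_sq, ← map_one α]
    congr 1
    exact Prod.ext rfl ((pow_two y).trans (cyc_two_mul_self y))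
  -- the gluing data
  have ho : orderOf (DihedralGroup.r 2 : DihedralGroup 4) = 2 := by
    rw [orderOf_eq_two_iff']; decide
  have hox : orderOf (Multiplicative.ofAdd ((2 : ZMod (2 ^ (ℓ - 1))) ^ (ℓ - 2))) = 2 := by
    obtain ⟨m, rfl⟩ := Nat.exists_eq_add_of_le' hℓ
    rw [orderOf_eq_two_iff', ← ofAdd_add]
    simp only [Nat.add_sub_cancel]
    rw [two_pow_add_two_pow]
    exact ⟨rfl, fun he => two_pow_ne_zero m (Multiplicative.ofAdd.injective he)⟩
  obtain ⟨d, -, hd2, hdg⟩ := exists_centralGluing hox ho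
    (Subgroup.mem_center_iff.2 fun _ => mul_comm _ _)
    (by rw [center_dihedralGroup_four]; exact Subgroup.mem_zpowers _)
  have hdcard : Nat.card (d.Product × Cyc 2) = 2 ^ (ℓ + 2) := by
    have h1 := d.card_product
    have h2 : Nat.card d.C₁ = 2 := by
      rw [Nat.card_congr d.φ.toEquiv, hd2, Nat.card_zpowers, ho]
    have h3 : 2 ^ (ℓ - 1) * (2 * 4) = 2 ^ (ℓ + 2) := by
      rw [show ℓ + 2 = ℓ - 1 + 3 by omega, pow_add]
      norm_num
    rw [h2, card_cyc, DihedralGroup.nat_card, h3] at h1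
    rw [Nat.card_prod, card_cyc, h1]
  obtain ⟨Φ, hΦ⟩ := d.exists_hom (cycHom (α (v, 1)) hα5) g (cycHom (n := 2) (α (-1, y)) hκ2)
    (fun a c => commute_dihedral_four (by rw [hg0]; exact commute_cycHom _ h5σ _)
      (by rw [hg1]; exact commute_cycHom _ (h5α _) _) c)
    (fun a c => commute_cycHom _ (commute_cycHom _ (hακ _) _).symm _)
    (fun a c => (commute_cycHom _ (commute_dihedral_four (by rw [hg0]; exact hκσ)
      (by rw [hg1]; exact hακ _) a) _).symm)
    (by
      intro p hp
      rcases (hdg p).1 hp with rfl | rfl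
      · rw [Prod.fst_one, Prod.snd_one, map_one, map_one, one_mul]
      · have h3 := cycHom_natCast (α (v, 1)) hα5 (2 ^ (ℓ - 2))
        push_cast at h3
        rw [h3, hg2, ← map_pow, ← map_mul, ← map_one α]
        congr 1
        refine Prod.ext (Units.ext ?_) (by simp)
        simp only [Prod.pow_mk, Prod.mk_mul_mk, Units.val_mul, hv', Prod.fst_one, Units.val_one]
        linear_combination two_pow_mul_two_pow (show 1 ≤ ℓ by omega) + two_mul_two_pow ℓ)
  refine ⟨IsPGroup.of_card hcard, d, Or.inr (by rw [hd2, center_dihedralGroup_four]), ?_⟩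
  refine ⟨(MulEquiv.ofBijective Φ ?_).symm⟩
  have hfin : Finite (d.Product × Cyc 2) := Nat.finite_of_card_ne_zero (by rw [hdcard]; positivity)
  rw [Nat.bijective_iff_surjective_and_card, hdcard, hcard]
  refine ⟨?_, rfl⟩
  rw [← MonoidHom.range_eq_top, eq_top_iff]
  have hmem : ∀ p q r, cycHom (α (v, 1)) hα5 p * g q * cycHom (n := 2) (α (-1, y)) hκ2 r ∈ Φ.range :=
    fun p q r => ⟨_, hΦ p q r⟩
  have hσr : σ ∈ Φ.range := by
    have := hmem 1 (DihedralGroup.sr 0) 1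
    rwa [hg0, map_one, map_one, one_mul, mul_one] at this
  have hτr : α (1, Multiplicative.ofAdd 1) ∈ Φ.range := by
    have := hmem 1 (DihedralGroup.sr 1) 1
    rwa [hg1, MonoidHom.map_one, MonoidHom.map_one, one_mul, mul_one] at this
  have hκr : α (-1, y) ∈ Φ.range := by
    have := hmem 1 1 (Multiplicative.ofAdd 1)
    rwa [cycHom_one, map_one, map_one, one_mul, one_mul] at this
  have h5r : α (v, 1) ∈ Φ.range := by
    have := hmem (Multiplicative.ofAdd 1) 1 1
    rwa [cycHom_one, map_one, map_one, mul_one, mul_one] at this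
  have hαy : ∀ y, α (1, y) ∈ Φ.range := by
    intro y
    rcases cyc_two_cases y with rfl | rfl
    · rw [show ((1, 1) : (ZMod (2 ^ (ℓ + 1)))ˣ × Cyc 2) = 1 from rfl, map_one]; exact one_mem _
    · exact hτr
  have hα1 : α (-1, 1) ∈ Φ.range := by
    have := mul_mem hκr (hαy y⁻¹)
    rwa [← map_mul, Prod.mk_mul_mk, mul_one, mul_inv_cancel] at this
  have hαr : ∀ t, α t ∈ Φ.range := by
    rintro ⟨x, y'⟩
    have hx : α (x, 1) ∈ Φ.range := by
      obtain ⟨⟨p, q⟩, rfl⟩ := hbij.surjective x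
      obtain ⟨k, hk⟩ := ZMod.natCast_zmod_surjective p.toAdd
      have hp : p = Multiplicative.ofAdd (k : ZMod (2 ^ (ℓ - 1))) := by rw [hk]; rfl
      have h6 := pow_mem h5r k
      rw [← map_pow, Prod.pow_mk, one_pow] at h6
      rw [MonoidHom.coprod_apply, hp, cycHom_natCast]
      rcases cyc_two_cases q with rfl | rfl
      · rwa [map_one, mul_one]
      · have := mul_mem h6 hα1
        rw [← map_mul, Prod.mk_mul_mk, mul_one] at this
        rwa [cycHom_one]
    have := mul_mem hx (hαy y')
    rwa [← map_mul, Prod.mk_mul_mk, mul_one, one_mul] at this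
  rintro f -
  obtain ⟨t, rfl | rfl⟩ := hcov f
  · exact hαr t
  · exact mul_mem (hαr t) hσr

/-- The automorphism group of `Z_4 × Z_2`. -/
theorem nonempty_mulAut_mulEquiv_dihedral {E : ZMod (2 ^ (1 + 1)) → G} (h : IsCyclicExt E b 1 0) :
    IsPGroup 2 (MulAut G) ∧ Nonempty (MulAut G ≃* DihedralGroup 4) := by
  obtain ⟨α, hα⟩ := h.exists_diagonal_hom
  obtain ⟨σ, hσ, hσb, hσσ⟩ := h.exists_transvection le_rfl (Or.inl rfl)
  have hσ1 : σ (E 1) = E 1 * b := by simpa using hσ 1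
  have hσz : σ (E (2 ^ 1)) = E (2 ^ 1) := by
    have := hσ (2 ^ 1)
    rw [h.pow_two_pow le_rfl (Or.inl rfl), mul_one] at this
    push_cast at this
    exact this
  obtain ⟨hcov, hcard⟩ := h.exists_mulAut_coordinates le_rfl (Or.inl rfl) hα hσ1 hσb
  obtain ⟨g, hg0, hg1, hg2⟩ := h.exists_dihedral_hom_mulAut le_rfl hα hσ1 hσz hσb hσσ (-1) rfl
  refine ⟨IsPGroup.of_card hcard, ⟨(MulEquiv.ofBijective g ?_).symm⟩⟩
  rw [Nat.bijective_iff_surjective_and_card, hcard, DihedralGroup.nat_card]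
  refine ⟨?_, rfl⟩
  rw [← MonoidHom.range_eq_top, eq_top_iff]
  have hαr : ∀ t, α t ∈ g.range := by
    rintro ⟨x, y⟩
    have hx : α (x, 1) ∈ g.range := by
      have : x = 1 ∨ x = -1 := by revert x; decide
      rcases this with rfl | rfl
      · exact ⟨1, (map_one g).trans (map_one α).symm⟩
      · exact ⟨_, hg2⟩
    have hy : α (1, y) ∈ g.range := by
      rcases cyc_two_cases y with rfl | rfl
      · exact ⟨1, (map_one g).trans (map_one α).symm⟩
      · exact ⟨_, hg1⟩
    have := mul_mem hx hy
    rwa [← map_mul, Prod.mk_mul_mk, mul_one, one_mul] at this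
  rintro f -
  obtain ⟨t, rfl | rfl⟩ := hcov f
  · exact hαr t
  · exact mul_mem (hαr t) ⟨_, hg0⟩

end IsCyclicExt

/-! ### Groups with a dihedral subgroup of index two -/

/-- The power map on rotations that fixes `sr 0`. -/
def dihedralPow {n : ℕ} (w : ZMod n) : DihedralGroup n → DihedralGroup n
  | DihedralGroup.r x => DihedralGroup.r (w * x)
  | DihedralGroup.sr x => DihedralGroup.sr (w * x)

@[simp] theorem dihedralPow_r {n : ℕ} (w x : ZMod n) :
    dihedralPow w (DihedralGroup.r x) = DihedralGroup.r (w * x) := rfl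

@[simp] theorem dihedralPow_sr {n : ℕ} (w x : ZMod n) :
    dihedralPow w (DihedralGroup.sr x) = DihedralGroup.sr (w * x) := rfl

@[simp] theorem dihedralPow_one {n : ℕ} (x : DihedralGroup n) : dihedralPow 1 x = x := by
  rcases x with x | x <;> simp

theorem dihedral_hom_ext {n : ℕ} [NeZero n] {H : Type*} [Group H] {F F' : DihedralGroup n →* H}
    (h1 : F (DihedralGroup.r 1) = F' (DihedralGroup.r 1))
    (h2 : F (DihedralGroup.sr 0) = F' (DihedralGroup.sr 0)) : F = F' :=
  (isCyclicExt_dihedralGroup n).hom_ext h1 h2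

open DihedralGroup in
theorem r_natCast_eq_pow {n : ℕ} (k : ℕ) : (r (k : ZMod n) : DihedralGroup n) = r 1 ^ k := by
  rw [r_one_pow]

namespace IsTwoExt

open DihedralGroup

section

variable {G : Type*} [Group G] {n : ℕ} [NeZero n] {i : DihedralGroup n →* G} {c : G} {w : ZMod n}

theorem hom_ext_dihedral {τ : DihedralGroup n → DihedralGroup n} {s : DihedralGroup n}
    (h : IsTwoExt i c τ s) {H : Type*} [Group H] {F F' : G →* H}
    (h1 : F (i (r 1)) = F' (i (r 1))) (h2 : F (i (sr 0)) = F' (i (sr 0))) (h3 : F c = F' c) :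
    F = F' :=
  h.hom_ext (fun m => DFunLike.congr_fun (dihedral_hom_ext (F := F.comp i) (F' := F'.comp i) h1 h2) m) h3

/-- Homomorphisms on generators and relations. -/
theorem exists_hom_dihedral (h : IsTwoExt i c (dihedralPow w) 1) {H : Type*} [Group H]
    (ρ σ C : H) (hρ : ρ ^ n = 1) (hσ : σ * σ = 1) (hσρ : ρ * σ * ρ = σ) (hC : C * C = 1)
    (k : ℕ) (hk : (k : ZMod n) = w) (hCρ : C * ρ = ρ ^ k * C) (hCσ : C * σ = σ * C) :
    ∃ F : G →* H, F (i (r 1)) = ρ ∧ F (i (sr 0)) = σ ∧ F c = C := by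
  obtain ⟨f, hf1, hf2⟩ := exists_dihedral_hom ρ σ hρ hσ (by
    rw [eq_comm, inv_mul_eq_iff_eq_mul, ← mul_assoc, hσρ])
  have hr : ∀ x, C * f (r x) = f (r (w * x)) * C := by
    intro x
    obtain ⟨l, rfl⟩ := ZMod.natCast_zmod_surjective x
    rw [← hk, ← Nat.cast_mul, r_natCast_eq_pow, r_natCast_eq_pow, map_pow, map_pow, hf1]
    have h3 : (C * ρ * C⁻¹) ^ l = C * ρ ^ l * C⁻¹ := conj_pow
    rw [hCρ, mul_inv_cancel_right, ← pow_mul] at h3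
    rw [h3, inv_mul_cancel_right]
  obtain ⟨F, h1, h2⟩ := h.exists_hom f C (fun m => by
      rcases m with x | x
      · exact hr x
      · have hs : ∀ x : ZMod n, sr x = sr 0 * r x := fun x => by simp
        rw [dihedralPow_sr, hs x, hs (w * x), map_mul, map_mul, ← mul_assoc, hf2, hCσ, mul_assoc, hr,
          mul_assoc])
    (by rw [hC, map_one])
  exact ⟨F, by rw [h1, hf1], by rw [h1, hf2], h2⟩

theorem map_r {f : G →* G} {v : ZMod n} (hf : f (i (r 1)) = i (r v)) (x : ZMod n) :
    f (i (r x)) = i (r (v * x)) := by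
  obtain ⟨k, rfl⟩ := ZMod.natCast_zmod_surjective x
  rw [r_natCast_eq_pow, map_pow, map_pow, hf, ← map_pow, r_pow]

theorem map_sr {f : G →* G} {v k : ZMod n} (hf : f (i (r 1)) = i (r v)) (hf' : f (i (sr 0)) = i (sr k))
    (x : ZMod n) : f (i (sr x)) = i (sr (k + v * x)) := by
  have hs : sr x = sr 0 * r x := by simp
  rw [hs, map_mul, map_mul, map_r hf, hf', ← map_mul, sr_mul_r]

theorem closure_eq_top {τ : DihedralGroup n → DihedralGroup n} {s : DihedralGroup n}
    (h : IsTwoExt i c τ s) {K : Subgroup G} (h0 : i (sr 0) ∈ K) (h1 : i (sr 1) ∈ K) (hc : c ∈ K) :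
    K = ⊤ := by
  have hr1 : i (r 1) ∈ K := by
    have := mul_mem h0 h1
    rwa [← map_mul, sr_mul_sr, sub_zero] at this
  have hr : ∀ x, i (r x) ∈ K := by
    intro x
    obtain ⟨k, rfl⟩ := ZMod.natCast_zmod_surjective x
    rw [r_natCast_eq_pow, map_pow]
    exact pow_mem hr1 k
  have hi : ∀ d, i d ∈ K := by
    rintro (x | x)
    · exact hr x
    · have := mul_mem h0 (hr x)
      rwa [← map_mul, sr_mul_r, zero_add] at this
  rw [eq_top_iff]
  rintro g -
  rcases h.cover g with ⟨m, rfl⟩ | ⟨m, rfl⟩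
  · exact hi m
  · exact mul_mem (hi m) hc

theorem hasRegularTriple (h : IsTwoExt i c (dihedralPow w) 1) : HasRegularTriple G := by
  have hsr : ∀ x, orderOf (i (sr x)) = 2 := fun x => by
    rw [orderOf_injective i h.inj, orderOf_sr]
  have hc : orderOf c = 2 := by
    rw [orderOf_eq_two_iff', h.sq, map_one]
    exact ⟨rfl, fun he => h.ne 1 (by rw [map_one, he])⟩
  refine hasRegularTriple_of (hsr 0) (hsr 1) hc ?_ ?_ (h.ne _)
  · exact h.closure_eq_top (Subgroup.subset_closure (by simp)) (Subgroup.subset_closure (by simp))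
      (Subgroup.subset_closure (by simp))
  · rw [h.conj, dihedralPow_sr, mul_zero]

/-- The group maps onto an elementary abelian group of order eight. -/
theorem not_hasRotaryPair (h : IsTwoExt i c (dihedralPow w) 1) (hn : Even n) (k : ℕ)
    (hk : (k : ZMod n) = w) (hodd : Odd k) : ¬ HasRotaryPair G := by
  have hsq : ∀ g : Cyc 2 × Cyc 2 × Cyc 2, g * g = 1 := by decide
  let g₁ : Cyc 2 × Cyc 2 × Cyc 2 := (Multiplicative.ofAdd 1, 1, 1)
  let g₂ : Cyc 2 × Cyc 2 × Cyc 2 := (1, Multiplicative.ofAdd 1, 1)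
  let g₃ : Cyc 2 × Cyc 2 × Cyc 2 := (1, 1, Multiplicative.ofAdd 1)
  obtain ⟨χ, h1, h2, h3⟩ := h.exists_hom_dihedral g₁ g₂ g₃
    (by obtain ⟨m, rfl⟩ := hn; rw [pow_add, hsq]) (hsq _)
    (by rw [mul_comm g₁, mul_assoc, hsq, mul_one]) (hsq _) k hk
    (by obtain ⟨m, rfl⟩ := hodd
        rw [pow_succ, two_mul, pow_add, hsq, one_mul, mul_comm]) (mul_comm _ _)
  refine not_hasRotaryPair_of_surjective (χ := χ) ?_
  rw [← MonoidHom.range_eq_top, eq_top_iff]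
  rintro g -
  have hg : ∀ g : Cyc 2 × Cyc 2 × Cyc 2, ∃ a b d : Fin 2,
    g = (Multiplicative.ofAdd 1, 1, 1) ^ a.val * (1, Multiplicative.ofAdd 1, 1) ^ b.val *
      (1, 1, Multiplicative.ofAdd 1) ^ d.val := by decide
  obtain ⟨a, b, d, rfl⟩ := hg g
  have m1 : g₁ ∈ χ.range := ⟨_, h1⟩
  have m2 : g₂ ∈ χ.range := ⟨_, h2⟩
  have m3 : g₃ ∈ χ.range := ⟨_, h3⟩
  exact mul_mem (mul_mem (pow_mem m1 _) (pow_mem m2 _)) (pow_mem m3 _)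

end

section

variable {G : Type*} [Group G] {ℓ : ℕ} {i : DihedralGroup (2 ^ (ℓ + 1)) →* G} {c : G}
  {w : ZMod (2 ^ (ℓ + 1))}

theorem mul_of_modular {x : ZMod (2 ^ (ℓ + 1))} (hw : w = 1 ∨ w = 1 + 2 ^ ℓ) (hx : parity ℓ x = 0) :
    w * x = x := by
  rcases hw with rfl | rfl
  · exact one_mul x
  · linear_combination two_pow_mul_of_even hx

/-- The automorphisms `r 1 ↦ r v`, `sr 0 ↦ sr k`, `c ↦ r κ * c` with `v` a unit, `k` even and
`2 * κ = 0`. -/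
theorem exists_diagonal_hom (h : IsTwoExt i c (dihedralPow w) 1) (hℓ : 1 ≤ ℓ)
    (hw : w = 1 ∨ w = 1 + 2 ^ ℓ) :
    ∃ Ψ : CycByAut ℓ × Cyc 2 →* MulAut G, Function.Injective Ψ ∧
      ∀ t, Ψ t (i (r 1)) = i (r (expo t.1.right)) ∧
        Ψ t (i (sr 0)) = i (sr (double ℓ t.1.left.toAdd)) ∧
        Ψ t c = i (r (half ℓ t.2)) * c := by
  have hwh : ∀ y, w * half ℓ y = half ℓ y := fun y => mul_of_modular hw (parity_half hℓ y)
  have hwd : ∀ y, w * double ℓ y = double ℓ y := fun y => mul_of_modular hw (parity_double y)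
  have hneg : ∀ y, -half ℓ y = half ℓ y := fun y => by linear_combination -two_mul_half ℓ y
  suffices hΨ : ∃ Ψ : CycByAut ℓ × Cyc 2 →* MulAut G, ∀ t j,
      Ψ t ((![i (r 1), i (sr 0), c] : Fin 3 → G) j) = (![i (r (expo t.1.right)),
        i (sr (double ℓ t.1.left.toAdd)), i (r (half ℓ t.2)) * c] : Fin 3 → G) j by
    obtain ⟨Ψ, hΨ⟩ := hΨ
    refine ⟨Ψ, ?_, fun t => ⟨hΨ t 0, hΨ t 1, hΨ t 2⟩⟩
    rw [injective_iff_map_eq_one]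
    intro t ht
    have h1 : i (r 1) = i (r (expo t.1.right)) := by have := hΨ t 0; rwa [ht] at this
    have h2 : i (sr 0) = i (sr (double ℓ t.1.left.toAdd)) := by have := hΨ t 1; rwa [ht] at this
    have h3 : c = i (r (half ℓ t.2)) * c := by have := hΨ t 2; rwa [ht] at this
    rw [h.inj_iff, r.injEq, ← expo_one] at h1
    rw [h.inj_iff, sr.injEq, ← map_zero (double ℓ)] at h2
    rw [eq_comm, mul_eq_right, ← map_one i, h.inj_iff, one_def, r.injEq, ← half_one ℓ] at h3
    exact Prod.ext (SemidirectProduct.ext (double_injective ℓ h2).symm (expo_injective h1).symm)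
      (half_injective ℓ h3)
  refine exists_hom_mulAut ![i (r 1), i (sr 0), c]
    (fun F F' hF => h.hom_ext_dihedral (hF 0) (hF 1) (hF 2))
    (fun t : CycByAut ℓ × Cyc 2 => ![i (r (expo t.1.right)), i (sr (double ℓ t.1.left.toAdd)),
      i (r (half ℓ t.2)) * c]) ?_ ?_ ?_
  · intro t
    obtain ⟨k, hk⟩ := ZMod.natCast_zmod_surjective w
    obtain ⟨F, h1, h2, h3⟩ := h.exists_hom_dihedral (i (r (expo t.1.right)))
      (i (sr (double ℓ t.1.left.toAdd))) (i (r (half ℓ t.2)) * c)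
      (by rw [← map_pow, r_pow]; simp)
      (by rw [← map_mul, sr_mul_self, map_one])
      (by simp [← map_mul])
      (by rw [h.mulcc, dihedralPow_r, hwh, mul_one, r_mul_r, ← two_mul, two_mul_half, r_zero, map_one])
      k hk
      (by rw [h.mulcM, dihedralPow_r, ← map_pow, r_pow, hk, h.mulMc, r_mul_r, r_mul_r, mul_comm w,
        add_comm (half ℓ t.2)])
      (by rw [h.mulcM, dihedralPow_sr, h.mulMc, hwd, r_mul_sr, sr_mul_r, sub_eq_add_neg, hneg])
    refine ⟨F, fun j => ?_⟩
    fin_cases j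
    · exact h1
    · exact h2
    · exact h3
  · simp only [Prod.fst_one, Prod.snd_one, SemidirectProduct.one_right, SemidirectProduct.one_left,
      expo_one, toAdd_one, map_zero, half_one, r_zero, map_one, one_mul]
  · intro t t' F hF j
    have h1 : F (i (r 1)) = i (r (expo t.1.right)) := hF 0
    have h2 : F (i (sr 0)) = i (sr (double ℓ t.1.left.toAdd)) := hF 1
    have h3 : F c = i (r (half ℓ t.2)) * c := hF 2
    fin_cases j
    · change F (i (r (expo t'.1.right))) = i (r (expo (t * t').1.right))
      rw [map_r h1, Prod.fst_mul, SemidirectProduct.mul_right, expo_mul]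
    · change F (i (sr (double ℓ t'.1.left.toAdd))) = i (sr (double ℓ (t * t').1.left.toAdd))
      rw [map_sr h1 h2, Prod.fst_mul, SemidirectProduct.mul_left, toAdd_mul, map_add,
        double_powerAction]
    · change F (i (r (half ℓ t'.2)) * c) = i (r (half ℓ (t * t').2)) * c
      have : expo t.1.right * half ℓ t'.2 = half ℓ t'.2 := unit_mul_half (autCyc _ t.1.right) _
      rw [map_mul, map_r h1, h3, h.mulMc, r_mul_r, Prod.snd_mul, half_mul, this,
        add_comm (half ℓ t'.2)]

end

end IsTwoExt

open DihedralGroup in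
theorem isTwoExt_dihedral_prod (n : ℕ) :
    IsTwoExt (MonoidHom.inl (DihedralGroup n) (Cyc 2)) (1, Multiplicative.ofAdd 1)
      (dihedralPow 1) 1 where
  inj _ _ h := congrArg Prod.fst h
  conj m := by simp
  sq := by
    ext
    · simp
    · exact cyc_two_mul_self _
  ne m h := by
    have := congrArg Prod.snd h
    revert this
    simp only [MonoidHom.inl_apply]
    decide
  cover := by
    rintro ⟨d, y⟩
    rcases cyc_two_cases y with rfl | rfl
    · exact Or.inl ⟨d, rfl⟩
    · exact Or.inr ⟨d, by simp⟩

theorem inr_mul_inl {N K : Type*} [Group N] [Group K] {φ : K →* MulAut N} (k : K) (x : N) :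
    (SemidirectProduct.inr k * SemidirectProduct.inl x : N ⋊[φ] K) =
      SemidirectProduct.inl (φ k x) * SemidirectProduct.inr k := by
  rw [SemidirectProduct.inl_aut, map_inv, inv_mul_cancel_right]

open DihedralGroup in
theorem exists_isTwoExt_semidirect_klein {n : ℕ} (φ : Cyc 2 × Cyc 2 →* MulAut (Cyc n)) (w : ZMod n)
    (hb : ∀ x, φ (Multiplicative.ofAdd 1, 1) (Multiplicative.ofAdd x) = Multiplicative.ofAdd (-x))
    (hc : ∀ x, φ (1, Multiplicative.ofAdd 1) (Multiplicative.ofAdd x) =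
      Multiplicative.ofAdd (w * x)) :
    ∃ (i : DihedralGroup n →* Cyc n ⋊[φ] (Cyc 2 × Cyc 2)) (c : Cyc n ⋊[φ] (Cyc 2 × Cyc 2)),
      IsTwoExt i c (dihedralPow w) 1 := by
  let E : ZMod n → Cyc n ⋊[φ] (Cyc 2 × Cyc 2) := fun x => SemidirectProduct.inl (Multiplicative.ofAdd x)
  let β : Cyc n ⋊[φ] (Cyc 2 × Cyc 2) := SemidirectProduct.inr (Multiplicative.ofAdd 1, 1)
  let γ : Cyc n ⋊[φ] (Cyc 2 × Cyc 2) := SemidirectProduct.inr (1, Multiplicative.ofAdd 1)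
  have hE : ∀ x y, E (x + y) = E x * E y := fun x y => by simp only [E, ofAdd_add, map_mul]
  have hβE : ∀ x, β * E x = E (-1 * x) * β := fun x => by
    simp only [E, β, inr_mul_inl, hb, neg_one_mul]
  have hγE : ∀ x, γ * E x = E (w * x) * γ := fun x => by simp only [E, γ, inr_mul_inl, hc]
  have hE0 : E 0 = 1 := by simp [E]
  have hββ : β * β = E 0 := by
    rw [hE0]; simp only [β, ← map_mul]; exact map_one _
  have hγγ : γ * γ = 1 := by
    simp only [γ, ← map_mul]; exact map_one _
  have hβγ : γ * β = β * γ := by simp only [β, γ, ← map_mul]; rfl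
  obtain ⟨i, hi1, hi2⟩ := (isCyclicExt_dihedralGroup n).exists_hom E hE β hβE hββ
  have hi3 : ∀ x, i (sr x) = β * E x := fun x => by
    have : sr x = sr 0 * r x := by simp
    rw [this, map_mul, hi1, hi2]
  have hleft : ∀ x, (E x).left = Multiplicative.ofAdd x := fun x => by simp [E]
  have hrE : ∀ x, (E x).right = 1 := fun x => by simp [E]
  have hrβE : ∀ x, (β * E x).right = (Multiplicative.ofAdd 1, 1) := fun x => by simp [β, E]
  refine ⟨i, γ, ⟨?_, ?_, ?_, ?_, ?_⟩⟩
  · rintro (x | x) (y | y) h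
    · rw [hi1, hi1] at h
      have := congrArg SemidirectProduct.left h
      rw [hleft, hleft] at this
      rw [Multiplicative.ofAdd.injective this]
    · rw [hi1, hi3] at h
      have := congrArg SemidirectProduct.right h
      rw [hrE, hrβE] at this
      exact absurd this (by decide)
    · rw [hi1, hi3] at h
      have := congrArg SemidirectProduct.right h
      rw [hrE, hrβE] at this
      exact absurd this (by decide)
    · rw [hi3, hi3] at h
      have := congrArg SemidirectProduct.left (mul_left_cancel h)
      rw [hleft, hleft] at this
      rw [Multiplicative.ofAdd.injective this]
  · rintro (x | x)
    · rw [dihedralPow_r, hi1, hi1, hγE]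
    · rw [dihedralPow_sr, hi3, hi3, ← mul_assoc, hβγ, mul_assoc, hγE, mul_assoc]
  · rw [map_one, hγγ]
  · rintro (x | x) h
    · rw [hi1] at h
      have := congrArg SemidirectProduct.right h
      rw [hrE] at this
      revert this; simp only [γ, SemidirectProduct.right_inr]; decide
    · rw [hi3] at h
      have := congrArg SemidirectProduct.right h
      rw [hrβE] at this
      revert this; simp only [γ, SemidirectProduct.right_inr]; decide
  · intro g
    obtain ⟨x, y⟩ := g
    have hdec : (⟨x, y⟩ : Cyc n ⋊[φ] (Cyc 2 × Cyc 2)) = E x.toAdd * SemidirectProduct.inr y := by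
      ext <;> simp [E]
    obtain ⟨y₁, y₂⟩ := y
    have hinr : (SemidirectProduct.inr (y₁, y₂) : Cyc n ⋊[φ] (Cyc 2 × Cyc 2)) =
        SemidirectProduct.inr (y₁, 1) * SemidirectProduct.inr (1, y₂) := by
      rw [← map_mul, Prod.mk_mul_mk, mul_one, one_mul]
    have h1 : (SemidirectProduct.inr (1, 1) : Cyc n ⋊[φ] (Cyc 2 × Cyc 2)) = 1 := map_one _
    have hEβ : E x.toAdd * β = i (sr (-x.toAdd)) := by rw [hi3, hβE]; simp
    rw [hdec, hinr]
    rcases cyc_two_cases y₁ with rfl | rfl <;> rcases cyc_two_cases y₂ with rfl | rfl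
    · exact Or.inl ⟨r x.toAdd, by rw [h1, hi1, mul_one, mul_one]⟩
    · exact Or.inr ⟨r x.toAdd, by rw [h1, hi1, one_mul]⟩
    · exact Or.inl ⟨sr (-x.toAdd), by rw [h1, mul_one]; exact hEβ⟩
    · exact Or.inr ⟨sr (-x.toAdd), by rw [← mul_assoc, ← hEβ]⟩

theorem exists_isTwoExt_cycByKlein (ℓ : ℕ) (hℓ : 2 ≤ ℓ) :
    ∃ (i : DihedralGroup (2 ^ (ℓ + 1)) →* CycByKlein ℓ hℓ) (c : CycByKlein ℓ hℓ),
      IsTwoExt i c (dihedralPow (1 + 2 ^ ℓ)) 1 := by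
  apply exists_isTwoExt_semidirect_klein
  · intro x
    rw [MonoidHom.comp_apply, MonoidHom.coprod_apply, MonoidHom.map_one, mul_one,
      involutionHom_gen]
    change Multiplicative.ofAdd (((-1 : (ZMod (2 ^ (ℓ + 1)))ˣ) : ZMod (2 ^ (ℓ + 1))) * x) = _
    rw [Units.val_neg, Units.val_one, neg_one_mul]
  · intro x
    rw [MonoidHom.comp_apply, MonoidHom.coprod_apply, MonoidHom.map_one, one_mul,
      involutionHom_gen, add_comm (1 : ZMod (2 ^ (ℓ + 1)))]
    rfl

/-! ### The automorphism group of `D_{2 ^ (ℓ + 2)} × Z_2` -/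

section DihedralProd

open DihedralGroup

variable {ℓ : ℕ}

theorem cyc_two_pow_two_pow (hℓ : 1 ≤ ℓ) (y : Cyc 2) : y ^ 2 ^ ℓ = 1 := by
  obtain ⟨m, rfl⟩ := Nat.exists_eq_add_of_le' hℓ
  rw [pow_succ', pow_mul, pow_two, cyc_two_mul_self, one_pow]

/-- Automorphisms of `D × Z_2` preserve the rotations up to the central factor, since the other
elements are involutions, and the image of the central factor is central. -/
theorem mulAut_apply_of_prod (hℓ : 1 ≤ ℓ) (f : MulAut (DihedralGroup (2 ^ (ℓ + 1)) × Cyc 2)) :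
    ∃ (v : (ZMod (2 ^ (ℓ + 1)))ˣ) (k : ZMod (2 ^ (ℓ + 1))) (j m y : Cyc 2),
      f (r 1, 1) = (r v, j) ∧ f (sr 0, 1) = (sr k, m) ∧
      f (1, Multiplicative.ofAdd 1) = (r (half ℓ y), Multiplicative.ofAdd 1) := by
  have h2 := two_ne_zero_of_pos hℓ
  obtain ⟨⟨d, j⟩, hd⟩ : ∃ p, f (r 1, 1) = p := ⟨_, rfl⟩
  obtain ⟨⟨d', j'⟩, hd'⟩ : ∃ p, f (1, Multiplicative.ofAdd 1) = p := ⟨_, rfl⟩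
  obtain ⟨⟨d'', m⟩, hd''⟩ : ∃ p, f (sr 0, 1) = p := ⟨_, rfl⟩
  have hcomm : ∀ p, f (1, Multiplicative.ofAdd 1) * p = p * f (1, Multiplicative.ofAdd 1) := by
    intro p
    obtain ⟨q, rfl⟩ := f.surjective p
    rw [← map_mul, ← map_mul]
    congr 1
    exact Prod.ext ((one_mul _).trans (mul_one _).symm) (mul_comm _ _)
  -- `f (r 1)` is a rotation, up to the central factor
  rcases d with v | x
  swap
  · exfalso
    have h3 : f (r 2, 1) = 1 := by
      have : ((r 2, 1) : DihedralGroup (2 ^ (ℓ + 1)) × Cyc 2) = (r 1, 1) * (r 1, 1) := by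
        rw [Prod.mk_mul_mk, r_mul_r, one_add_one_eq_two, mul_one]
      rw [this, map_mul, hd, Prod.mk_mul_mk, sr_mul_self, cyc_two_mul_self]; rfl
    rw [map_eq_one_iff f f.injective] at h3
    exact h2 (r.inj (congrArg Prod.fst h3))
  -- `f` fixes the central rotation, so `v` is odd
  have hfz : f (r (2 ^ ℓ), 1) = (r (v * 2 ^ ℓ), 1) := by
    have : ((r (2 ^ ℓ), 1) : DihedralGroup (2 ^ (ℓ + 1)) × Cyc 2) = (r 1, 1) ^ 2 ^ ℓ := by
      rw [Prod.pow_mk, r_one_pow, one_pow]; push_cast; rfl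
    rw [this, map_pow, hd, Prod.pow_mk, r_pow, cyc_two_pow_two_pow hℓ]; push_cast; rfl
  have hpv : parity ℓ v = 1 := by
    rcases parity_eq_zero_or_one v with hp | hp
    · rw [mul_comm, two_pow_mul_of_even hp, r_zero] at hfz
      have := (map_eq_one_iff f f.injective).1 hfz
      exact absurd (r.inj (congrArg Prod.fst this)) (two_pow_ne_zero ℓ)
    · exact hp
  rw [mul_comm, two_pow_mul_of_odd hpv] at hfz
  obtain ⟨v, rfl⟩ := parity_eq_one_iff.1 hpv
  -- the image of the central factor
  obtain ⟨κ, hκ, rfl⟩ : ∃ κ : ZMod (2 ^ (ℓ + 1)), 2 * κ = 0 ∧ d' = r κ := by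
    rcases d' with κ | x
    · have := congrArg Prod.fst (hcomm (sr 0, 1))
      rw [hd', Prod.fst_mul, Prod.fst_mul, r_mul_sr, sr_mul_r, sr.injEq] at this
      exact ⟨κ, by linear_combination -this, rfl⟩
    · have := congrArg Prod.fst (hcomm (r 1, 1))
      rw [hd', Prod.fst_mul, Prod.fst_mul, r_mul_sr, sr_mul_r, sr.injEq] at this
      exact absurd (by linear_combination this) h2
  have hj' : j' = Multiplicative.ofAdd 1 := by
    rcases cyc_two_cases j' with rfl | rfl
    · exfalso
      have hne : ∀ p : DihedralGroup (2 ^ (ℓ + 1)), f (1, Multiplicative.ofAdd 1) ≠ f (p, 1) := by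
        intro p h
        have := congrArg Prod.snd (f.injective h)
        revert this; dsimp only; decide
      rcases two_mul_eq_zero_iff.1 hκ with rfl | rfl
      · exact hne 1 (by rw [hd', r_zero]; exact (map_one f).symm)
      · exact hne (r (2 ^ ℓ)) (by rw [hd', hfz])
    · rfl
  obtain ⟨y, rfl⟩ := exists_half_iff.2 hκ
  subst hj'
  rcases d'' with k | k
  · exfalso
    have h3 : f ((sr 0, 1) * (r 1, 1)) = f ((r 1, 1) * (sr 0, 1)) := by
      rw [map_mul, map_mul, hd, hd'']
      exact Prod.ext (by simp [add_comm]) (mul_comm _ _)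
    have h4 := congrArg Prod.fst (f.injective h3)
    rw [Prod.fst_mul, Prod.fst_mul, sr_mul_r, r_mul_sr, sr.injEq] at h4
    exact h2 (by linear_combination h4)
  · exact ⟨v, k, j, m, y, hd, hd'', hd'⟩

/-- The parity of the exponent of a rotation or of a reflection. -/
def dihedralParity : DihedralGroup (2 ^ (ℓ + 1)) → ZMod 2
  | r x => parity ℓ x
  | sr x => parity ℓ x

/-- The dihedral group of order eight as the group of triples `(j, k, m)` with the product
`(j * j', k + k', m * m' * j ^ k')`. -/
def heisenberg (j : Cyc 2) (k : ZMod 2) (m : Cyc 2) : DihedralGroup 4 :=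
  r 2 ^ m.toAdd.val * sr 1 ^ k.val * sr 0 ^ j.toAdd.val

theorem heisenberg_mul : ∀ (j : Cyc 2) (k : ZMod 2) (m j' : Cyc 2) (k' : ZMod 2) (m' : Cyc 2),
    heisenberg j k m * heisenberg j' k' m' =
      heisenberg (j * j') (k + k') (m * (j ^ k'.val * m')) := by
  decide

theorem heisenberg_eq_one : ∀ (j : Cyc 2) (k : ZMod 2) (m : Cyc 2), heisenberg j k m = 1 →
    j = 1 ∧ k = 0 ∧ m = 1 := by
  decide

theorem heisenberg_surjective : ∀ d, ∃ j k m, heisenberg j k m = d := by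
  decide

/-- The coordinate `y` of a central rotation `r (half ℓ y)`. -/
def centralCoordinate (d : DihedralGroup (2 ^ (ℓ + 1))) : Cyc 2 :=
  if d = 1 then 1 else Multiplicative.ofAdd 1

theorem centralCoordinate_half (y : Cyc 2) : centralCoordinate (r (half ℓ y)) = y := by
  rcases cyc_two_cases y with rfl | rfl
  · rw [half_one, r_zero, centralCoordinate, if_pos rfl]
  · rw [half_gen, centralCoordinate, if_neg]
    intro h
    exact two_pow_ne_zero ℓ (r.inj h)

/-- The action of an automorphism on the Frattini quotient, a unitriangular matrix whose entries are
read off from the images of `r 1` and `sr 0`, together with its action on the centre, read off from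
the image of the direct factor `Z_2`. -/
def frattiniAction (f : MulAut (DihedralGroup (2 ^ (ℓ + 1)) × Cyc 2)) : DihedralGroup 4 × Cyc 2 :=
  (heisenberg (f (r 1, 1)).2 (dihedralParity (f (sr 0, 1)).1) (f (sr 0, 1)).2,
    centralCoordinate (f (1, Multiplicative.ofAdd 1)).1)

theorem frattiniAction_eq {f : MulAut (DihedralGroup (2 ^ (ℓ + 1)) × Cyc 2)} {v k : ZMod (2 ^ (ℓ + 1))}
    {j m y : Cyc 2} (h1 : f (r 1, 1) = (r v, j)) (h2 : f (sr 0, 1) = (sr k, m))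
    (h3 : f (1, Multiplicative.ofAdd 1) = (r (half ℓ y), Multiplicative.ofAdd 1)) :
    frattiniAction f = (heisenberg j (parity ℓ k) m, y) := by
  rw [frattiniAction, h1, h2, h3]
  exact Prod.ext rfl (centralCoordinate_half y)

theorem map_r_prod {f : DihedralGroup (2 ^ (ℓ + 1)) × Cyc 2 →* DihedralGroup (2 ^ (ℓ + 1)) × Cyc 2}
    {v : ZMod (2 ^ (ℓ + 1))} {j : Cyc 2} (h1 : f (r 1, 1) = (r v, j)) (x : ZMod (2 ^ (ℓ + 1))) :
    f (r x, 1) = (r (v * x), j ^ (parity ℓ x).val) := by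
  obtain ⟨l, rfl⟩ := ZMod.natCast_zmod_surjective x
  have : ((r (l : ZMod (2 ^ (ℓ + 1))), 1) : DihedralGroup (2 ^ (ℓ + 1)) × Cyc 2) = (r 1, 1) ^ l := by
    rw [Prod.pow_mk, r_one_pow, one_pow]
  rw [this, map_pow, h1, Prod.pow_mk, r_pow, parity_natCast, ZMod.val_natCast]
  exact Prod.ext rfl (pow_eq_pow_mod l ((pow_two j).trans (cyc_two_mul_self j)))

theorem map_cyc_prod (hℓ : 1 ≤ ℓ)
    {f : DihedralGroup (2 ^ (ℓ + 1)) × Cyc 2 →* DihedralGroup (2 ^ (ℓ + 1)) × Cyc 2}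
    {y : Cyc 2} (h3 : f (1, Multiplicative.ofAdd 1) = (r (half ℓ y), Multiplicative.ofAdd 1))
    (j : Cyc 2) : ∃ κ, 2 * κ = 0 ∧ parity ℓ κ = 0 ∧ f (1, j) = (r κ, j) := by
  rcases cyc_two_cases j with rfl | rfl
  · exact ⟨0, mul_zero _, map_zero _, by rw [r_zero]; exact map_one f⟩
  · exact ⟨half ℓ y, two_mul_half ℓ y, parity_half hℓ y, h3⟩

/-- `frattiniAction` is multiplicative, like the corresponding matrices. -/
theorem frattiniAction_mul (hℓ : 1 ≤ ℓ) (f f' : MulAut (DihedralGroup (2 ^ (ℓ + 1)) × Cyc 2)) :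
    frattiniAction (f * f') = frattiniAction f * frattiniAction f' := by
  obtain ⟨v, k, j, m, y, h1, h2, h3⟩ := mulAut_apply_of_prod hℓ f
  obtain ⟨v', k', j', m', y', h1', h2', h3'⟩ := mulAut_apply_of_prod hℓ f'
  rw [frattiniAction_eq h1 h2 h3, frattiniAction_eq h1' h2' h3', Prod.mk_mul_mk, heisenberg_mul]
  have hr := map_r_prod (f := f.toMonoidHom) h1
  simp only [MulEquiv.toMonoidHom_eq_coe, MonoidHom.coe_coe] at hr
  have hsplit : ∀ (d : DihedralGroup (2 ^ (ℓ + 1))) (e : Cyc 2), f (d, e) = f (d, 1) * f (1, e) := by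
    intro d e
    rw [← map_mul, Prod.mk_mul_mk, mul_one, one_mul]
  have e1 : ∃ κ, (f * f') (r 1, 1) = (r κ, j * j') := by
    obtain ⟨κ, -, -, hκ⟩ := map_cyc_prod (f := f.toMonoidHom) hℓ h3 j'
    simp only [MulEquiv.toMonoidHom_eq_coe, MonoidHom.coe_coe] at hκ
    refine ⟨v * v' + κ, ?_⟩
    rw [MulAut.mul_apply, h1', hsplit, hr, hκ, Prod.mk_mul_mk, r_mul_r, parity_unit]
    congr 2
    exact pow_one j
  obtain ⟨κ, e1⟩ := e1
  have e2 : ∃ κ, parity ℓ κ = parity ℓ k + parity ℓ k' ∧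
      (f * f') (sr 0, 1) = (sr κ, m * (j ^ (parity ℓ k').val * m')) := by
    obtain ⟨κ, -, hp, hκ⟩ := map_cyc_prod (f := f.toMonoidHom) hℓ h3 m'
    simp only [MulEquiv.toMonoidHom_eq_coe, MonoidHom.coe_coe] at hκ
    refine ⟨k + v * k' + κ, ?_, ?_⟩
    · rw [map_add, map_add, map_mul, parity_unit, hp, one_mul, add_zero]
    · have hs : ((sr k', 1) : DihedralGroup (2 ^ (ℓ + 1)) × Cyc 2) = (sr 0, 1) * (r k', 1) := by
        rw [Prod.mk_mul_mk, sr_mul_r, zero_add, mul_one]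
      rw [MulAut.mul_apply, h2', hsplit, hs, map_mul, hr, hκ, h2, Prod.mk_mul_mk, Prod.mk_mul_mk,
        sr_mul_r, sr_mul_r, mul_assoc]
  obtain ⟨κ', hκ', e2⟩ := e2
  have e3 : (f * f') (1, Multiplicative.ofAdd 1) =
      (r (half ℓ (y * y')), Multiplicative.ofAdd 1) := by
    rw [MulAut.mul_apply, h3', hsplit, hr, h3, Prod.mk_mul_mk, r_mul_r, unit_mul_half, half_mul,
      parity_half hℓ, add_comm (half ℓ y')]
    exact Prod.ext rfl (one_mul _)
  rw [frattiniAction_eq e1 e2 e3, hκ']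

/-- All actions on the Frattini quotient and on the centre that are compatible with the commutator
map are realized. -/
theorem exists_mulAut_prod (hℓ : 1 ≤ ℓ) (k : ZMod (2 ^ (ℓ + 1))) (j m y : Cyc 2) :
    ∃ f : MulAut (DihedralGroup (2 ^ (ℓ + 1)) × Cyc 2), f (r 1, 1) = (r 1, j) ∧
      f (sr 0, 1) = (sr k, m) ∧
      f (1, Multiplicative.ofAdd 1) = (r (half ℓ y), Multiplicative.ofAdd 1) := by
  have hneg : -half ℓ y = half ℓ y := by linear_combination -two_mul_half ℓ y
  obtain ⟨F, h1, h2, h3⟩ := (isTwoExt_dihedral_prod (2 ^ (ℓ + 1))).exists_hom_dihedral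
    (H := DihedralGroup (2 ^ (ℓ + 1)) × Cyc 2) (r 1, j) (sr k, m)
    (r (half ℓ y), Multiplicative.ofAdd 1)
    (by rw [Prod.pow_mk, r_one_pow_n, cyc_two_pow_two_pow (by omega)]; rfl)
    (by rw [Prod.mk_mul_mk, sr_mul_self, cyc_two_mul_self]; rfl)
    (by rw [Prod.mk_mul_mk, Prod.mk_mul_mk, r_mul_sr, sr_mul_r, sub_add_cancel, mul_comm j, mul_assoc,
      cyc_two_mul_self, mul_one])
    (by rw [Prod.mk_mul_mk, r_mul_r, ← two_mul, two_mul_half, r_zero, cyc_two_mul_self]; rfl)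
    1 Nat.cast_one
    (by rw [pow_one, Prod.mk_mul_mk, Prod.mk_mul_mk, r_mul_r, r_mul_r,
      add_comm (half ℓ y), mul_comm j])
    (by rw [Prod.mk_mul_mk, Prod.mk_mul_mk, r_mul_sr, sr_mul_r, sub_eq_add_neg, hneg,
      mul_comm m])
  rw [MonoidHom.inl_apply] at h1 h2
  have hr := map_r_prod h1
  have hinj : Function.Injective F := by
    rw [injective_iff_map_eq_one]
    rintro ⟨d, e⟩ hd
    have hsplit : F (d, e) = F (d, 1) * F (1, e) := by
      rw [← map_mul, Prod.mk_mul_mk, mul_one, one_mul]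
    rcases d with x | x
    · rw [hsplit, hr, one_mul] at hd
      rcases cyc_two_cases e with rfl | rfl
      · rw [show ((1, 1) : DihedralGroup (2 ^ (ℓ + 1)) × Cyc 2) = 1 from rfl, map_one, mul_one] at hd
        rw [r.inj (congrArg Prod.fst hd), r_zero]; rfl
      · exfalso
        rw [h3, Prod.mk_mul_mk, r_mul_r] at hd
        have hx : x = half ℓ y := by
          rw [← hneg]
          linear_combination r.inj (congrArg Prod.fst hd)
        have := congrArg Prod.snd hd
        dsimp only at this
        rw [hx, parity_half hℓ, ZMod.val_zero, pow_zero, one_mul] at this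
        exact absurd (show Multiplicative.ofAdd (1 : ZMod 2) = 1 from this) (by decide)
    · exfalso
      obtain ⟨κ, -, -, hκ⟩ := map_cyc_prod hℓ h3 e
      have hs : ((sr x, 1) : DihedralGroup (2 ^ (ℓ + 1)) × Cyc 2) = (sr 0, 1) * (r x, 1) := by
        rw [Prod.mk_mul_mk, sr_mul_r, zero_add, mul_one]
      rw [hsplit, hs, map_mul, h2, hr, hκ, Prod.mk_mul_mk, Prod.mk_mul_mk, sr_mul_r, sr_mul_r] at hd
      have := congrArg Prod.fst hd
      rw [Prod.fst_one, one_def] at this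
      cases this
  exact ⟨MulEquiv.ofBijective F (Finite.injective_iff_bijective.1 hinj), h1, h2, h3⟩

/-- The automorphism group of `D_{2 ^ (ℓ + 2)} × Z_2`. The normal subgroup is the kernel of the
action on the Frattini quotient and on the centre. -/
theorem mulAut_dihedral_prod (hℓ : 1 ≤ ℓ) {G : Type*} [Group G]
    (e : G ≃* DihedralGroup (2 ^ (ℓ + 1)) × Cyc 2) :
    IsPGroup 2 (MulAut G) ∧ ∃ (H : Subgroup (MulAut G)) (_ : H.Normal),
      Nonempty (H ≃* CycByAut ℓ) ∧ Nonempty (MulAut G ⧸ H ≃* DihedralGroup 4 × Cyc 2) := by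
  let Θ₀ : MulAut (DihedralGroup (2 ^ (ℓ + 1)) × Cyc 2) →* DihedralGroup 4 × Cyc 2 :=
    MonoidHom.mk' frattiniAction (frattiniAction_mul hℓ)
  have hsurj₀ : Function.Surjective Θ₀ := by
    rintro ⟨d, y⟩
    obtain ⟨j, k, m, rfl⟩ := heisenberg_surjective d
    obtain ⟨f, h1, h2, h3⟩ := exists_mulAut_prod hℓ (k.val : ZMod (2 ^ (ℓ + 1))) j m y
    refine ⟨f, (frattiniAction_eq h1 h2 h3).trans ?_⟩
    rw [parity_natCast, ZMod.natCast_zmod_val]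
  obtain ⟨Ψ, hΨ, hΨt⟩ := (isTwoExt_dihedral_prod (2 ^ (ℓ + 1))).exists_diagonal_hom hℓ (Or.inl rfl)
  have hker : (Ψ.comp (MonoidHom.inl _ _)).range = Θ₀.ker := by
    ext f
    constructor
    · rintro ⟨t, rfl⟩
      obtain ⟨h1, h2, h3⟩ := hΨt (t, 1)
      refine (frattiniAction_eq h1 h2 (y := 1) (h3.trans (Prod.ext (mul_one _) (one_mul _)))).trans ?_
      dsimp only
      rw [parity_double]
      rfl
    · intro hf
      obtain ⟨v, k, j, m, y, h1, h2, h3⟩ := mulAut_apply_of_prod hℓ f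
      have hf1 := (frattiniAction_eq h1 h2 h3).symm.trans hf
      obtain ⟨rfl, hk, rfl⟩ := heisenberg_eq_one _ _ _ (congrArg Prod.fst hf1)
      obtain rfl : y = 1 := congrArg Prod.snd hf1
      obtain ⟨x, rfl⟩ := exists_double_iff.2 hk
      obtain ⟨φ, hφ⟩ := exists_expo v
      refine ⟨⟨Multiplicative.ofAdd x, φ⟩, ?_⟩
      obtain ⟨h1', h2', h3'⟩ := hΨt (⟨Multiplicative.ofAdd x, φ⟩, 1)
      have := (isTwoExt_dihedral_prod (2 ^ (ℓ + 1))).hom_ext_dihedral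
        (F := (Ψ (⟨Multiplicative.ofAdd x, φ⟩, 1)).toMonoidHom) (F' := f.toMonoidHom)
        (h1'.trans (by rw [hφ]; exact h1.symm)) (h2'.trans h2.symm)
        (h3'.trans (by
          rw [MulEquiv.toMonoidHom_eq_coe, MonoidHom.coe_coe, h3]
          exact Prod.ext (mul_one _) (one_mul _)))
      ext1 g
      exact DFunLike.congr_fun this g
  have hinj : Function.Injective (Ψ.comp (MonoidHom.inl (CycByAut ℓ) (Cyc 2))) :=
    hΨ.comp fun _ _ h => congrArg Prod.fst h
  let Θ : MulAut G →* DihedralGroup 4 × Cyc 2 := Θ₀.comp (MulAut.congr e).toMonoidHom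
  have hsurj : Function.Surjective Θ := hsurj₀.comp (MulAut.congr e).surjective
  let ι : CycByAut ℓ →* MulAut G :=
    (MulAut.congr e).symm.toMonoidHom.comp (Ψ.comp (MonoidHom.inl _ _))
  have hι : Function.Injective ι := (MulAut.congr e).symm.injective.comp hinj
  have hkι : ι.range = Θ.ker := by
    ext f
    have h1 : f ∈ Θ.ker ↔ MulAut.congr e f ∈ Θ₀.ker := Iff.rfl
    rw [h1, ← hker]
    constructor
    · rintro ⟨t, rfl⟩
      exact ⟨t, ((MulAut.congr e).apply_symm_apply _).symm⟩
    · rintro ⟨t, ht⟩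
      refine ⟨t, ?_⟩
      change (MulAut.congr e).symm _ = f
      rw [ht, MulEquiv.symm_apply_apply]
  have E₁ : Θ.ker ≃* CycByAut ℓ :=
    ((MonoidHom.ofInjective hι).trans (MulEquiv.subgroupCongr hkι)).symm
  have E₂ : MulAut G ⧸ Θ.ker ≃* DihedralGroup 4 × Cyc 2 :=
    QuotientGroup.quotientKerEquivOfSurjective Θ hsurj
  refine ⟨IsPGroup.of_card (n := 4 + (ℓ + ℓ)) ?_, Θ.ker, inferInstance, ⟨E₁⟩, ⟨E₂⟩⟩
  rw [Subgroup.card_eq_card_quotient_mul_card_subgroup Θ.ker, Nat.card_congr E₁.toEquiv,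
    Nat.card_congr E₂.toEquiv, card_cycByAut, Nat.card_prod, DihedralGroup.nat_card, card_cyc]
  ring

end DihedralProd

/-! ### The automorphism group of `Z_{2 ^ (ℓ + 1)} : Z_2 ^ 2` -/

/-- A group with a subgroup of index two and an involution outside of it is a semidirect product. -/
theorem exists_semidirect_of_index_two {A X : Type*} [Group A] [Group X] (Ψ : A →* X)
    (hΨ : Function.Injective Ψ) (ρ : X) (hρ : ρ * ρ = 1) (hne : ∀ t, Ψ t ≠ ρ)
    (hcov : ∀ f, (∃ t, f = Ψ t) ∨ ∃ t, f = Ψ t * ρ) :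
    ∃ θ : Cyc 2 →* MulAut A, Nonempty (X ≃* A ⋊[θ] Cyc 2) := by
  have hρn : ρ ∉ Ψ.range := fun ⟨t, ht⟩ => hne t ht
  have hidx : Ψ.range.index = 2 := by
    rw [Subgroup.index_eq_two_iff]
    refine ⟨ρ, fun f => ?_⟩
    rcases hcov f with ⟨t, rfl⟩ | ⟨t, rfl⟩
    · refine Or.inr ⟨⟨t, rfl⟩, fun h => hρn ?_⟩
      exact (Subgroup.mul_mem_cancel_left _ (show Ψ t ∈ Ψ.range from ⟨t, rfl⟩)).1 h
    · refine Or.inl ⟨⟨t, by rw [mul_assoc, hρ, mul_one]⟩, fun h => hρn ?_⟩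
      exact (Subgroup.mul_mem_cancel_left _ (show Ψ t ∈ Ψ.range from ⟨t, rfl⟩)).1 h
  obtain ⟨τ, s, h⟩ := isTwoExt_of_index_two hidx (MonoidHom.ofInjective hΨ) hρn
  have hs : s = 1 := h.inj (by rw [← h.sq, hρ, map_one])
  subst hs
  have hττ : ∀ m, τ (τ m) = m := fun m => by
    have h1 := h.conj m
    have h2 := congrArg (ρ * ·) h1
    rw [← mul_assoc, hρ, one_mul, ← mul_assoc, h.conj, mul_assoc, hρ, mul_one] at h2
    exact (h.inj h2).symm
  let τ' : MulAut A := τ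
  have hτ' : τ' ^ 2 = 1 := by
    ext m
    rw [pow_two]
    exact hττ m
  refine ⟨cycHom τ' hτ', h.nonempty_mulEquiv (i' := SemidirectProduct.inl)
    (c' := SemidirectProduct.inr (Multiplicative.ofAdd 1)) ⟨?_, ?_, ?_, ?_, ?_⟩⟩
  · exact SemidirectProduct.inl_injective
  · intro m
    rw [inr_mul_inl, cycHom_one]
  · exact (map_mul _ _ _).symm.trans ((congrArg _ (cyc_two_mul_self _)).trans
      ((MonoidHom.map_one _).trans (MonoidHom.map_one _).symm))
  · intro m h
    have := congrArg SemidirectProduct.right h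
    rw [SemidirectProduct.right_inl, SemidirectProduct.right_inr] at this
    exact absurd this (by decide)
  · rintro ⟨x, y⟩
    rcases cyc_two_cases y with rfl | rfl
    · exact Or.inl ⟨x, rfl⟩
    · refine Or.inr ⟨x, ?_⟩
      ext <;> simp

namespace IsTwoExt

open DihedralGroup

variable {G : Type*} [Group G] {ℓ : ℕ} {i : DihedralGroup (2 ^ (ℓ + 1)) →* G} {c : G}

/-- The automorphism `r 1 ↦ r 1 * c`, `sr 0 ↦ sr 0 * c`, `c ↦ c`, an involution that does not
preserve the dihedral subgroup. -/
theorem exists_swap (h : IsTwoExt i c (dihedralPow (1 + 2 ^ ℓ)) 1) (hℓ : 2 ≤ ℓ) :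
    ∃ ρ : MulAut G, ρ (i (r 1)) = i (r 1) * c ∧ ρ (i (sr 0)) = i (sr 0) * c ∧ ρ c = c ∧
      ρ * ρ = 1 := by
  have hcc : c * c = 1 := by rw [h.sq, map_one]
  have h2 : i (r 1) * c * (i (r 1) * c) = i (r (2 + 2 ^ ℓ)) := by
    rw [h.mulcc, dihedralPow_r, mul_one, mul_one, r_mul_r]
    congr 2
    ring
  have h3 : (i (r 1) * c) ^ 2 ^ ℓ = i (r (2 ^ ℓ)) := by
    obtain ⟨m, rfl⟩ := Nat.exists_eq_add_of_le' hℓ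
    rw [show 2 ^ (m + 2) = 2 * 2 ^ (m + 1) from pow_succ' 2 (m + 1), pow_mul, pow_two, h2, ← map_pow,
      r_pow]
    congr 2
    push_cast
    linear_combination 2 ^ m * two_pow_mul_two (m + 2)
  have h4 : (i (r 1) * c) ^ 2 ^ (ℓ + 1) = 1 := by
    have : ∀ g : G, g ^ 2 ^ (ℓ + 1) = g ^ 2 ^ ℓ * g ^ 2 ^ ℓ := fun g => by
      rw [pow_succ, pow_mul, pow_two]
    rw [this, h3, ← map_mul, r_mul_r, two_pow_add_two_pow, r_zero, map_one]
  obtain ⟨F, h5, h6, h7⟩ := h.exists_hom_dihedral (i (r 1) * c) (i (sr 0) * c) c h4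
    (by rw [h.mulcc, dihedralPow_sr, mul_zero, mul_one, sr_mul_self, map_one])
    (by rw [h.mulcc, dihedralPow_sr, mul_zero, mul_one, r_mul_sr, h.mulMc, sr_mul_r, zero_sub,
      neg_add_cancel])
    hcc (1 + 2 ^ ℓ) (by push_cast; rfl)
    (by have h5 : ∀ g : G, g ^ (1 + 2 ^ ℓ) = g * g ^ 2 ^ ℓ := fun g => by rw [pow_add, pow_one]
        rw [h5, h3, ← mul_assoc, h.conj, mul_assoc, hcc, mul_one, mul_assoc (i (r 1)), h.conj,
          ← mul_assoc, ← map_mul, mul_assoc, hcc, mul_one, dihedralPow_r, dihedralPow_r, r_mul_r,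
          mul_one]
        congr 2
        linear_combination -two_pow_mul_two_pow (show 1 ≤ ℓ by omega))
    (by rw [← mul_assoc, h.conj, dihedralPow_sr, mul_zero])
  obtain ⟨ρ, hρ, hρρ⟩ := exists_mulAut_of_involutive F (h.hom_ext_dihedral
    (by rw [MonoidHom.comp_apply, h5, map_mul, h5, h7, mul_assoc, hcc, mul_one]; rfl)
    (by rw [MonoidHom.comp_apply, h6, map_mul, h6, h7, mul_assoc, hcc, mul_one]; rfl)
    (by rw [MonoidHom.comp_apply, h7, h7]; rfl))
  exact ⟨ρ, by rw [hρ, h5], by rw [hρ, h6], by rw [hρ, h7], hρρ⟩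

/-- The shape of an automorphism: up to `exists_swap` it is diagonal. -/
theorem mulAut_apply_of_modular (h : IsTwoExt i c (dihedralPow (1 + 2 ^ ℓ)) 1) (hℓ : 2 ≤ ℓ)
    (f : MulAut G) : ∃ (v : (ZMod (2 ^ (ℓ + 1)))ˣ) (k : ZMod (2 ^ (ℓ + 1))) (y : Cyc 2),
      parity ℓ k = 0 ∧ f c = i (r (half ℓ y)) * c ∧
      ((f (i (r 1)) = i (r v) ∧ f (i (sr 0)) = i (sr k)) ∨
        (f (i (r 1)) = i (r v) * c ∧ f (i (sr 0)) = i (sr k) * c)) := by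
  have four := four_ne_zero_of_two_le hℓ
  have hcc : c * c = 1 := by rw [h.sq, map_one]
  have hu : IsUnit (1 + 2 ^ (ℓ - 1) : ZMod (2 ^ (ℓ + 1))) := by
    apply parity_eq_one_iff.1
    rw [map_add, map_one, map_pow, parity_two, zero_pow (by omega), add_zero]
  have hhalf : (2 : ZMod (2 ^ (ℓ + 1))) * 2 ^ (ℓ - 1) = 2 ^ ℓ := by
    obtain ⟨m, rfl⟩ := Nat.exists_eq_add_of_le' (show 1 ≤ ℓ by omega)
    rw [Nat.add_sub_cancel]; ring
  have hpow : ∀ x k, (i (r x)) ^ k = i (r (x * (k : ℕ))) := fun x k => by rw [← map_pow, r_pow]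
  -- elements outside of `⟨r 1, c⟩` have order at most `4`, so `f (r 1)` lies inside
  have hout : ∀ x, i (sr x) ^ 4 = 1 ∧ (i (sr x) * c) ^ 4 = 1 := by
    intro x
    constructor
    · rw [pow_four_eq, ← map_mul, sr_mul_self, map_one, mul_one]
    · rw [pow_four_eq, h.mulcc, dihedralPow_sr, sr_mul_sr, mul_one, ← map_mul, r_mul_r, ← map_one i,
        ← r_zero]
      congr 2
      linear_combination x * two_mul_two_pow ℓ
  have hr4 : f (i (r 1)) ^ 4 ≠ 1 := by
    intro h4
    rw [← map_pow, map_eq_one_iff f f.injective, hpow, one_mul, ← map_one i, h.inj_iff, ← r_zero,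
      r.injEq] at h4
    exact four (by exact_mod_cast h4)
  obtain ⟨v, hv⟩ : ∃ v, f (i (r 1)) = i (r v) ∨ f (i (r 1)) = i (r v) * c := by
    rcases h.cover (f (i (r 1))) with ⟨v | x, hv⟩ | ⟨v | x, hv⟩
    · exact ⟨v, Or.inl hv⟩
    · exact absurd (by rw [hv, (hout x).1]) hr4
    · exact ⟨v, Or.inr hv⟩
    · exact absurd (by rw [hv, (hout x).2]) hr4
  -- the square of `r 1`
  obtain ⟨v', hpv', hv'⟩ : ∃ v', parity ℓ v' = parity ℓ v ∧ f (i (r 2)) = i (r (2 * v')) := by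
    have hr2 : i (r 2) = i (r 1) * i (r 1) := by rw [← map_mul, r_mul_r, one_add_one_eq_two]
    rcases hv with hv | hv
    · exact ⟨v, rfl, by rw [hr2, map_mul, hv, ← map_mul, r_mul_r, two_mul]⟩
    · refine ⟨v * (1 + 2 ^ (ℓ - 1)), ?_, ?_⟩
      · rw [map_mul, parity_eq_one_iff.2 hu, mul_one]
      · rw [hr2, map_mul, hv, h.mulcc, dihedralPow_r, r_mul_r, mul_one]
        congr 2
        linear_combination -v * hhalf
  have hfz : f (i (r (2 ^ ℓ))) = i (r (2 ^ ℓ * v')) := by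
    have h1 : i (r (2 ^ ℓ)) = i (r 2) ^ 2 ^ (ℓ - 1) := by
      rw [hpow]; push_cast; rw [hhalf]
    rw [h1, map_pow, hv', hpow]
    push_cast
    congr 2
    linear_combination v' * hhalf
  have hpv : parity ℓ v' = 1 := by
    rcases parity_eq_zero_or_one v' with hp | hp
    · rw [two_pow_mul_of_even hp, r_zero, map_one, map_eq_one_iff f f.injective, ← map_one i,
        h.inj_iff, ← r_zero, r.injEq] at hfz
      exact absurd hfz (two_pow_ne_zero ℓ)
    · exact hp
  rw [two_pow_mul_of_odd hpv] at hfz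
  have hu' := parity_eq_one_iff.1 hpv
  obtain ⟨v, rfl⟩ := parity_eq_one_iff.1 (hpv'.symm.trans hpv)
  have h4v : ¬ (4 * v' = 0) := fun h4 => four (hu'.mul_left_eq_zero.1 h4)
  have hw2 : ∀ x : ZMod (2 ^ (ℓ + 1)), (1 + 2 ^ ℓ) * (2 * x) = 2 * x := fun x => by
    linear_combination x * two_pow_mul_two ℓ
  -- the image of `c` centralizes the square of the image of `r 1`
  have hcomm2 : f c * i (r (2 * v')) = i (r (2 * v')) * f c := by
    have h1 := hw2 1
    rw [mul_one] at h1
    rw [← hv', ← map_mul, ← map_mul, h.conj, dihedralPow_r, h1]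
  have hfcc : f c * f c = 1 := by rw [← map_mul, hcc, map_one]
  have hfc : ∃ κ, f c = i (r κ) * c := by
    rcases h.cover (f c) with ⟨κ | x, hκ⟩ | ⟨κ | x, hκ⟩
    · exfalso
      rw [hκ, ← map_mul, r_mul_r, ← map_one i, h.inj_iff, ← r_zero, r.injEq, ← two_mul] at hfcc
      rcases two_mul_eq_zero_iff.1 hfcc with rfl | rfl
      · rw [r_zero, map_one, map_eq_one_iff f f.injective] at hκ
        exact h.ne 1 (by rw [hκ, map_one])
      · rw [← hfz] at hκ
        exact h.ne _ (f.injective hκ).symm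
    · exfalso
      rw [hκ, ← map_mul, ← map_mul, h.inj_iff, sr_mul_r, r_mul_sr, sr.injEq] at hcomm2
      exact h4v (by linear_combination hcomm2)
    · exact ⟨κ, hκ⟩
    · exfalso
      rw [hκ, h.mulcM, h.mulMc, dihedralPow_r, hw2, h.mul_c_inj, sr_mul_r, r_mul_sr, sr.injEq]
        at hcomm2
      exact h4v (by linear_combination hcomm2)
  obtain ⟨κ, hκ⟩ := hfc
  rw [hκ, h.mulcc, dihedralPow_r, r_mul_r, mul_one, ← map_one i, h.inj_iff, ← r_zero, r.injEq] at hfcc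
  have h2κ : 2 * κ = 0 := by
    refine hu.mul_left_eq_zero.1 ?_
    linear_combination hfcc + κ * hhalf
  obtain ⟨y, rfl⟩ := exists_half_iff.2 h2κ
  have hy : (1 + 2 ^ ℓ) * half ℓ y = half ℓ y :=
    mul_of_modular (Or.inr rfl) (parity_half (by omega) y)
  -- the image of `sr 0`
  have hs2 : f (i (sr 0)) * i (r (2 * v')) ≠ i (r (2 * v')) * f (i (sr 0)) := by
    rw [← hv', ← map_mul f, ← map_mul f, Ne, f.injective.eq_iff, ← map_mul i, ← map_mul i, h.inj_iff,
      sr_mul_r, r_mul_sr, sr.injEq]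
    intro he
    exact four (by linear_combination he)
  have hsc : f (i (sr 0)) * f c = f c * f (i (sr 0)) := by
    rw [← map_mul, ← map_mul, h.conj, dihedralPow_sr, mul_zero]
  have hpar : ∀ k : ZMod (2 ^ (ℓ + 1)), 2 ^ ℓ * k = 0 → parity ℓ k = 0 := by
    intro k hk
    rcases parity_eq_zero_or_one k with hp | hp
    · exact hp
    · rw [two_pow_mul_of_odd hp] at hk
      exact absurd hk (two_pow_ne_zero ℓ)
  have hy2 := two_mul_half ℓ y
  have hrs : f (i (r 1)) * f (i (sr 0)) * f (i (r 1)) = f (i (sr 0)) := by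
    rw [← map_mul, ← map_mul, ← map_mul, ← map_mul, r_mul_sr, sr_mul_r, sub_add_cancel]
  have hwv : ∀ x : (ZMod (2 ^ (ℓ + 1)))ˣ, 2 ^ ℓ * (x : ZMod (2 ^ (ℓ + 1))) ≠ 0 := fun x => by
    rw [two_pow_mul_unit]; exact two_pow_ne_zero ℓ
  rcases h.cover (f (i (sr 0))) with ⟨x | k, hk⟩ | ⟨x | k, hk⟩
  · exact absurd (by rw [hk, ← map_mul, ← map_mul, r_mul_r, r_mul_r, add_comm x]) hs2
  · have hkp : parity ℓ k = 0 := by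
      rw [hk, hκ, h.mulMc, h.mulcM, dihedralPow_sr, h.mul_c_inj, sr_mul_r, r_mul_sr, sr.injEq] at hsc
      exact hpar k (by linear_combination -hsc + hy2)
    refine ⟨v, k, y, hkp, hκ, Or.inl ⟨?_, hk⟩⟩
    rcases hv with hv | hv
    · exact hv
    · exfalso
      rw [hv, hk, h.mulcM, dihedralPow_sr, h.mulcc, dihedralPow_r, mul_one, h.inj_iff, r_mul_sr,
        sr_mul_r, sr.injEq] at hrs
      refine hwv v ?_
      linear_combination hrs - two_pow_mul_of_even hkp
  · exact absurd (by rw [hk, h.mulcM, h.mulMc, dihedralPow_r, hw2, r_mul_r, r_mul_r, add_comm x]) hs2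
  · have hkp : parity ℓ k = 0 := by
      rw [hk, hκ, h.mulcc, h.mulcc, dihedralPow_r, dihedralPow_sr, h.inj_iff, mul_one, mul_one,
        sr_mul_r, r_mul_sr, sr.injEq] at hsc
      exact hpar k (by linear_combination -hsc + hy2 + hy)
    refine ⟨v, k, y, hkp, hκ, Or.inr ⟨?_, hk⟩⟩
    rcases hv with hv | hv
    · exfalso
      rw [hv, hk, h.mulMc, h.mulcM, dihedralPow_r, h.mul_c_inj, r_mul_sr, sr_mul_r, sr.injEq] at hrs
      refine hwv v ?_
      linear_combination hrs
    · exact hv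

/-- The automorphism group is `A : Z_2`, where `A` is the group of diagonal automorphisms. -/
theorem nonempty_mulAut_mulEquiv_of_modular (h : IsTwoExt i c (dihedralPow (1 + 2 ^ ℓ)) 1)
    (hℓ : 2 ≤ ℓ) {A : Type*} [Group A] (e : A ≃* CycByAut ℓ × Cyc 2) :
    ∃ θ : Cyc 2 →* MulAut A, Nonempty (MulAut G ≃* A ⋊[θ] Cyc 2) := by
  obtain ⟨Ψ, hΨ, hΨt⟩ := h.exists_diagonal_hom (by omega) (Or.inr rfl)
  obtain ⟨ρ, hρ1, hρ2, hρ3, hρρ⟩ := h.exists_swap hℓ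
  have hcc : c * c = 1 := by rw [h.sq, map_one]
  have hdiag : ∀ (f : MulAut G) (v : (ZMod (2 ^ (ℓ + 1)))ˣ) (k : ZMod (2 ^ (ℓ + 1))) (y : Cyc 2),
      parity ℓ k = 0 → f c = i (r (half ℓ y)) * c → f (i (r 1)) = i (r v) →
      f (i (sr 0)) = i (sr k) → ∃ t, f = Ψ t := by
    intro f v k y hk h1 h2 h3
    obtain ⟨x, rfl⟩ := exists_double_iff.2 hk
    obtain ⟨φ, hφ⟩ := exists_expo v
    refine ⟨(⟨Multiplicative.ofAdd x, φ⟩, y), ?_⟩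
    obtain ⟨h1', h2', h3'⟩ := hΨt (⟨Multiplicative.ofAdd x, φ⟩, y)
    have := h.hom_ext_dihedral (F := f.toMonoidHom)
      (F' := (Ψ (⟨Multiplicative.ofAdd x, φ⟩, y)).toMonoidHom)
      (h2.trans (by rw [← hφ]; exact h1'.symm)) (h3.trans h2'.symm) (h1.trans h3'.symm)
    ext1 g
    exact DFunLike.congr_fun this g
  refine exists_semidirect_of_index_two (Ψ.comp e.toMonoidHom) (hΨ.comp e.injective) ρ hρρ ?_ ?_
  · intro t ht
    have h1 := (hΨt (e t)).1
    have h2 : Ψ (e t) = ρ := ht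
    rw [h2, hρ1] at h1
    exact h.ne_mul _ _ h1.symm
  · have hΨe : ∀ t, Ψ t = Ψ.comp e.toMonoidHom (e.symm t) := fun t => by simp
    intro f
    obtain ⟨v, k, y, hk, h1, ⟨h2, h3⟩ | ⟨h2, h3⟩⟩ := h.mulAut_apply_of_modular hℓ f
    · obtain ⟨t, rfl⟩ := hdiag f v k y hk h1 h2 h3
      exact Or.inl ⟨e.symm t, hΨe t⟩
    · have hy : (1 + 2 ^ ℓ) * half ℓ y = half ℓ y :=
        mul_of_modular (Or.inr rfl) (parity_half (by omega) y)
      obtain ⟨v', hv'⟩ : IsUnit ((v : ZMod (2 ^ (ℓ + 1))) + half ℓ y) := by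
        rw [← parity_eq_one_iff, map_add, parity_unit, parity_half (by omega), add_zero]
      obtain ⟨t, ht⟩ := hdiag (f * ρ) v' (k + half ℓ y) y
        (by rw [map_add, hk, parity_half (by omega), add_zero])
        (by rw [MulAut.mul_apply, hρ3, h1])
        (by rw [MulAut.mul_apply, hρ1, map_mul, h1, h2, h.mulcc, dihedralPow_r, hy, mul_one, r_mul_r,
          hv'])
        (by rw [MulAut.mul_apply, hρ2, map_mul, h1, h3, h.mulcc, dihedralPow_r, hy, mul_one,
          sr_mul_r])
      refine Or.inr ⟨e.symm t, ?_⟩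
      rw [← hΨe, ← ht, mul_assoc, hρρ, mul_one]

end IsTwoExt

/-! ### The central product of a quaternion group and a cyclic group of order four -/

theorem eq_zero_or_eq_of_two_mul_eq_zero {m : ℕ} [NeZero m] {x : ZMod (2 * m)} (hx : 2 * x = 0) :
    x = 0 ∨ x = m := by
  obtain ⟨k, rfl⟩ := ZMod.natCast_zmod_surjective x
  have h1 : ((2 * k : ℕ) : ZMod (2 * m)) = 0 := by exact_mod_cast hx
  rw [ZMod.natCast_eq_zero_iff, Nat.mul_dvd_mul_iff_left (by norm_num)] at h1
  obtain ⟨j, rfl⟩ := h1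
  have h2 : ((m : ZMod (2 * m)) + m) = 0 := by
    have := ZMod.natCast_self (2 * m)
    rw [two_mul, Nat.cast_add] at this
    rwa [two_mul]
  rcases Nat.even_or_odd' j with ⟨t, rfl | rfl⟩
  · left; push_cast; linear_combination t * h2
  · right; push_cast; linear_combination t * h2

namespace QuaternionGroup

variable {m : ℕ} [NeZero m]

theorem natCast_ne_zero : (m : ZMod (2 * m)) ≠ 0 := by
  rw [Ne, ZMod.natCast_eq_zero_iff]
  intro h
  have := Nat.le_of_dvd (NeZero.pos m) h
  have := NeZero.pos m
  omega

theorem a_natCast_ne_one : a (m : ZMod (2 * m)) ≠ 1 := by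
  rw [one_def, Ne, a.injEq]
  exact natCast_ne_zero

theorem two_mul_natCast {m : ℕ} : (2 : ZMod (2 * m)) * m = 0 := by
  exact_mod_cast ZMod.natCast_self (2 * m)

theorem a_natCast_mul_self {m : ℕ} : a (m : ZMod (2 * m)) * a m = 1 := by
  rw [a_mul_a, ← two_mul, two_mul_natCast, a_zero]

/-- A generalized quaternion group has exactly one involution. -/
theorem eq_one_or_eq_of_mul_self {q : QuaternionGroup m} (hq : q * q = 1) : q = 1 ∨ q = a m := by
  rcases q with x | x
  · rw [a_mul_a, one_def, a.injEq, ← two_mul] at hq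
    rcases eq_zero_or_eq_of_two_mul_eq_zero hq with rfl | rfl
    · exact Or.inl rfl
    · exact Or.inr rfl
  · rw [xa_mul_xa, add_sub_cancel_right] at hq
    exact absurd hq a_natCast_ne_one

theorem a_natCast_mul_comm {m : ℕ} (q : QuaternionGroup m) : q * a m = a m * q := by
  rcases q with x | x
  · rw [a_mul_a, a_mul_a, add_comm (m : ZMod (2 * m))]
  · rw [xa_mul_a, a_mul_xa]
    congr 1
    linear_combination two_mul_natCast (m := m)

theorem not_commute_xa {m : ℕ} (hm : 2 ≤ m) (t : ZMod (2 * m)) : xa t * a 1 ≠ a 1 * xa t := by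
  rw [xa_mul_a, a_mul_xa, Ne, xa.injEq]
  intro h
  have h2 : ((2 : ℕ) : ZMod (2 * m)) = 0 := by push_cast; linear_combination h
  rw [ZMod.natCast_eq_zero_iff] at h2
  have := Nat.le_of_dvd (by norm_num) h2
  omega

theorem mul_self_of_central {m : ℕ} (hm : 2 ≤ m) {q : QuaternionGroup m} (hq : ∀ g, g * q = q * g) :
    q * q = 1 := by
  rcases q with x | x
  · have := hq (xa 0)
    rw [xa_mul_a, a_mul_xa, xa.injEq] at this
    rw [a_mul_a, one_def, a.injEq]
    linear_combination this
  · exact absurd (hq (a 1)).symm (not_commute_xa hm x)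

theorem mulAut_apply_natCast (f : MulAut (QuaternionGroup m)) : f (a m) = a m := by
  rcases eq_one_or_eq_of_mul_self (q := f (a m)) (by
    rw [← map_mul, a_natCast_mul_self, map_one]) with h | h
  · exact absurd ((map_eq_one_iff f f.injective).1 h) a_natCast_ne_one
  · exact h

/-- The quotient of a quaternion group by its Frattini subgroup. -/
theorem exists_frattini_hom {m : ℕ} (hm : Even m) : ∃ χ : QuaternionGroup m →* Cyc 2 × Cyc 2,
    (∀ x, χ (a x) = (Multiplicative.ofAdd (ZMod.castHom (dvd_mul_right 2 m) (ZMod 2) x), 1)) ∧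
    χ (xa 0) = (1, Multiplicative.ofAdd 1) := by
  let p := ZMod.castHom (dvd_mul_right 2 m) (ZMod 2)
  have hpm : p m = 0 := by
    rw [map_natCast, ZMod.natCast_eq_zero_iff]
    exact hm.two_dvd
  have hneg : ∀ x y : ZMod 2, x - y = y + x := by decide
  let F : QuaternionGroup m → Cyc 2 × Cyc 2 := fun q => match q with
    | a x => (Multiplicative.ofAdd (p x), 1)
    | xa x => (Multiplicative.ofAdd (p x), Multiplicative.ofAdd 1)
  refine ⟨MonoidHom.mk' F ?_, fun x => rfl, ?_⟩
  · rintro (x | x) (y | y)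
    · exact Prod.ext (congrArg Multiplicative.ofAdd (map_add p x y)) rfl
    · exact Prod.ext (congrArg Multiplicative.ofAdd
        (show p (y - x) = p x + p y by rw [map_sub, hneg])) rfl
    · exact Prod.ext (congrArg Multiplicative.ofAdd (map_add p x y)) rfl
    · exact Prod.ext (congrArg Multiplicative.ofAdd
        (show p (m + y - x) = p x + p y by rw [map_sub, map_add, hpm, zero_add, hneg]))
        (show (1 : Cyc 2) = Multiplicative.ofAdd 1 * Multiplicative.ofAdd 1 by decide)
  · exact Prod.ext (congrArg Multiplicative.ofAdd (map_zero p)) rfl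

end QuaternionGroup

namespace CentralGluing

open QuaternionGroup

variable {m : ℕ} [NeZero m]

/-- A central product of a quaternion group and a cyclic group of order four is the extension of
the quaternion group by a central element that is a square root of the central involution. In
particular, it amalgamates the two subgroups of order two. -/
theorem exists_isTwoExt (hm : 2 ≤ m) (d : CentralGluing (QuaternionGroup m) (Cyc 4))
    (hd : d.IsFull) : ∃ (i : QuaternionGroup m →* d.Product) (c : d.Product),
      IsTwoExt i c id (a m) := by
  have hC1 : ∀ x : d.C₁, d.φ x * d.φ x = 1 := fun x => by
    rw [← map_mul, map_eq_one_iff _ d.φ.injective]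
    exact Subtype.ext (mul_self_of_central hm (Subgroup.mem_center_iff.1 (d.le₁ x.2)))
  have hnot : ∀ x : d.C₁, (d.φ x : Cyc 4) ≠ Multiplicative.ofAdd 1 := fun x hx => by
    have := congrArg Subtype.val (hC1 x)
    rw [Subgroup.coe_mul, hx] at this
    exact absurd this (show ¬ (Multiplicative.ofAdd 1 * Multiplicative.ofAdd 1 : Cyc 4) = 1 by decide)
  have hz : a (m : ZMod (2 * m)) ∈ d.C₁ := by
    rcases hd with hd | hd
    · rw [hd]
      exact Subgroup.mem_center_iff.2 a_natCast_mul_comm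
    · exfalso
      have : (Multiplicative.ofAdd 1 : Cyc 4) ∈ d.C₂ := by
        rw [hd]
        exact Subgroup.mem_center_iff.2 fun g => mul_comm _ _
      exact hnot (d.φ.symm ⟨_, this⟩) (by rw [MulEquiv.apply_symm_apply])
  have hφz : (d.φ ⟨_, hz⟩ : Cyc 4) = Multiplicative.ofAdd 2 := by
    have h1 : ∀ y : Cyc 4, y * y = 1 → y = 1 ∨ y = Multiplicative.ofAdd 2 := by decide
    rcases h1 _ (congrArg Subtype.val (hC1 ⟨_, hz⟩)) with h | h
    · have h2 : d.φ ⟨_, hz⟩ = 1 := Subtype.ext h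
      rw [map_eq_one_iff _ d.φ.injective] at h2
      exact absurd (congrArg Subtype.val h2) a_natCast_ne_one
    · exact h
  have hgraph : ((a m, Multiplicative.ofAdd 2) : QuaternionGroup m × Cyc 4) ∈ d.graph :=
    (d.mem_graph _).2 ⟨⟨_, hz⟩, by rw [hφz]⟩
  have hy : ∀ y : Cyc 4, (y = 1 ∨ y = Multiplicative.ofAdd 1) ∨
      ∃ y', y = y' * Multiplicative.ofAdd 2 ∧ (y' = 1 ∨ y' = Multiplicative.ofAdd 1) := by decide
  refine ⟨(QuotientGroup.mk' d.graph).comp (MonoidHom.inl _ _),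
    QuotientGroup.mk' d.graph (1, Multiplicative.ofAdd 1), ?_, ?_, ?_, ?_, ?_⟩
  · rw [injective_iff_map_eq_one]
    intro q hq
    obtain ⟨x, hx⟩ := (d.mem_graph _).1 ((QuotientGroup.eq_one_iff _).1 hq)
    have h2 : d.φ x = 1 := Subtype.ext (congrArg Prod.snd hx)
    rw [map_eq_one_iff _ d.φ.injective] at h2
    rw [h2] at hx
    exact (congrArg Prod.fst hx).symm
  · intro q
    rw [MonoidHom.comp_apply, ← map_mul, id, MonoidHom.comp_apply, ← map_mul]
    congr 1
    exact Prod.ext ((one_mul _).trans (mul_one _).symm) ((mul_one _).trans (one_mul _).symm)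
  · rw [MonoidHom.comp_apply, ← map_mul]
    refine QuotientGroup.eq.2 ?_
    have h1 : ((1, Multiplicative.ofAdd 1) * (1, Multiplicative.ofAdd 1) :
        QuaternionGroup m × Cyc 4)⁻¹ * MonoidHom.inl _ _ (a m) = (a m, Multiplicative.ofAdd 2) :=
      Prod.ext (by simp) (show (Multiplicative.ofAdd 1 * Multiplicative.ofAdd 1)⁻¹ * 1 =
        (Multiplicative.ofAdd 2 : Cyc 4) by decide)
    rw [h1]
    exact hgraph
  · intro q hq
    obtain ⟨x, hx⟩ := (d.mem_graph _).1 (QuotientGroup.eq.1 hq)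
    refine hnot x ((congrArg Prod.snd hx).trans ?_)
    simp
  · intro g
    induction g using QuotientGroup.induction_on with
    | H p =>
      have key : ∀ (q : QuaternionGroup m) (y : Cyc 4), y = 1 ∨ y = Multiplicative.ofAdd 1 →
          (∃ q', QuotientGroup.mk' d.graph (q, y) =
            (QuotientGroup.mk' d.graph).comp (MonoidHom.inl _ _) q') ∨
          ∃ q', QuotientGroup.mk' d.graph (q, y) =
            (QuotientGroup.mk' d.graph).comp (MonoidHom.inl _ _) q' *
              QuotientGroup.mk' d.graph (1, Multiplicative.ofAdd 1) := by
        rintro q y (rfl | rfl)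
        · exact Or.inl ⟨q, rfl⟩
        · refine Or.inr ⟨q, ?_⟩
          rw [MonoidHom.comp_apply, ← map_mul]
          congr 1
          exact Prod.ext (mul_one _).symm (one_mul _).symm
      obtain ⟨q, y⟩ := p
      rcases hy y with hy | ⟨y', rfl, hy'⟩
      · exact key q y hy
      · have h2 : QuotientGroup.mk' d.graph (q, y' * Multiplicative.ofAdd 2) =
            QuotientGroup.mk' d.graph (q * a m, y') := by
          refine QuotientGroup.eq.2 ?_
          convert hgraph using 1
          refine Prod.ext ?_ ?_
          · simp
          · rw [Prod.snd_mul, Prod.snd_inv, mul_inv_rev, inv_mul_cancel_right]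
            exact (show (Multiplicative.ofAdd 2)⁻¹ = (Multiplicative.ofAdd 2 : Cyc 4) by decide)
        have := key (q * a m) y' hy'
        rw [← h2] at this
        exact this

/-- The central product of a quaternion group and a cyclic group of order four exists. -/
theorem exists_isFull (hm : 2 ≤ m) :
    ∃ d : CentralGluing (QuaternionGroup m) (Cyc 4), d.IsFull := by
  have hz : a (m : ZMod (2 * m)) ∈ Subgroup.center (QuaternionGroup m) :=
    Subgroup.mem_center_iff.2 a_natCast_mul_comm
  have hz2 : orderOf (a (m : ZMod (2 * m))) = 2 :=
    orderOf_eq_two_iff'.2 ⟨a_natCast_mul_self, a_natCast_ne_one⟩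
  obtain ⟨d, h1, -, -⟩ := exists_centralGluing (y := (Multiplicative.ofAdd 2 : Cyc 4)) hz2
    (orderOf_eq_two_iff'.2 (by decide)) hz (Subgroup.mem_center_iff.2 fun g => mul_comm _ _)
  refine ⟨d, Or.inl (h1.trans (le_antisymm (Subgroup.zpowers_le.2 hz) fun q hq => ?_))⟩
  exact (mem_zpowers_of_orderOf_eq_two hz2).2
    (eq_one_or_eq_of_mul_self (mul_self_of_central hm (Subgroup.mem_center_iff.1 hq)))

end CentralGluing

namespace IsTwoExt

open QuaternionGroup

variable {G : Type*} [Group G] {m : ℕ} [NeZero m] {i : QuaternionGroup m →* G} {c : G}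

theorem isCentralProduct (h : IsTwoExt i c id (a m)) (hm : 2 ≤ m) :
    IsCentralProduct G (QuaternionGroup m) (Cyc 4) := by
  obtain ⟨d, hd⟩ := CentralGluing.exists_isFull hm
  obtain ⟨i', c', h'⟩ := d.exists_isTwoExt hm hd
  exact ⟨d, hd, h.nonempty_mulEquiv h'⟩

theorem mulAut_apply_of_quaternion (h : IsTwoExt i c id (a m)) (hm : 2 ≤ m) (f : MulAut G) :
    (f c = c ∨ f c = i (a m) * c) ∧ ∀ q, ∃ q', f (i q) = i q' := by
  have hcomm : ∀ q, c * i q = i q * c := h.conj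
  have hcen : ∀ g, g * c = c * g := by
    intro g
    rcases h.cover g with ⟨q, rfl⟩ | ⟨q, rfl⟩
    · rw [hcomm]
    · rw [mul_assoc, ← mul_assoc c, hcomm, mul_assoc]
  have hfcen : ∀ g, g * f c = f c * g := fun g => by
    obtain ⟨g, rfl⟩ := f.surjective g
    rw [← map_mul, hcen, map_mul]
  have hfc : f c = c ∨ f c = i (a m) * c := by
    rcases h.cover (f c) with ⟨q, hq⟩ | ⟨q, hq⟩
    · exfalso
      have h1 : q * q = 1 := mul_self_of_central hm fun g => by
        have := hfcen (i g)
        rwa [hq, ← map_mul, ← map_mul, h.inj_iff] at this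
      have h2 : f (c * c) = 1 := by rw [map_mul, hq, ← map_mul, h1, map_one]
      rw [map_eq_one_iff f f.injective, h.sq, ← map_one i, h.inj_iff] at h2
      exact a_natCast_ne_one h2
    · have h1 : q * q = 1 := mul_self_of_central hm fun g => by
        have := hfcen (i g)
        rwa [hq, h.mulcM, h.mulMc, h.mul_c_inj] at this
      rcases eq_one_or_eq_of_mul_self h1 with rfl | rfl
      · left; rw [hq, map_one, one_mul]
      · exact Or.inr hq
  refine ⟨hfc, ?_⟩
  have hfz : f (i (a m)) = i (a m) := by
    rw [← h.sq, map_mul]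
    rcases hfc with hq | hq
    · rw [hq]
    · rw [hq, h.mulcc, id, a_natCast_mul_self, one_mul, h.sq]
  -- the square roots of the central involution in `i q * c` are central
  have hxa : ∀ t, ∃ q', f (i (xa t)) = i q' := by
    intro t
    rcases h.cover (f (i (xa t))) with hq | ⟨q, hq⟩
    · exact hq
    · exfalso
      have h1 : f (i (xa t) * i (xa t)) = i (a m) := by
        rw [← map_mul i, xa_mul_xa, add_sub_cancel_right, hfz]
      rw [map_mul, hq, h.mulcc, h.inj_iff, id, mul_eq_right] at h1
      have h2 : ∀ g, g * f (i (xa t)) = f (i (xa t)) * g := by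
        rw [hq]
        intro g
        have h3 : g * i q = i q * g := by
          rcases eq_one_or_eq_of_mul_self h1 with rfl | rfl
          · rw [map_one, one_mul, mul_one]
          · rw [← h.sq, ← mul_assoc, hcen, mul_assoc, hcen g]
        rw [← mul_assoc, h3, mul_assoc, hcen, mul_assoc]
      have h4 := h2 (f (i (a 1)))
      rw [← map_mul f, ← map_mul f, f.injective.eq_iff, ← map_mul i, ← map_mul i, h.inj_iff] at h4
      exact not_commute_xa hm t h4.symm
  rintro (t | t)
  · obtain ⟨q, hq⟩ := hxa 0
    obtain ⟨q', hq'⟩ := hxa (t - m)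
    refine ⟨q * q', ?_⟩
    rw [map_mul, ← hq, ← hq', ← map_mul f, ← map_mul i, xa_mul_xa, sub_zero, add_sub_cancel]
  · exact hxa t

theorem nonempty_mulAut_mulEquiv_of_quaternion (h : IsTwoExt i c id (a m)) (hm : 2 ≤ m) :
    Nonempty (MulAut G ≃* MulAut (QuaternionGroup m) × Cyc 2) := by
  let ζ : Cyc 2 →* QuaternionGroup m := cycHom (a m) (by rw [pow_two, a_natCast_mul_self])
  have hζ1 : ζ (Multiplicative.ofAdd 1) = a m := cycHom_one _ _
  have hζφ : ∀ (φ : MulAut (QuaternionGroup m)) y, φ (ζ y) = ζ y := by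
    intro φ y
    rcases cyc_two_cases y with rfl | rfl
    · rw [MonoidHom.map_one, map_one]
    · rw [hζ1, mulAut_apply_natCast]
  have hζc : ∀ y q, q * ζ y = ζ y * q := by
    intro y q
    rcases cyc_two_cases y with rfl | rfl
    · rw [MonoidHom.map_one, mul_one, one_mul]
    · rw [hζ1, a_natCast_mul_comm]
  refine nonempty_mulAut_mulEquiv (ι := Option (QuaternionGroup m)) (fun j => j.elim c i)
    (fun F F' hF => h.hom_ext (fun q => hF (some q)) (hF none))
    (fun t j => j.elim (i (ζ t.2) * c) (fun q => i (t.1 q))) ?_ ?_ ?_ ?_ ?_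
  · rintro ⟨φ, y⟩
    obtain ⟨F, h1, h2⟩ := h.exists_hom (i.comp φ.toMonoidHom) (i (ζ y) * c)
      (fun q => by
        change _ * i (φ q) = i (φ q) * _
        rw [h.mulcM, h.mulMc, id, hζc])
      (by
        change _ = i (φ (a m))
        rw [h.mulcc, id, ← map_mul ζ, cyc_two_mul_self, MonoidHom.map_one, one_mul,
          mulAut_apply_natCast])
    exact ⟨F, fun j => by
      cases j
      · exact h2
      · exact h1 _⟩
  · funext j
    cases j
    · change i (ζ 1) * c = c
      rw [MonoidHom.map_one, MonoidHom.map_one, one_mul]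
    · rfl
  · rintro ⟨φ, y⟩ ⟨φ', y'⟩ F hF j
    have h1 : ∀ q, F (i q) = i (φ q) := fun q => hF (some q)
    cases j with
    | none =>
      change F (i (ζ y') * c) = i (ζ (y * y')) * c
      have h2 : F c = i (ζ y) * c := hF none
      rw [map_mul, h1, h2, hζφ, h.mulMc, ← map_mul ζ, mul_comm]
    | some q => exact h1 _
  · rintro ⟨φ, y⟩ ht
    have h1 : ∀ q, i (φ q) = i q := fun q => congrFun ht (some q)
    have h2 : i (ζ y) * c = c := congrFun ht none
    refine Prod.ext (MulEquiv.ext fun q => h.inj (h1 q)) ?_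
    rcases cyc_two_cases y with rfl | rfl
    · rfl
    · rw [hζ1, mul_eq_right, ← map_one i, h.inj_iff] at h2
      exact absurd h2 a_natCast_ne_one
  · intro f
    obtain ⟨hc, hq⟩ := h.mulAut_apply_of_quaternion hm f
    choose φ hφ using hq
    let Φ : QuaternionGroup m →* QuaternionGroup m := MonoidHom.mk' φ fun q q' => by
      apply h.inj
      rw [← hφ, map_mul, map_mul, map_mul, hφ, hφ]
    have hΦ : Function.Injective Φ := fun q q' hqq => by
      have : φ q = φ q' := hqq
      exact h.inj (f.injective (by rw [hφ, hφ, this]))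
    let Φ' : MulAut (QuaternionGroup m) :=
      MulEquiv.ofBijective Φ (Finite.injective_iff_bijective.1 hΦ)
    rcases hc with hc | hc
    · refine ⟨(Φ', 1), fun j => ?_⟩
      cases j with
      | none =>
        change f c = i (ζ 1) * c
        rw [hc, MonoidHom.map_one, MonoidHom.map_one, one_mul]
      | some q => exact hφ q
    · refine ⟨(Φ', Multiplicative.ofAdd 1), fun j => ?_⟩
      cases j with
      | none =>
        change f c = i (ζ (Multiplicative.ofAdd 1)) * c
        rw [hc, hζ1]
      | some q => exact hφ q

theorem exists_frattini_hom_of_quaternion {m : ℕ} {i : QuaternionGroup m →* G}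
    (h : IsTwoExt i c id (a m)) (hm : Even m) :
    ∃ χ : G →* Cyc 2 × Cyc 2 × Cyc 2, Function.Surjective χ ∧ χ (i (a m)) = 1 := by
  obtain ⟨ψ, hψ, hψ'⟩ := exists_frattini_hom hm
  have hz : ψ (a m) = 1 := by
    rw [hψ, map_natCast, (ZMod.natCast_eq_zero_iff m 2).2 hm.two_dvd]
    rfl
  obtain ⟨χ, h1, h2⟩ := h.exists_hom
    ((MonoidHom.fst _ _).comp ψ |>.prod (((MonoidHom.snd _ _).comp ψ).prod (1 : _ →* Cyc 2)))
    (1, 1, Multiplicative.ofAdd 1) (fun q => mul_comm _ _) (by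
      simp only [MonoidHom.prod_apply, MonoidHom.comp_apply, hz]
      exact (show ((1, 1, Multiplicative.ofAdd 1) * (1, 1, Multiplicative.ofAdd 1) :
        Cyc 2 × Cyc 2 × Cyc 2) = 1 by decide))
  simp only [MonoidHom.prod_apply, MonoidHom.comp_apply] at h1
  refine ⟨χ, ?_, by rw [h1, hz]; rfl⟩
  have ha : χ (i (a 1)) = (Multiplicative.ofAdd 1, 1, 1) := by
    rw [h1, hψ, map_one]; rfl
  have hb : χ (i (xa 0)) = (1, Multiplicative.ofAdd 1, 1) := by
    rw [h1, hψ']; rfl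
  have key : ∀ t : Cyc 2 × Cyc 2 × Cyc 2, ∃ j k l : Fin 2,
      ((Multiplicative.ofAdd 1, 1, 1) : Cyc 2 × Cyc 2 × Cyc 2) ^ j.val *
        (1, Multiplicative.ofAdd 1, 1) ^ k.val * (1, 1, Multiplicative.ofAdd 1) ^ l.val = t := by
    decide
  intro t
  obtain ⟨j, k, l, rfl⟩ := key t
  exact ⟨i (a 1) ^ j.val * i (xa 0) ^ k.val * c ^ l.val, by
    rw [map_mul, map_mul, map_pow, map_pow, map_pow, ha, hb, h2]⟩

theorem hasReversingTriple_of_quaternion {k : ℕ} {i : QuaternionGroup (k + k) →* G} [NeZero (k + k)]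
    (h : IsTwoExt i c id (a (k + k : ℕ))) : HasReversingTriple G := by
  have hsq : ∀ q, q * q = a ((k + k : ℕ) : ZMod (2 * (k + k))) → orderOf (i q * c) = 2 := by
    intro q hq
    rw [orderOf_eq_two_iff', h.mulcc, id, hq, a_natCast_mul_self, map_one]
    refine ⟨rfl, fun h1 => ?_⟩
    rw [← map_one i] at h1
    exact h.ne_mul _ _ h1.symm
  refine ⟨i (xa 0) * c, i (xa 1) * c, i (a (k : ZMod (2 * (k + k)))) * c, hsq _ ?_, hsq _ ?_,
    hsq _ ?_, ?_⟩
  · rw [xa_mul_xa, add_sub_cancel_right]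
  · rw [xa_mul_xa, add_sub_cancel_right]
  · rw [a_mul_a]; push_cast; rfl
  · set K := Subgroup.closure
      {i (xa 0) * c, i (xa 1) * c, i (a (k : ZMod (2 * (k + k)))) * c} with hK
    have h1 : i (xa 0) * c ∈ K := Subgroup.subset_closure (by simp)
    have h2 : i (xa 1) * c ∈ K := Subgroup.subset_closure (by simp)
    have h3 : i (a (k : ZMod (2 * (k + k)))) * c ∈ K := Subgroup.subset_closure (by simp)
    have ha1 : i (a 1) ∈ K := by
      have := K.mul_mem h1 h2
      rw [h.mulcc, id, xa_mul_xa, a_mul_a] at this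
      convert this using 3
      linear_combination -two_mul_natCast (m := k + k)
    have ha : ∀ x, i (a x) ∈ K := by
      intro x
      obtain ⟨t, rfl⟩ := ZMod.natCast_zmod_surjective x
      rw [← a_one_pow, map_pow]
      exact K.pow_mem ha1 t
    have hc : c ∈ K := (K.mul_mem_cancel_left (ha _)).1 h3
    have hxa0 : i (xa 0) ∈ K := (K.mul_mem_cancel_right hc).1 h1
    have hi : ∀ q, i q ∈ K := by
      rintro (x | x)
      · exact ha x
      · have := K.mul_mem hxa0 (ha x)
        rwa [← map_mul, xa_mul_a, zero_add] at this
    rw [eq_top_iff]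
    intro g _
    rcases h.cover g with ⟨q, rfl⟩ | ⟨q, rfl⟩
    · exact hi q
    · exact K.mul_mem (hi q) hc

/-- Commuting involutions agree modulo the Frattini subgroup unless one of them is contained in
it. -/
theorem not_hasRegularTriple_of_quaternion (h : IsTwoExt i c id (a m)) (hm : Even m) :
    ¬ HasRegularTriple G := by
  obtain ⟨χ, hχ, hχz⟩ := h.exists_frattini_hom_of_quaternion hm
  rintro ⟨x, y, z, ⟨hx, -, hz, hc⟩, he⟩
  obtain ⟨hxz, -⟩ := commute_of_closure_pair_mulEquiv hx he
  have hinv : ∀ g : G, orderOf g = 2 → χ g = 1 ∨ ∃ q, g = i q * c := by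
    intro g hg
    obtain ⟨h1, h2⟩ := orderOf_eq_two_iff'.1 hg
    rcases h.cover g with ⟨q, rfl⟩ | hq
    · left
      rw [← map_mul, ← map_one i, h.inj_iff] at h1
      rcases eq_one_or_eq_of_mul_self h1 with rfl | rfl
      · exact absurd (map_one i) h2
      · exact hχz
    · exact Or.inr hq
  have hx1 := (orderOf_eq_two_iff'.1 hx).1
  have hz1 := (orderOf_eq_two_iff'.1 hz).1
  rcases hinv x hx with hx' | ⟨q, rfl⟩
  · refine closure_ne_top_of_two hχ (χ y) (χ z) ?_ hc
    simp [hx']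
  · rcases hinv z hz with hz' | ⟨q', rfl⟩
    · refine closure_ne_top_of_two hχ (χ (i q * c)) (χ y) ?_ hc
      simp [hz']
    · refine closure_ne_top_of_two hχ (χ (i q * c)) (χ y) ?_ hc
      have h1 : χ (i q * c * (i q' * c)) = 1 := by
        have h2 : i q * c * (i q' * c) * (i q * c * (i q' * c)) = 1 := by
          rw [Commute.mul_mul_mul_comm hxz.symm, hx1, one_mul, hz1]
        rw [h.mulcc] at h2 ⊢
        rw [← map_mul, ← map_one i, h.inj_iff] at h2
        rcases eq_one_or_eq_of_mul_self h2 with h3 | h3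
        · rw [h3, map_one, map_one]
        · rw [h3, hχz]
      have h2 : χ (i q' * c) = χ (i q * c) := by
        rw [map_mul, mul_eq_one_iff_inv_eq] at h1
        rw [← h1, inv_eq_iff_mul_eq_one, ← map_mul, hx1, map_one]
      simp [h2]

theorem not_hasRotaryPair_of_quaternion {m : ℕ} {i : QuaternionGroup m →* G}
    (h : IsTwoExt i c id (a m)) (hm : Even m) :
    ¬ HasRotaryPair G := by
  obtain ⟨χ, hχ, -⟩ := h.exists_frattini_hom_of_quaternion hm
  exact not_hasRotaryPair_of_surjective hχ

end IsTwoExt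

/-! ### Transport of the invariants along isomorphisms -/

section Transport

variable {G H : Type*} [Group G] [Group H]

theorem closure_image_eq_top (e : G ≃* H) {s : Set G} (hs : Subgroup.closure s = ⊤) :
    Subgroup.closure (e '' s) = ⊤ := by
  have := MonoidHom.map_closure e.toMonoidHom s
  rw [hs, ← MonoidHom.range_eq_map, MonoidHom.range_eq_top.2 e.surjective] at this
  exact this.symm

theorem IsReversingTriple.map (e : G ≃* H) {x y z : G} (h : IsReversingTriple x y z) :
    IsReversingTriple (e x) (e y) (e z) := by
  obtain ⟨hx, hy, hz, hc⟩ := h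
  refine ⟨by rwa [MulEquiv.orderOf_eq], by rwa [MulEquiv.orderOf_eq], by rwa [MulEquiv.orderOf_eq],
    ?_⟩
  rw [← closure_image_eq_top e hc, Set.image_insert_eq, Set.image_pair]

theorem HasReversingTriple.map (e : G ≃* H) (h : HasReversingTriple G) : HasReversingTriple H := by
  obtain ⟨x, y, z, h⟩ := h
  exact ⟨e x, e y, e z, h.map e⟩

theorem HasRegularTriple.map (e : G ≃* H) (h : HasRegularTriple G) : HasRegularTriple H := by
  obtain ⟨x, y, z, h, hxz⟩ := h
  have hx := h.1
  have hz := h.2.2.1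
  obtain ⟨h1, h2⟩ := commute_of_closure_pair_mulEquiv hx hxz
  exact ⟨e x, e y, e z, h.map e, closure_pair_mulEquiv (by rwa [MulEquiv.orderOf_eq])
    (by rwa [MulEquiv.orderOf_eq]) (by rw [← map_mul, h1, map_mul]) (e.injective.ne h2)⟩

theorem HasRotaryPair.map (e : G ≃* H) (h : HasRotaryPair G) : HasRotaryPair H := by
  obtain ⟨α, z, hz, hc⟩ := h
  refine ⟨e α, e z, by rwa [MulEquiv.orderOf_eq], ?_⟩
  rw [← closure_image_eq_top e hc, Set.image_pair]

theorem not_isPGroup_of_mulEquiv (e : G ≃* H) [Finite H] (h3 : 3 ∣ Nat.card H) :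
    ¬ IsPGroup 2 G := by
  intro h
  have : Fact (Nat.Prime 2) := ⟨Nat.prime_two⟩
  obtain ⟨n, hn⟩ := IsPGroup.iff_card.1 (h.of_equiv e)
  rw [hn] at h3
  exact absurd (Nat.prime_three.dvd_of_dvd_pow h3) (by norm_num)

end Transport

/-! ### The elementary abelian groups -/

/-- Every permutation of the three involutions of the Klein four-group is an automorphism. -/
theorem nonempty_mulAut_klein_mulEquiv :
    Nonempty (MulAut (Cyc 2 × Cyc 2) ≃* Equiv.Perm (Fin 3)) := by
  let gen : Fin 3 → Cyc 2 × Cyc 2 :=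
    ![(Multiplicative.ofAdd 1, 1), (1, Multiplicative.ofAdd 1),
      (Multiplicative.ofAdd 1, Multiplicative.ofAdd 1)]
  have hinj : Function.Injective gen := by decide
  have hcover : ∀ g, g = 1 ∨ ∃ j, g = gen j := by decide
  have hgen1 : ∀ j, gen j ≠ 1 := by decide
  refine nonempty_mulAut_mulEquiv gen ?_ (fun (σ : Equiv.Perm (Fin 3)) j => gen (σ j)) ?_ rfl ?_ ?_
    ?_
  · intro F F' h
    ext1 g
    rcases hcover g with rfl | ⟨j, rfl⟩
    · rw [map_one, map_one]
    · exact h j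
  · have key : ∀ σ : Equiv.Perm (Fin 3), ∃ A B : Cyc 2 × Cyc 2, ∀ j,
        A ^ ((gen j).1.toAdd.val) * B ^ ((gen j).2.toAdd.val) = gen (σ j) := by decide
    intro σ
    obtain ⟨A, B, h⟩ := key σ
    have hsq : ∀ g : Cyc 2 × Cyc 2, g ^ 2 = 1 := by decide
    exact ⟨MonoidHom.coprod (involutionHom A (hsq A)) (involutionHom B (hsq B)), h⟩
  · exact fun σ σ' F hF j => hF (σ' j)
  · intro σ hσ
    ext1 j
    exact hinj (congrFun hσ j)
  · intro f
    have hex : ∀ j, ∃ k, f (gen j) = gen k := fun j =>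
      (hcover (f (gen j))).resolve_left fun h =>
        hgen1 j ((map_eq_one_iff f f.injective).1 h)
    choose σ hσ using hex
    have hσi : Function.Injective σ := fun j k hjk =>
      hinj (f.injective (by rw [hσ, hσ, hjk]))
    exact ⟨Equiv.ofBijective σ (Finite.injective_iff_bijective.1 hσi), hσ⟩

/-- The automorphism group of an elementary abelian group is a general linear group. -/
theorem nonempty_mulAut_mulEquiv_generalLinearGroup (n p : ℕ) :
    Nonempty (MulAut (Multiplicative (Fin n → ZMod p)) ≃*
      Matrix.GeneralLinearGroup (Fin n) (ZMod p)) := by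
  let e : ((Fin n → ZMod p) ≃ₗ[ZMod p] (Fin n → ZMod p)) ≃*
      MulAut (Multiplicative (Fin n → ZMod p)) :=
    { toFun := fun f => AddEquiv.toMultiplicative f.toAddEquiv
      invFun := fun f =>
        let f' : (Fin n → ZMod p) ≃+ (Fin n → ZMod p) := AddEquiv.toMultiplicative.symm f
        { f' with map_smul' := ZMod.map_smul f'.toAddMonoidHom }
      left_inv := fun _ => rfl
      right_inv := fun _ => rfl
      map_mul' := fun _ _ => rfl }
  exact ⟨e.symm.trans ((LinearMap.GeneralLinearGroup.generalLinearEquiv _ _).symm.trans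
    Matrix.GeneralLinearGroup.toLin.symm)⟩

theorem nonempty_mulAut_cube_mulEquiv :
    Nonempty (MulAut (Cyc 2 × Cyc 2 × Cyc 2) ≃* Matrix.GeneralLinearGroup (Fin 3) (ZMod 2)) := by
  let e : Multiplicative (Fin 3 → ZMod 2) ≃* Cyc 2 × Cyc 2 × Cyc 2 :=
    { toFun := fun v => (Multiplicative.ofAdd (v.toAdd 0), Multiplicative.ofAdd (v.toAdd 1),
        Multiplicative.ofAdd (v.toAdd 2))
      invFun := fun t => Multiplicative.ofAdd ![t.1.toAdd, t.2.1.toAdd, t.2.2.toAdd]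
      left_inv := fun v => by
        apply Multiplicative.toAdd.injective
        funext j
        fin_cases j <;> rfl
      right_inv := fun t => rfl
      map_mul' := fun v w => rfl }
  obtain ⟨E⟩ := nonempty_mulAut_mulEquiv_generalLinearGroup 3 2
  exact ⟨(MulAut.congr e).symm.trans E⟩

theorem three_dvd_card_generalLinearGroup :
    3 ∣ Nat.card (Matrix.GeneralLinearGroup (Fin 3) (ZMod 2)) := by
  have : Fact (Nat.Prime 2) := ⟨Nat.prime_two⟩
  rw [Matrix.card_GL_field, Fin.prod_univ_three, ZMod.card]
  norm_num

theorem hasRegularTriple_klein : HasRegularTriple (Cyc 2 × Cyc 2) := by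
  refine hasRegularTriple_of (x := (Multiplicative.ofAdd 1, 1)) (y := (Multiplicative.ofAdd 1, 1))
    (z := (1, Multiplicative.ofAdd 1)) ?_ ?_ ?_ ?_ (by decide) (by decide)
  · rw [orderOf_eq_two_iff']; decide
  · rw [orderOf_eq_two_iff']; decide
  · rw [orderOf_eq_two_iff']; decide
  · have key : ∀ g : Cyc 2 × Cyc 2, ∃ j k : Fin 2,
        (Multiplicative.ofAdd 1, 1) ^ j.val * (1, Multiplicative.ofAdd 1) ^ k.val = g := by decide
    rw [eq_top_iff]
    intro g _
    obtain ⟨j, k, rfl⟩ := key g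
    exact mul_mem (pow_mem (Subgroup.subset_closure (by simp)) _)
      (pow_mem (Subgroup.subset_closure (by simp)) _)

theorem hasRotaryPair_klein : HasRotaryPair (Cyc 2 × Cyc 2) := by
  refine ⟨(Multiplicative.ofAdd 1, 1), (1, Multiplicative.ofAdd 1), ?_, ?_⟩
  · rw [orderOf_eq_two_iff']; decide
  · have key : ∀ g : Cyc 2 × Cyc 2, ∃ j k : Fin 2,
        (Multiplicative.ofAdd 1, 1) ^ j.val * (1, Multiplicative.ofAdd 1) ^ k.val = g := by decide
    rw [eq_top_iff]
    intro g _
    obtain ⟨j, k, rfl⟩ := key g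
    exact mul_mem (pow_mem (Subgroup.subset_closure (by simp)) _)
      (pow_mem (Subgroup.subset_closure (by simp)) _)

theorem hasRegularTriple_cube : HasRegularTriple (Cyc 2 × Cyc 2 × Cyc 2) := by
  refine hasRegularTriple_of (x := (Multiplicative.ofAdd 1, 1, 1))
    (y := (1, Multiplicative.ofAdd 1, 1))
    (z := (1, 1, Multiplicative.ofAdd 1)) ?_ ?_ ?_ ?_ (by decide) (by decide)
  · rw [orderOf_eq_two_iff']; decide
  · rw [orderOf_eq_two_iff']; decide
  · rw [orderOf_eq_two_iff']; decide
  · have key : ∀ g : Cyc 2 × Cyc 2 × Cyc 2, ∃ j k l : Fin 2,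
        (Multiplicative.ofAdd 1, 1, 1) ^ j.val * (1, Multiplicative.ofAdd 1, 1) ^ k.val *
          (1, 1, Multiplicative.ofAdd 1) ^ l.val = g := by decide
    rw [eq_top_iff]
    intro g _
    obtain ⟨j, k, l, rfl⟩ := key g
    exact mul_mem (mul_mem (pow_mem (Subgroup.subset_closure (by simp)) _)
      (pow_mem (Subgroup.subset_closure (by simp)) _))
      (pow_mem (Subgroup.subset_closure (by simp)) _)

/-! ### Quaternion groups -/

namespace QuaternionGroup

theorem not_hasReversingTriple {m : ℕ} [NeZero m] (hm : Even m) :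
    ¬ HasReversingTriple (QuaternionGroup m) := by
  obtain ⟨χ, hχ, hχ'⟩ := exists_frattini_hom hm
  refine _root_.not_hasReversingTriple χ (fun h => ?_) fun x hx => ?_
  · rw [h] at hχ'
    exact absurd (congrArg Prod.snd hχ') (show ¬ (1 : Cyc 2) = Multiplicative.ofAdd 1 by decide)
  · rcases eq_one_or_eq_of_mul_self hx with rfl | rfl
    · exact map_one χ
    · rw [hχ, map_natCast, (ZMod.natCast_eq_zero_iff m 2).2 hm.two_dvd]
      rfl

theorem not_hasRotaryPair {m : ℕ} [NeZero m] (hm : 2 ≤ m) :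
    ¬ HasRotaryPair (QuaternionGroup m) := by
  refine not_hasRotaryPair_of_central (fun z hz g => ?_) (xa 0) (a 1) (not_commute_xa hm 0)
  obtain ⟨h1, h2⟩ := orderOf_eq_two_iff'.1 hz
  rw [(eq_one_or_eq_of_mul_self h1).resolve_left h2]
  exact a_natCast_mul_comm g

/-- The six elements of order four of `Q_8` correspond to the six cycles of length four in the
symmetric group, as the quarter-turns of an octahedron about the coordinate axes. -/
def fourCycle : QuaternionGroup 2 → Equiv.Perm (Fin 4)
  | a x => (![1, c[0, 1, 2, 3], 1, c[0, 3, 2, 1]] : Fin 4 → Equiv.Perm (Fin 4)) x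
  | xa x => (![c[0, 1, 3, 2], c[0, 3, 1, 2], c[0, 2, 3, 1], c[0, 2, 1, 3]] :
      Fin 4 → Equiv.Perm (Fin 4)) x

/-- The action of a permutation on `Q_8` by conjugation of `fourCycle`. -/
def conjFourCycle (σ : Equiv.Perm (Fin 4)) (q : QuaternionGroup 2) : QuaternionGroup 2 :=
  if q = 1 ∨ q = a 2 then q else
  if σ * fourCycle q = fourCycle (a 1) * σ then a 1 else
  if σ * fourCycle q = fourCycle (a 3) * σ then a 3 else
  if σ * fourCycle q = fourCycle (xa 0) * σ then xa 0 else
  if σ * fourCycle q = fourCycle (xa 1) * σ then xa 1 else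
  if σ * fourCycle q = fourCycle (xa 2) * σ then xa 2 else xa 3

theorem exists_hom_fourCycle (σ : Equiv.Perm (Fin 4)) :
    ∃ F : QuaternionGroup 2 →* QuaternionGroup 2,
      ∀ q, fourCycle (F q) = σ * fourCycle q * σ⁻¹ := by
  have hgen : σ ∈ Submonoid.closure
      (Set.range fun j : Fin 3 => Equiv.swap j.castSucc j.succ) := by
    rw [Equiv.Perm.mclosure_swap_castSucc_succ]
    exact Submonoid.mem_top σ
  induction hgen using Submonoid.closure_induction with
  | mem σ h =>
    obtain ⟨j, rfl⟩ := h
    have h1 : ∀ (j : Fin 3) (x y : QuaternionGroup 2),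
        conjFourCycle (Equiv.swap j.castSucc j.succ) (x * y) =
          conjFourCycle (Equiv.swap j.castSucc j.succ) x *
            conjFourCycle (Equiv.swap j.castSucc j.succ) y := by decide
    have h2 : ∀ (j : Fin 3) (q : QuaternionGroup 2),
        fourCycle (conjFourCycle (Equiv.swap j.castSucc j.succ) q) =
          Equiv.swap j.castSucc j.succ * fourCycle q * (Equiv.swap j.castSucc j.succ)⁻¹ := by
      decide
    exact ⟨MonoidHom.mk' _ (h1 j), h2 j⟩
  | one => exact ⟨MonoidHom.id _, fun q => by simp⟩
  | mul σ τ _ _ hσ hτ =>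
    obtain ⟨F, hF⟩ := hσ
    obtain ⟨F', hF'⟩ := hτ
    refine ⟨F.comp F', fun q => ?_⟩
    rw [MonoidHom.comp_apply, hF, hF', mul_inv_rev]
    simp only [mul_assoc]

theorem hom_ext_fourCycle {F F' : QuaternionGroup 2 →* QuaternionGroup 2} {σ : Equiv.Perm (Fin 4)}
    (h : ∀ q, fourCycle (F q) = σ * fourCycle q * σ⁻¹)
    (h' : ∀ q, fourCycle (F' q) = σ * fourCycle q * σ⁻¹) : F = F' := by
  have hinj : ∀ q q', fourCycle q = fourCycle q' → fourCycle q ≠ 1 → q = q' := by decide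
  have hconj : ∀ τ, σ * τ * σ⁻¹ ≠ 1 ↔ τ ≠ 1 := fun τ => by
    rw [Ne, Ne, conj_eq_one_iff]
  have key : ∀ q, fourCycle q ≠ 1 → F q = F' q := fun q hq =>
    hinj _ _ (by rw [h, h']) (by rwa [h, hconj])
  have hdec : ∀ q : QuaternionGroup 2, ∃ x y, fourCycle x ≠ 1 ∧ fourCycle y ≠ 1 ∧ q = x * y := by
    decide
  ext1 q
  obtain ⟨x, y, hx, hy, rfl⟩ := hdec q
  rw [map_mul, map_mul, key x hx, key y hy]

/-- The automorphism group of `Q_8` acts on the elements of order four like the rotation group of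
an octahedron. -/
theorem nonempty_mulAut_mulEquiv_perm :
    Nonempty (MulAut (QuaternionGroup 2) ≃* Equiv.Perm (Fin 4)) := by
  choose p hp using exists_hom_fourCycle
  have hgen : ∀ F F' : QuaternionGroup 2 →* QuaternionGroup 2, F (a 1) = F' (a 1) →
      F (xa 0) = F' (xa 0) → F = F' := by
    intro F F' h1 h2
    have hdec : ∀ q : QuaternionGroup 2, ∃ j : Fin 4, ∃ k : Fin 2,
        q = a 1 ^ j.val * xa 0 ^ k.val := by decide
    ext1 q
    obtain ⟨j, k, rfl⟩ := hdec q
    rw [map_mul, map_mul, map_pow, map_pow, map_pow, map_pow, h1, h2]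
  refine nonempty_mulAut_mulEquiv (fun q => q) (fun F F' h => MonoidHom.ext h)
    (fun σ q => p σ q) (fun σ => ⟨p σ, fun _ => rfl⟩) ?_ ?_ ?_ ?_
  · have : p 1 = MonoidHom.id _ := hom_ext_fourCycle (hp 1) fun q => by simp
    rw [this]
    rfl
  · intro σ τ F hF q
    have h1 : F = p σ := MonoidHom.ext hF
    have h2 : (p σ).comp (p τ) = p (σ * τ) := hom_ext_fourCycle (fun q => by
      rw [MonoidHom.comp_apply, hp, hp, mul_inv_rev]
      simp only [mul_assoc]) (hp _)
    rw [h1, ← h2]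
    rfl
  · intro σ hσ
    have h1 : ∀ q, fourCycle q = σ * fourCycle q * σ⁻¹ := fun q => by
      rw [← hp σ q]
      exact congrArg _ (congrFun hσ q).symm
    have hcen : ∀ σ : Equiv.Perm (Fin 4), σ * fourCycle (a 1) = fourCycle (a 1) * σ →
        σ * fourCycle (xa 0) = fourCycle (xa 0) * σ → σ = 1 := by decide
    exact hcen σ (eq_mul_inv_iff_mul_eq.1 (h1 (a 1))).symm
      (eq_mul_inv_iff_mul_eq.1 (h1 (xa 0))).symm
  · intro f
    have key : ∀ A B : QuaternionGroup 2, (A * A ≠ 1 ∧ B * B ≠ 1 ∧ A ≠ B ∧ A * B ≠ 1) →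
        ∃ σ : Equiv.Perm (Fin 4), fourCycle A * σ = σ * fourCycle (a 1) ∧
          fourCycle B * σ = σ * fourCycle (xa 0) := by
      decide
    have hne : ∀ A : QuaternionGroup 2, A * A ≠ 1 → fourCycle A ≠ 1 := by decide
    have hA2 : f (a 1) * f (a 1) ≠ 1 := by
      rw [← map_mul, Ne, map_eq_one_iff f f.injective]; decide
    have hB2 : f (xa 0) * f (xa 0) ≠ 1 := by
      rw [← map_mul, Ne, map_eq_one_iff f f.injective]; decide
    have hinj : ∀ q q', fourCycle q = fourCycle q' → fourCycle q ≠ 1 → q = q' := by decide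
    obtain ⟨σ, hA, hB⟩ := key (f (a 1)) (f (xa 0))
      ⟨hA2, hB2, f.injective.ne (by decide),
        by rw [← map_mul, Ne, map_eq_one_iff f f.injective]; decide⟩
    have : f.toMonoidHom = p σ := hgen _ _
      (hinj _ _ (by rw [hp]; exact eq_mul_inv_iff_mul_eq.2 hA) (hne _ hA2))
      (hinj _ _ (by rw [hp]; exact eq_mul_inv_iff_mul_eq.2 hB) (hne _ hB2))
    exact ⟨σ, fun q => DFunLike.congr_fun this q⟩

end QuaternionGroup

/-! ### Generating triples of the groups with a cyclic subgroup of index two -/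

namespace IsCyclicExt

variable {G : Type*} [Group G]

theorem closure_eq_top {n : ℕ} [NeZero n] {E : ZMod n → G} {b : G} {u s : ZMod n}
    (h : IsCyclicExt E b u s) {K : Subgroup G} (h1 : E 1 ∈ K) (hb : b ∈ K) : K = ⊤ := by
  have hE : ∀ x, E x ∈ K := by
    intro x
    obtain ⟨k, rfl⟩ := ZMod.natCast_zmod_surjective x
    have : E (k : ZMod n) = E 1 ^ k := by rw [h.pow, mul_one]
    rw [this]
    exact pow_mem h1 k
  rw [eq_top_iff]
  rintro g -
  rcases h.cover g with ⟨m, rfl⟩ | ⟨m, rfl⟩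
  · exact hE m
  · exact mul_mem (hE m) hb

theorem orderOf_b {n : ℕ} {E : ZMod n → G} {b : G} {u : ZMod n} (h : IsCyclicExt E b u 0) :
    orderOf b = 2 := by
  rw [orderOf_eq_two_iff', h.sq, h.zero]
  exact ⟨rfl, fun hb => h.ne 0 (by rw [h.zero, hb])⟩

theorem hasRotaryPair {n : ℕ} [NeZero n] {E : ZMod n → G} {b : G} {u : ZMod n}
    (h : IsCyclicExt E b u 0) : HasRotaryPair G :=
  ⟨E 1, b, h.orderOf_b, h.closure_eq_top (Subgroup.subset_closure (by simp))
    (Subgroup.subset_closure (by simp))⟩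

/-- The homomorphism `E x ↦ x` modulo `2`, `b ↦ 1` vanishes on all involutions if it vanishes on
those outside of the cyclic subgroup. -/
theorem not_hasReversingTriple {ℓ : ℕ} {E : ZMod (2 ^ (ℓ + 1)) → G} {b : G}
    {u : ZMod (2 ^ (ℓ + 1))} (h : IsCyclicExt E b u 0) (hℓ : 1 ≤ ℓ)
    (hinv : ∀ x, x + u * x = 0 → parity ℓ x = 0) : ¬ HasReversingTriple G := by
  have hu : parity ℓ u = 1 := parity_eq_one_iff.2 (IsUnit.of_mul_eq_one u h.mul_self_u)
  obtain ⟨χ, hE, hb⟩ := h.exists_hom (fun x => Multiplicative.ofAdd (parity ℓ x))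
    (fun x y => by rw [map_add, ofAdd_add]) (1 : Cyc 2)
    (fun x => by rw [map_mul, hu, one_mul, one_mul, mul_one])
    (by rw [map_zero, mul_one, ofAdd_zero])
  refine _root_.not_hasReversingTriple χ (fun h1 => ?_) fun g hg => ?_
  · have h2 := hE 1
    rw [h1, map_one] at h2
    exact absurd h2 (show ¬ (1 : Cyc 2) = Multiplicative.ofAdd 1 by decide)
  · have hpar : ∀ x, parity ℓ x = 0 → χ (E x) = 1 := fun x hx => by rw [hE, hx, ofAdd_zero]
    rcases h.cover g with ⟨x, rfl⟩ | ⟨x, rfl⟩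
    · rw [h.mulE, h.eq_one_iff, ← two_mul] at hg
      apply hpar
      rcases two_mul_eq_zero_iff.1 hg with rfl | rfl
      · exact map_zero _
      · exact parity_two_pow hℓ
    · rw [h.mulbb, h.eq_one_iff, add_zero] at hg
      rw [map_mul, hpar x (hinv x hg), hb, one_mul]

theorem hasRegularTriple {ℓ : ℕ} {E : ZMod (2 ^ (ℓ + 1)) → G} {b : G}
    (h : IsCyclicExt E b (-1) 0) : HasRegularTriple G := by
  refine hasRegularTriple_of (x := b) (y := E 1 * b) (z := E (2 ^ ℓ)) h.orderOf_b ?_ ?_ ?_ ?_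
    (h.ne _).symm
  · rw [orderOf_eq_two_iff', h.mulbb, h.eq_one_iff]
    exact ⟨by ring, h.mul_b_ne_one⟩
  · rw [orderOf_eq_two_iff', h.mulE, two_pow_add_two_pow, h.zero, Ne, h.eq_one_iff]
    exact ⟨rfl, two_pow_ne_zero ℓ⟩
  · have hb : b ∈ Subgroup.closure {b, E 1 * b, E (2 ^ ℓ)} := Subgroup.subset_closure (by simp)
    have hEb : E 1 * b ∈ Subgroup.closure {b, E 1 * b, E (2 ^ ℓ)} :=
      Subgroup.subset_closure (by simp)
    exact h.closure_eq_top ((Subgroup.mul_mem_cancel_right _ hb).1 hEb) hb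
  · rw [h.conj, neg_one_mul, neg_two_pow]

end IsCyclicExt

/-! ### The groups with a cyclic maximal subgroup -/

section Rows

variable {G : Type*} [Group G] {ℓ : ℕ}

theorem cyclic_properties (hℓ : 2 ≤ ℓ) (e : G ≃* Cyc (2 ^ ℓ)) :
    IsPGroup 2 (MulAut G) ∧ Nonempty (MulAut G ≃* Cyc (2 ^ (ℓ - 2)) × Cyc 2) ∧
      ¬ HasReversingTriple G ∧ ¬ HasRegularTriple G ∧ HasRotaryPair G := by
  obtain ⟨E⟩ := nonempty_mulAut_cyc_mulEquiv hℓ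
  have h3 : ¬ HasReversingTriple (Cyc (2 ^ ℓ)) := by
    obtain ⟨m, rfl⟩ := Nat.exists_eq_add_of_le' hℓ
    refine not_hasReversingTriple (AddMonoidHom.toMultiplicative (parity (m + 1)).toAddMonoidHom)
      (fun h => ?_) fun g hg => ?_
    · have h1 : Multiplicative.ofAdd (parity (m + 1) 1) = 1 :=
        DFunLike.congr_fun h (Multiplicative.ofAdd 1)
      rw [map_one] at h1
      exact absurd h1 (by decide)
    · have h1 : (2 : ZMod (2 ^ (m + 1 + 1))) * g.toAdd = 0 := by
        rw [two_mul]
        exact congrArg Multiplicative.toAdd hg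
      change Multiplicative.ofAdd (parity (m + 1) g.toAdd) = 1
      rcases two_mul_eq_zero_iff.1 h1 with h2 | h2
      · rw [h2, map_zero, ofAdd_zero]
      · rw [h2, parity_two_pow (by omega), ofAdd_zero]
  refine ⟨isPGroup_of_mulEquiv_of_card (ℓ - 2 + 1) ⟨(MulAut.congr e).trans E⟩ ?_,
    ⟨(MulAut.congr e).trans E⟩, fun h => h3 (h.map e),
    fun h => h3 (h.hasReversingTriple.map e), ?_⟩
  · rw [Nat.card_prod, card_cyc, card_cyc, pow_succ]
  · obtain ⟨m, rfl⟩ := Nat.exists_eq_add_of_le' hℓ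
    refine HasRotaryPair.map e.symm ⟨Multiplicative.ofAdd 1,
      Multiplicative.ofAdd ((2 : ZMod (2 ^ (m + 1 + 1))) ^ (m + 1)), ?_, ?_⟩
    · rw [orderOf_eq_two_iff']
      exact ⟨congrArg Multiplicative.ofAdd (two_pow_add_two_pow (m + 1)),
        fun h => two_pow_ne_zero (m + 1) h⟩
    · rw [eq_top_iff]
      intro g _
      obtain ⟨k, hk⟩ := ZMod.natCast_zmod_surjective (n := 2 ^ (m + 2)) g.toAdd
      have : g = Multiplicative.ofAdd 1 ^ k := by
        apply Multiplicative.toAdd.injective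
        rw [← hk, toAdd_pow, toAdd_ofAdd, nsmul_one]
      rw [this]
      exact pow_mem (Subgroup.subset_closure (by simp)) k

theorem four_prod_two_properties (e : G ≃* Cyc 4 × Cyc 2) :
    IsPGroup 2 (MulAut G) ∧ Nonempty (MulAut G ≃* DihedralGroup 4) ∧
      ¬ HasReversingTriple G ∧ ¬ HasRegularTriple G ∧ HasRotaryPair G := by
  have h : IsCyclicExt (n := 2 ^ (1 + 1)) _ _ _ _ := (isCyclicExt_prod 4).map e.symm
  obtain ⟨h1, h2⟩ := h.nonempty_mulAut_mulEquiv_dihedral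
  have h3 : ¬ HasReversingTriple G := h.not_hasReversingTriple le_rfl (by decide)
  exact ⟨h1, h2, h3, fun h => h3 h.hasReversingTriple, h.hasRotaryPair⟩

theorem cyclic_prod_two_properties (hℓ : 2 ≤ ℓ) (e : G ≃* Cyc (2 ^ (ℓ + 1)) × Cyc 2) :
    IsPGroup 2 (MulAut G) ∧
      (∃ d : CentralGluing (Cyc (2 ^ (ℓ - 1))) (DihedralGroup 4), d.IsFull ∧
        Nonempty (MulAut G ≃* d.Product × Cyc 2)) ∧
      ¬ HasReversingTriple G ∧ ¬ HasRegularTriple G ∧ HasRotaryPair G := by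
  have h := (isCyclicExt_prod (2 ^ (ℓ + 1))).map e.symm
  obtain ⟨h1, h2⟩ := h.nonempty_mulAut_mulEquiv_product hℓ (Or.inl rfl)
  have h3 : ¬ HasReversingTriple G := h.not_hasReversingTriple (by omega) fun x hx => by
    rw [one_mul, ← two_mul] at hx
    rcases two_mul_eq_zero_iff.1 hx with rfl | rfl
    · exact map_zero _
    · exact parity_two_pow (by omega)
  exact ⟨h1, h2, h3, fun h => h3 h.hasReversingTriple, h.hasRotaryPair⟩

theorem modularGrp_properties (hℓ : 2 ≤ ℓ) (e : G ≃* ModularGrp ℓ hℓ) :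
    IsPGroup 2 (MulAut G) ∧
      (∃ d : CentralGluing (Cyc (2 ^ (ℓ - 1))) (DihedralGroup 4), d.IsFull ∧
        Nonempty (MulAut G ≃* d.Product × Cyc 2)) ∧
      ¬ HasReversingTriple G ∧ ¬ HasRegularTriple G ∧ HasRotaryPair G := by
  have h := (isCyclicExt_modularGrp ℓ hℓ).map e.symm
  obtain ⟨h1, h2⟩ := h.nonempty_mulAut_mulEquiv_product hℓ (Or.inr (add_comm _ _))
  have h3 : ¬ HasReversingTriple G := h.not_hasReversingTriple (by omega) fun x hx => by
    rcases parity_eq_zero_or_one x with hp | hp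
    · exact hp
    · -- for odd `x` the equation reads `2 * (x + 2 ^ (ℓ - 1)) = 0`
      have hhalf : (2 : ZMod (2 ^ (ℓ + 1))) * 2 ^ (ℓ - 1) = 2 ^ ℓ := by
        obtain ⟨m, rfl⟩ := Nat.exists_eq_add_of_le' (show 1 ≤ ℓ by omega)
        rw [Nat.add_sub_cancel]; ring
      have hx2 : 2 * (x + 2 ^ (ℓ - 1)) = 0 := by
        linear_combination hx - two_pow_mul_of_odd hp + hhalf
      have hpx : parity ℓ (x + 2 ^ (ℓ - 1)) = parity ℓ x := by
        rw [map_add, map_pow, parity_two, zero_pow (by omega), add_zero]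
      rw [← hpx]
      rcases two_mul_eq_zero_iff.1 hx2 with h0 | h0
      · rw [h0, map_zero]
      · rw [h0, parity_two_pow (by omega)]
  exact ⟨h1, h2, h3, fun h => h3 h.hasReversingTriple, h.hasRotaryPair⟩

theorem dihedral_properties (hℓ : 2 ≤ ℓ) (e : G ≃* DihedralGroup (2 ^ ℓ)) :
    IsPGroup 2 (MulAut G) ∧ Nonempty (MulAut G ≃* Holomorph (Cyc (2 ^ ℓ))) ∧
      HasReversingTriple G ∧ HasRegularTriple G ∧ HasRotaryPair G := by
  obtain ⟨k, rfl⟩ := Nat.exists_eq_add_of_le' (show 1 ≤ ℓ by omega)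
  have h := (isCyclicExt_dihedralGroup (2 ^ (k + 1))).map e.symm
  have h1 := h.nonempty_mulAut_mulEquiv_holomorph 2
    (by exact_mod_cast two_ne_zero_of_pos (show 1 ≤ k by omega))
    (fun x => by rw [pow_two, h.mulbb, h.eq_one_iff]; ring) (fun v => mul_zero _)
  exact ⟨isPGroup_of_mulEquiv_of_card _ h1 (card_holomorph_cyc k), h1,
    h.hasRegularTriple.hasReversingTriple, h.hasRegularTriple, h.hasRotaryPair⟩

theorem semiDihedral_properties (hℓ : 2 ≤ ℓ) (e : G ≃* SemiDihedral ℓ hℓ) :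
    IsPGroup 2 (MulAut G) ∧ Nonempty (MulAut G ≃* CycByAut ℓ) ∧
      ¬ HasReversingTriple G ∧ ¬ HasRegularTriple G ∧ HasRotaryPair G := by
  have h := (isCyclicExt_semiDihedral ℓ hℓ).map e.symm
  have h1 := h.nonempty_mulAut_mulEquiv_cycByAut hℓ
  have h3 : ¬ HasReversingTriple G := h.not_hasReversingTriple (by omega) fun x hx => by
    rcases parity_eq_zero_or_one x with hp | hp
    · exact hp
    · refine absurd ?_ (two_pow_ne_zero ℓ)
      linear_combination hx - two_pow_mul_of_odd hp
  exact ⟨isPGroup_of_mulEquiv_of_card _ h1 (card_cycByAut ℓ), h1, h3,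
    fun h => h3 h.hasReversingTriple, h.hasRotaryPair⟩

theorem nonempty_mulAut_quaternionGroup_mulEquiv (hℓ : 2 ≤ ℓ) :
    Nonempty (MulAut (QuaternionGroup (2 ^ ℓ)) ≃* Holomorph (Cyc (2 ^ (ℓ + 1)))) := by
  have h := isCyclicExt_quaternionGroup_two_pow ℓ
  refine h.nonempty_mulAut_mulEquiv_holomorph 4
    (by exact_mod_cast four_ne_zero_of_two_le hℓ) (fun x => ?_) fun v => ?_
  · rw [pow_four_eq, h.mulbb, h.mulE, h.eq_one_iff]
    linear_combination two_mul_two_pow ℓ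
  · rw [mul_comm, two_pow_mul_unit]

theorem two_le_two_pow (hℓ : 2 ≤ ℓ) : 2 ≤ 2 ^ ℓ :=
  le_trans (by norm_num) (Nat.pow_le_pow_right (by norm_num) hℓ)

theorem even_two_pow (hℓ : 2 ≤ ℓ) : Even (2 ^ ℓ) :=
  (by decide : Even 2).pow_of_ne_zero (by omega)

theorem quaternion_triples {m : ℕ} (hm : 2 ≤ m) (hm' : Even m) (e : G ≃* QuaternionGroup m) :
    ¬ HasReversingTriple G ∧ ¬ HasRegularTriple G ∧ ¬ HasRotaryPair G := by
  have : NeZero m := ⟨by omega⟩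
  exact ⟨fun h => QuaternionGroup.not_hasReversingTriple hm' (h.map e),
    fun h => QuaternionGroup.not_hasReversingTriple hm' (h.hasReversingTriple.map e),
    fun h => QuaternionGroup.not_hasRotaryPair hm (h.map e)⟩

theorem quaternion_properties (hℓ : 2 ≤ ℓ) (e : G ≃* QuaternionGroup (2 ^ ℓ)) :
    IsPGroup 2 (MulAut G) ∧ Nonempty (MulAut G ≃* Holomorph (Cyc (2 ^ (ℓ + 1)))) ∧
      ¬ HasReversingTriple G ∧ ¬ HasRegularTriple G ∧ ¬ HasRotaryPair G := by
  obtain ⟨E⟩ := nonempty_mulAut_quaternionGroup_mulEquiv hℓ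
  exact ⟨isPGroup_of_mulEquiv_of_card _ ⟨(MulAut.congr e).trans E⟩ (card_holomorph_cyc ℓ),
    ⟨(MulAut.congr e).trans E⟩, quaternion_triples (two_le_two_pow hℓ) (even_two_pow hℓ) e⟩

theorem quaternion_eight_properties (e : G ≃* QuaternionGroup 2) :
    ¬ IsPGroup 2 (MulAut G) ∧ Nonempty (MulAut G ≃* Equiv.Perm (Fin 4)) ∧
      ¬ HasReversingTriple G ∧ ¬ HasRegularTriple G ∧ ¬ HasRotaryPair G := by
  obtain ⟨E⟩ := QuaternionGroup.nonempty_mulAut_mulEquiv_perm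
  refine ⟨not_isPGroup_of_mulEquiv ((MulAut.congr e).trans E) ?_, ⟨(MulAut.congr e).trans E⟩,
    quaternion_triples le_rfl (by decide) e⟩
  rw [Nat.card_eq_fintype_card, Fintype.card_perm]
  decide

theorem klein_properties (e : G ≃* Cyc 2 × Cyc 2) :
    ¬ IsPGroup 2 (MulAut G) ∧ Nonempty (MulAut G ≃* Equiv.Perm (Fin 3)) ∧
      HasReversingTriple G ∧ HasRegularTriple G ∧ HasRotaryPair G := by
  obtain ⟨E⟩ := nonempty_mulAut_klein_mulEquiv
  have h1 : HasRegularTriple G := hasRegularTriple_klein.map e.symm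
  refine ⟨not_isPGroup_of_mulEquiv ((MulAut.congr e).trans E) ?_, ⟨(MulAut.congr e).trans E⟩,
    h1.hasReversingTriple, h1, hasRotaryPair_klein.map e.symm⟩
  rw [Nat.card_eq_fintype_card, Fintype.card_perm]
  decide

/-! ### The groups of rank three -/

theorem cube_properties (e : G ≃* Cyc 2 × Cyc 2 × Cyc 2) :
    ¬ IsPGroup 2 (MulAut G) ∧
      Nonempty (MulAut G ≃* Matrix.GeneralLinearGroup (Fin 3) (ZMod 2)) ∧
      HasReversingTriple G ∧ HasRegularTriple G ∧ ¬ HasRotaryPair G := by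
  obtain ⟨E⟩ := nonempty_mulAut_cube_mulEquiv
  have h1 : HasRegularTriple G := hasRegularTriple_cube.map e.symm
  exact ⟨not_isPGroup_of_mulEquiv ((MulAut.congr e).trans E) three_dvd_card_generalLinearGroup,
    ⟨(MulAut.congr e).trans E⟩, h1.hasReversingTriple, h1,
    not_hasRotaryPair_of_surjective (χ := e.toMonoidHom) e.surjective⟩

/-- The properties of a central product of a quaternion group and `Z_4` that do not depend on the
order of the quaternion group. -/
theorem quaternion_four_triples {m : ℕ} (hm : 2 ≤ m) (hm' : Even m)
    (h : IsCentralProduct G (QuaternionGroup m) (Cyc 4)) :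
    Nonempty (MulAut G ≃* MulAut (QuaternionGroup m) × Cyc 2) ∧
      HasReversingTriple G ∧ ¬ HasRegularTriple G ∧ ¬ HasRotaryPair G := by
  have : NeZero m := ⟨by omega⟩
  obtain ⟨d, hd, ⟨e⟩⟩ := h
  obtain ⟨i, c, h⟩ := d.exists_isTwoExt hm hd
  have h' := h.map e.symm
  refine ⟨h'.nonempty_mulAut_mulEquiv_of_quaternion hm, ?_,
    h'.not_hasRegularTriple_of_quaternion hm', h'.not_hasRotaryPair_of_quaternion hm'⟩
  obtain ⟨k, rfl⟩ := hm'
  exact h'.hasReversingTriple_of_quaternion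

theorem quaternion_four_properties (hℓ : 2 ≤ ℓ)
    (h : IsCentralProduct G (QuaternionGroup (2 ^ ℓ)) (Cyc 4)) :
    IsPGroup 2 (MulAut G) ∧ Nonempty (MulAut G ≃* MulAut (QuaternionGroup (2 ^ ℓ)) × Cyc 2) ∧
      HasReversingTriple G ∧ ¬ HasRegularTriple G ∧ ¬ HasRotaryPair G := by
  obtain ⟨h1, h2⟩ := quaternion_four_triples (two_le_two_pow hℓ) (even_two_pow hℓ) h
  refine ⟨isPGroup_of_mulEquiv_of_card (ℓ + 1 + ℓ + 1) h1 ?_, h1, h2⟩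
  obtain ⟨E⟩ := nonempty_mulAut_quaternionGroup_mulEquiv hℓ
  rw [Nat.card_prod, Nat.card_congr E.toEquiv, card_holomorph_cyc, card_cyc, pow_succ 2 (ℓ + 1 + ℓ)]

theorem quaternion_eight_four_properties (h : IsCentralProduct G (QuaternionGroup 2) (Cyc 4)) :
    ¬ IsPGroup 2 (MulAut G) ∧ Nonempty (MulAut G ≃* Equiv.Perm (Fin 4) × Cyc 2) ∧
      HasReversingTriple G ∧ ¬ HasRegularTriple G ∧ ¬ HasRotaryPair G := by
  obtain ⟨⟨E⟩, h2⟩ := quaternion_four_triples le_rfl (by decide) h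
  obtain ⟨E'⟩ := QuaternionGroup.nonempty_mulAut_mulEquiv_perm
  have e := E.trans (E'.prodCongr (MulEquiv.refl (Cyc 2)))
  refine ⟨not_isPGroup_of_mulEquiv e ?_, ⟨e⟩, h2⟩
  rw [Nat.card_prod, Nat.card_eq_fintype_card (α := Equiv.Perm (Fin 4)), Fintype.card_perm]
  exact Dvd.dvd.mul_right (by decide) _

theorem dihedral_prod_two_properties (hℓ : 2 ≤ ℓ) (e : G ≃* DihedralGroup (2 ^ ℓ) × Cyc 2) :
    IsPGroup 2 (MulAut G) ∧
      (∃ (H : Subgroup (MulAut G)) (_ : H.Normal), Nonempty (H ≃* CycByAut (ℓ - 1)) ∧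
        Nonempty (MulAut G ⧸ H ≃* DihedralGroup 4 × Cyc 2)) ∧
      HasReversingTriple G ∧ HasRegularTriple G ∧ ¬ HasRotaryPair G := by
  obtain ⟨k, rfl⟩ := Nat.exists_eq_add_of_le' (show 1 ≤ ℓ by omega)
  have h := (isTwoExt_dihedral_prod (2 ^ (k + 1))).map e.symm
  obtain ⟨h1, h2⟩ := mulAut_dihedral_prod (show 1 ≤ k by omega) e
  exact ⟨h1, h2, h.hasRegularTriple.hasReversingTriple, h.hasRegularTriple,
    h.not_hasRotaryPair (even_two_pow hℓ) 1 Nat.cast_one odd_one⟩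

theorem cycByKlein_properties (hℓ : 2 ≤ ℓ) (e : G ≃* CycByKlein ℓ hℓ) :
    IsPGroup 2 (MulAut G) ∧
      (∃ θ : Cyc 2 →* MulAut (MulAut (SemiDihedral ℓ hℓ) × Cyc 2),
        Nonempty (MulAut G ≃* (MulAut (SemiDihedral ℓ hℓ) × Cyc 2) ⋊[θ] Cyc 2)) ∧
      HasReversingTriple G ∧ HasRegularTriple G ∧ ¬ HasRotaryPair G := by
  obtain ⟨i, c, h⟩ := exists_isTwoExt_cycByKlein ℓ hℓ
  have h' := h.map e.symm
  obtain ⟨E⟩ := (isCyclicExt_semiDihedral ℓ hℓ).nonempty_mulAut_mulEquiv_cycByAut hℓ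
  obtain ⟨θ, hθ⟩ := h'.nonempty_mulAut_mulEquiv_of_modular hℓ (E.prodCongr (MulEquiv.refl (Cyc 2)))
  refine ⟨isPGroup_of_mulEquiv_of_card (ℓ + ℓ + 1 + 1) hθ ?_, ⟨θ, hθ⟩,
    h'.hasRegularTriple.hasReversingTriple, h'.hasRegularTriple,
    h'.not_hasRotaryPair (even_two_pow (by omega)) (1 + 2 ^ ℓ) (by push_cast; rfl)
      ((even_two_pow hℓ).one_add)⟩
  rw [SemidirectProduct.card, Nat.card_prod, Nat.card_congr E.toEquiv, card_cycByAut, card_cyc,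
    pow_succ 2 (ℓ + ℓ + 1), pow_succ 2 (ℓ + ℓ)]

end Rows

/-! ### The classification -/

/-- `G` is isomorphic to one of the groups of the classification. -/
def IsListed (G : Type*) [Group G] : Prop :=
  (∃ (ℓ : ℕ) (hℓ : 2 ≤ ℓ),
    Nonempty (G ≃* Cyc (2 ^ ℓ)) ∨
    Nonempty (G ≃* Cyc 4 × Cyc 2) ∨
    Nonempty (G ≃* Cyc (2 ^ (ℓ + 1)) × Cyc 2) ∨
    Nonempty (G ≃* DihedralGroup (2 ^ ℓ)) ∨
    Nonempty (G ≃* SemiDihedral ℓ hℓ) ∨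
    Nonempty (G ≃* ModularGrp ℓ hℓ) ∨
    Nonempty (G ≃* QuaternionGroup (2 ^ ℓ)) ∨
    IsCentralProduct G (QuaternionGroup (2 ^ ℓ)) (Cyc 4) ∨
    Nonempty (G ≃* DihedralGroup (2 ^ ℓ) × Cyc 2) ∨
    Nonempty (G ≃* CycByKlein ℓ hℓ)) ∨
  Nonempty (G ≃* Cyc 2 × Cyc 2) ∨
  Nonempty (G ≃* QuaternionGroup 2) ∨
  Nonempty (G ≃* Cyc 2 × Cyc 2 × Cyc 2) ∨
  IsCentralProduct G (QuaternionGroup 2) (Cyc 4)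

section Classification

variable {G : Type*} [Group G]

theorem two_mul_two_pow_pred {κ : ℕ} (hκ : 1 ≤ κ) :
    (2 : ZMod (2 ^ (κ + 1))) * 2 ^ (κ - 1) = 2 ^ κ := by
  obtain ⟨m, rfl⟩ := Nat.exists_eq_add_of_le' hκ
  rw [Nat.add_sub_cancel]; ring

/-- The factor `2 + 2 ^ κ` is twice the unit `1 + 2 ^ (κ - 1)`, so that it divides every even
element. -/
theorem exists_mul_eq_of_even {κ : ℕ} (hκ : 2 ≤ κ) {s : ZMod (2 ^ (κ + 1))} (hs : parity κ s = 0) :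
    ∃ t, t + (1 + 2 ^ κ) * t + s = 0 := by
  obtain ⟨v, hv⟩ : IsUnit (1 + 2 ^ (κ - 1) : ZMod (2 ^ (κ + 1))) := by
    apply parity_eq_one_iff.1
    rw [map_add, map_one, map_pow, parity_two, zero_pow (by omega), add_zero]
  obtain ⟨y, rfl⟩ := parity_eq_zero_iff.1 hs
  have h1 : (v : ZMod (2 ^ (κ + 1))) * (v⁻¹ : (ZMod (2 ^ (κ + 1)))ˣ) = 1 := v.mul_inv
  rw [hv] at h1
  refine ⟨-(v⁻¹ : (ZMod (2 ^ (κ + 1)))ˣ) * y, ?_⟩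
  linear_combination -2 * y * h1 +
    ((v⁻¹ : (ZMod (2 ^ (κ + 1)))ˣ) : ZMod (2 ^ (κ + 1))) * y *
      two_mul_two_pow_pred (show 1 ≤ κ by omega)

theorem two_mul_eq_zero_of_modular {κ : ℕ} (hκ : 2 ≤ κ) {x : ZMod (2 ^ (κ + 1))}
    (hx : (2 + 2 ^ κ) * x = 0) : 2 * x = 0 := by
  have hu : IsUnit (1 + 2 ^ (κ - 1) : ZMod (2 ^ (κ + 1))) := by
    apply parity_eq_one_iff.1
    rw [map_add, map_one, map_pow, parity_two, zero_pow (by omega), add_zero]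
  refine hu.mul_right_eq_zero.1 ?_
  linear_combination hx + x * two_mul_two_pow_pred (show 1 ≤ κ by omega)

namespace IsCyclicExt

variable {κ : ℕ} {E : ZMod (2 ^ (κ + 1)) → G} {b : G} {u s : ZMod (2 ^ (κ + 1))}

/-- An abelian group with a cyclic subgroup of index two. -/
theorem isListed_of_commute (h : IsCyclicExt E b 1 s) : IsListed G := by
  rcases parity_eq_zero_or_one s with hs | hs
  · obtain ⟨y, rfl⟩ := parity_eq_zero_iff.1 hs
    have h1 := h.change (-y)
    have h2 : -y + 1 * -y + 2 * y = 0 := by ring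
    rw [h2] at h1
    have h3 := h1.nonempty_mulEquiv (isCyclicExt_prod (2 ^ (κ + 1)))
    match κ, h3 with
    | 0, h3 => exact Or.inr (Or.inl h3)
    | 1, h3 => exact Or.inl ⟨2, le_rfl, Or.inr (Or.inl h3)⟩
    | κ + 2, h3 => exact Or.inl ⟨κ + 2, by omega, Or.inr (Or.inr (Or.inl h3))⟩
  · have hb : ∀ k : ℕ, b ^ (2 * k) = E (k * s) := fun k => by
      rw [pow_mul, pow_two, h.sq, h.pow]
    have ho : orderOf b = 2 ^ (κ + 1 + 1) := by
      have : Fact (Nat.Prime 2) := ⟨Nat.prime_two⟩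
      refine orderOf_eq_prime_pow ?_ ?_
      · rw [pow_succ' 2 κ, hb, h.eq_one_iff]
        push_cast
        rw [two_pow_mul_of_odd hs]
        exact two_pow_ne_zero κ
      · rw [pow_succ' 2 (κ + 1), hb, ZMod.natCast_self, zero_mul, h.zero]
    have hcard : Nat.card G = 2 ^ (κ + 1 + 1) := by rw [h.card, pow_succ' 2 (κ + 1)]
    have := h.finite
    have : IsCyclic G := isCyclic_of_orderOf_eq_card b (by rw [ho, hcard])
    exact Or.inl ⟨κ + 1 + 1, by omega, Or.inl
      ⟨mulEquivOfCyclicCardEq (by rw [hcard, card_cyc])⟩⟩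

theorem isListed_of_neg_one (h : IsCyclicExt E b (-1) s) (hκ : 1 ≤ κ) : IsListed G := by
  have hs : 2 * s = 0 := by linear_combination -h.u_mul_s
  rcases two_mul_eq_zero_iff.1 hs with rfl | rfl
  · exact Or.inl ⟨κ + 1, by omega, Or.inr (Or.inr (Or.inr (Or.inl
      (h.nonempty_mulEquiv (isCyclicExt_dihedralGroup _)))))⟩
  · have h1 := h.nonempty_mulEquiv (isCyclicExt_quaternionGroup_two_pow κ)
    obtain rfl | hκ := hκ.eq_or_lt
    · exact Or.inr (Or.inr (Or.inl h1))
    · exact Or.inl ⟨κ, hκ, Or.inr (Or.inr (Or.inr (Or.inr (Or.inr (Or.inr (Or.inl h1))))))⟩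

/-- A group with a cyclic subgroup of index two: `u` is a square root of one, and `b` is changed to
make `b ^ 2` trivial if `u` is `±1 + 2 ^ κ`. -/
theorem isListed (h : IsCyclicExt E b u s) : IsListed G := by
  rcases Nat.lt_or_ge κ 2 with hκ | hκ
  · obtain rfl | rfl : κ = 0 ∨ κ = 1 := by omega
    · have h1 : ∀ u : ZMod (2 ^ (0 + 1)), u * u = 1 → u = 1 := by decide
      obtain rfl := h1 u h.mul_self_u
      exact h.isListed_of_commute
    · have h1 : ∀ u : ZMod (2 ^ (1 + 1)), u * u = 1 → u = 1 ∨ u = -1 := by decide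
      rcases h1 u h.mul_self_u with rfl | rfl
      · exact h.isListed_of_commute
      · exact h.isListed_of_neg_one le_rfl
  · have hus := h.u_mul_s
    rcases sq_eq_one_cases h.mul_self_u with rfl | rfl | rfl | rfl
    · exact h.isListed_of_commute
    · have hs : parity κ s = 0 := by
        rcases parity_eq_zero_or_one s with hs | hs
        · exact hs
        · refine absurd ?_ (two_pow_ne_zero κ)
          linear_combination hus - two_pow_mul_of_odd hs
      obtain ⟨t, ht⟩ := exists_mul_eq_of_even hκ hs
      have h1 := h.change t
      rw [ht, add_comm (1 : ZMod (2 ^ (κ + 1)))] at h1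
      exact Or.inl ⟨κ, hκ, Or.inr (Or.inr (Or.inr (Or.inr (Or.inr (Or.inl
        (h1.nonempty_mulEquiv (isCyclicExt_modularGrp κ hκ)))))))⟩
    · exact h.isListed_of_neg_one (by omega)
    · have hs : 2 * s = 0 := two_mul_eq_zero_of_modular hκ (by
        have h1 : parity κ s = 0 := by
          rcases parity_eq_zero_or_one s with hs | hs
          · exact hs
          · exfalso
            have h2 : (2 : ZMod (2 ^ (κ + 1))) * (s - 2 ^ (κ - 1)) = 0 := by
              linear_combination two_pow_mul_of_odd hs - hus -
                two_mul_two_pow_pred (show 1 ≤ κ by omega)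
            have h3 : parity κ (s - 2 ^ (κ - 1)) = 1 := by
              rw [map_sub, hs, map_pow, parity_two, zero_pow (by omega), sub_zero]
            rcases two_mul_eq_zero_iff.1 h2 with h4 | h4
            · rw [h4, map_zero] at h3
              exact absurd h3 (by decide)
            · rw [h4, parity_two_pow (by omega)] at h3
              exact absurd h3 (by decide)
        linear_combination -hus + 2 * two_pow_mul_of_even h1)
      obtain ⟨t, ht⟩ : ∃ t, t + (-1 + 2 ^ κ) * t + s = 0 := by
        rcases two_mul_eq_zero_iff.1 hs with rfl | rfl
        · exact ⟨0, by ring⟩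
        · exact ⟨1, by linear_combination two_mul_two_pow κ⟩
      have h1 := h.change t
      have hu : (-1 + 2 ^ κ : ZMod (2 ^ (κ + 1))) = 2 ^ κ - 1 := by ring
      rw [ht, hu] at h1
      exact Or.inl ⟨κ, hκ, Or.inr (Or.inr (Or.inr (Or.inr (Or.inl
        (h1.nonempty_mulEquiv (isCyclicExt_semiDihedral κ hκ))))))⟩

end IsCyclicExt

theorem isListed_of_orderOf {κ : ℕ} (hG : Nat.card G = 2 ^ (κ + 2)) {g : G}
    (hg : orderOf g = 2 ^ (κ + 1)) : IsListed G := by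
  have hK : Nat.card (Subgroup.zpowers g) = 2 ^ (κ + 1) := by rw [Nat.card_zpowers, hg]
  have hidx : (Subgroup.zpowers g).index = 2 := by
    have h1 := (Subgroup.zpowers g).card_mul_index
    rw [hK, hG, pow_succ 2 (κ + 1)] at h1
    exact Nat.eq_of_mul_eq_mul_left (by positivity) h1
  obtain ⟨c, hc⟩ : ∃ c, c ∉ Subgroup.zpowers g := by
    by_contra! h
    rw [(Subgroup.eq_top_iff' _).2 h, Subgroup.index_top] at hidx
    omega
  obtain ⟨τ, s, h⟩ := isTwoExt_of_index_two hidx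
    (mulEquivOfCyclicCardEq (G := Cyc (2 ^ (κ + 1))) (by rw [hK, card_cyc])) hc
  have h' : IsCyclicExt (fun x => ((Subgroup.zpowers g).subtype.comp
      (mulEquivOfCyclicCardEq (G := Cyc (2 ^ (κ + 1))) (by rw [hK, card_cyc])).toMonoidHom)
      (Multiplicative.ofAdd x)) c (expo (n := 2 ^ (κ + 1)) τ) s.toAdd :=
    { add := fun x y => by rw [ofAdd_add, map_mul]
      inj := h.inj
      conj := fun x => by
        rw [h.conj]
        congr 2
        exact congrArg Multiplicative.ofAdd (toAdd_mulAut_apply τ _)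
      sq := h.sq
      ne := fun x => h.ne _
      cover := h.cover }
  exact h'.isListed

namespace IsTwoExt

section Change

variable {M : Type*} [Group M] {i : M →* G} {c : G} {τ : M → M} {s : M}

/-- The element outside of the subgroup may be multiplied by an element of it. -/
theorem change (h : IsTwoExt i c τ s) (d : M) :
    IsTwoExt i (i d * c) (fun m => d * τ m * d⁻¹) (d * τ d * s) where
  inj := h.inj
  conj m := by rw [h.mulcM, h.mulMc, inv_mul_cancel_right]
  sq := h.mulcc d d
  ne m := h.ne_mul _ _
  cover g := by
    rcases h.cover g with h1 | ⟨m, rfl⟩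
    · exact Or.inl h1
    · exact Or.inr ⟨m * d⁻¹, by rw [h.mulMc, inv_mul_cancel_right]⟩

/-- The identification of the subgroup with `M` may be changed by an automorphism. -/
theorem comp (h : IsTwoExt i c τ s) (σ : M ≃* M) :
    IsTwoExt (i.comp σ.toMonoidHom) c (fun m => σ.symm (τ (σ m))) (σ.symm s) where
  inj := h.inj.comp σ.injective
  conj m := by simp [h.conj]
  sq := by simp [h.sq]
  ne m := h.ne _
  cover g := by
    rcases h.cover g with ⟨m, rfl⟩ | ⟨m, rfl⟩
    · exact Or.inl ⟨σ.symm m, by simp⟩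
    · exact Or.inr ⟨σ.symm m, by simp⟩

theorem congr (h : IsTwoExt i c τ s) {τ' : M → M} {s' : M} (hτ : ∀ m, τ m = τ' m) (hs : s = s') :
    IsTwoExt i c τ' s' := by
  obtain rfl := funext hτ
  subst hs
  exact h

/-- `c ^ 2 = s` acts as conjugation by `s` and commutes with `c`. -/
theorem apply_apply (h : IsTwoExt i c τ s) (m : M) : τ (τ m) * s = s * m := by
  apply h.inj
  rw [map_mul, map_mul, ← h.sq, ← mul_assoc, ← h.conj, mul_assoc c, ← h.conj, mul_assoc]

theorem apply_self (h : IsTwoExt i c τ s) : τ s = s := by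
  apply h.inj
  have : c * i s = i s * c := by rw [← h.sq, mul_assoc]
  rw [h.conj] at this
  exact mul_right_cancel this

end Change

open DihedralGroup

section Dihedral

variable {κ : ℕ} {i : DihedralGroup (2 ^ (κ + 1)) →* G} {c : G}
  {τ : DihedralGroup (2 ^ (κ + 1)) → DihedralGroup (2 ^ (κ + 1))}
  {s : DihedralGroup (2 ^ (κ + 1))} {w k t : ZMod (2 ^ (κ + 1))}

/-- If `c` is central and `c ^ 2` is the central involution of the dihedral group, then `r 1` and
`sr 0 * c` generate a quaternion group. -/
theorem exists_quaternion (h : IsTwoExt i c id (r (2 ^ κ))) :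
    ∃ i' : QuaternionGroup (2 ^ κ) →* G, IsTwoExt i' c id (QuaternionGroup.a (2 ^ κ : ℕ)) := by
  have hQ := isCyclicExt_quaternionGroup_two_pow κ
  obtain ⟨i', h1, h2⟩ := hQ.exists_hom (fun x => i (r x)) (fun x y => by rw [← map_mul, r_mul_r])
    (i (sr 0) * c)
    (fun x => by rw [h.mulcM, h.mulMc, id, sr_mul_r, r_mul_sr]; congr 3; ring)
    (by rw [h.mulcc, id, sr_mul_self, one_mul])
  have h3 : ∀ x, i' (QuaternionGroup.a (n := 2 ^ κ) (ZMod.ringEquivCongr (pow_succ' 2 κ) x) *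
      QuaternionGroup.xa 0) = i (sr (-x)) * c := fun x => by
    rw [map_mul, h1, h2, h.mulMc, r_mul_sr, zero_sub]
  have hz : QuaternionGroup.a (n := 2 ^ κ) (2 ^ κ : ℕ) =
      QuaternionGroup.a (n := 2 ^ κ) (ZMod.ringEquivCongr (pow_succ' 2 κ) (2 ^ κ)) := by
    rw [map_pow, map_ofNat]
    push_cast
    rfl
  refine ⟨i', ?_, ?_, ?_, ?_, ?_⟩
  · rw [injective_iff_map_eq_one]
    intro q hq
    rcases hQ.cover q with ⟨x, rfl⟩ | ⟨x, rfl⟩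
    · rw [h1, ← map_one i, h.inj_iff, one_def, r.injEq] at hq
      rw [hq]
      exact hQ.zero
    · rw [h3, ← map_one i] at hq
      exact absurd hq.symm (h.ne_mul _ _)
  · intro q
    rcases hQ.cover q with ⟨x, rfl⟩ | ⟨x, rfl⟩
    · rw [id, h1, h.conj, id]
    · rw [id, h3, ← mul_assoc, h.conj, id]
  · rw [hz, h1, h.sq]
  · intro q
    rcases hQ.cover q with ⟨x, rfl⟩ | ⟨x, rfl⟩
    · rw [h1]
      exact h.ne _
    · rw [h3, Ne, mul_eq_right, ← map_one i, h.inj_iff, one_def]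
      exact fun h => nomatch h
  · intro g
    rcases h.cover g with ⟨x | x, rfl⟩ | ⟨x | x, rfl⟩
    · exact Or.inl ⟨_, (h1 x).symm⟩
    · -- `sr x = (sr x * r (2 ^ κ) * c) * c`
      refine Or.inr ⟨_, Eq.trans ?_ (congrArg (· * c) (h3 (-(x + 2 ^ κ))).symm)⟩
      rw [mul_assoc, h.sq, ← map_mul, sr_mul_r]
      congr 2
      linear_combination -two_mul_two_pow κ
    · exact Or.inr ⟨_, congrArg (· * c) (h1 x).symm⟩
    · refine Or.inl ⟨_, Eq.trans ?_ (h3 (-x)).symm⟩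
      rw [neg_neg]

/-- The case of an element `c` that centralizes the rotations. -/
theorem isListed_of_centralizes (h : IsTwoExt i c τ (r t)) (hκ : 1 ≤ κ)
    (hr : ∀ x, τ (r x) = r x) (hsr : ∀ x, τ (sr x) = sr (x + k)) : IsListed G := by
  have hcard : Nat.card G = 2 ^ (κ + 1 + 2) := by
    have h1 : Function.Bijective (fun x : DihedralGroup (2 ^ (κ + 1)) ⊕
        DihedralGroup (2 ^ (κ + 1)) => Sum.elim i (fun m => i m * c) x) := by
      constructor
      · rintro (x | x) (y | y) hxy
        · exact congrArg _ (h.inj hxy)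
        · exact absurd hxy (h.ne_mul _ _)
        · exact absurd hxy.symm (h.ne_mul _ _)
        · exact congrArg _ (h.mul_c_inj.1 hxy)
      · intro g
        rcases h.cover g with ⟨x, rfl⟩ | ⟨x, rfl⟩
        · exact ⟨Sum.inl x, rfl⟩
        · exact ⟨Sum.inr x, rfl⟩
    rw [← Nat.card_congr (Equiv.ofBijective _ h1), Nat.card_sum, DihedralGroup.nat_card]
    ring
  rcases parity_eq_zero_or_one t with ht | ht
  · obtain ⟨y, rfl⟩ := parity_eq_zero_iff.1 ht
    have h1 := h.apply_apply (sr 0)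
    rw [hsr, hsr, sr_mul_r, r_mul_sr, sr.injEq] at h1
    have hk : 2 * (k + 2 * y) = 0 := by linear_combination h1
    have h2 := h.change (r (-y))
    have hr' : ∀ x, r (-y) * τ (r x) * (r (-y))⁻¹ = r x := fun x => by
      rw [hr, inv_r, r_mul_r, r_mul_r]
      congr 1
      ring
    have hs' : r (-y) * τ (r (-y)) * r (2 * y) = 1 := by
      rw [hr, r_mul_r, r_mul_r, one_def]
      congr 1
      ring
    have hsr' : ∀ x, r (-y) * τ (sr x) * (r (-y))⁻¹ = sr (x + (k + 2 * y)) := fun x => by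
      rw [hsr, inv_r, r_mul_sr, sr_mul_r]
      congr 1
      ring
    rcases two_mul_eq_zero_iff.1 hk with hk | hk
    · have h3 : IsTwoExt i (i (r (-y)) * c) (dihedralPow 1) 1 := h2.congr (fun m => by
        rcases m with x | x
        · rw [hr', dihedralPow_one]
        · rw [hsr', hk, add_zero, dihedralPow_one]) hs'
      exact Or.inl ⟨κ + 1, by omega, Or.inr (Or.inr (Or.inr (Or.inr (Or.inr (Or.inr (Or.inr (Or.inr
        (Or.inl (h3.nonempty_mulEquiv (isTwoExt_dihedral_prod _))))))))))⟩
    · have hh := two_mul_two_pow_pred hκ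
      have h3 := (h2.change (r (2 ^ (κ - 1)))).congr (τ' := id) (s' := r (2 ^ κ)) (fun m => by
        rcases m with x | x
        · rw [hr', inv_r, r_mul_r, r_mul_r]
          congr 1
          ring
        · rw [hsr', hk, inv_r, r_mul_sr, sr_mul_r]
          congr 1
          linear_combination -hh) (by
        rw [hr', hs', mul_one, r_mul_r]
        congr 1
        linear_combination hh)
      obtain ⟨i', h4⟩ := h3.exists_quaternion
      have h5 := h4.isCentralProduct (le_trans (by norm_num : 2 ≤ 2 ^ 1)
        (Nat.pow_le_pow_right (by norm_num) hκ))
      obtain rfl | hκ := hκ.eq_or_lt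
      · exact Or.inr (Or.inr (Or.inr (Or.inr h5)))
      · exact Or.inl ⟨κ, hκ, Or.inr (Or.inr (Or.inr (Or.inr (Or.inr (Or.inr (Or.inr
          (Or.inl h5)))))))⟩
  · -- `c` generates a cyclic subgroup that contains the rotations
    refine isListed_of_orderOf hcard (g := c) ?_
    have : Fact (Nat.Prime 2) := ⟨Nat.prime_two⟩
    have hc : ∀ j : ℕ, c ^ (2 * j) = i (r (t * j)) := fun j => by
      rw [pow_mul, pow_two, h.sq, ← map_pow, r_pow]
    refine orderOf_eq_prime_pow ?_ ?_
    · rw [pow_succ' 2 κ, hc, ← map_one i, h.inj_iff, one_def, r.injEq]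
      push_cast
      rw [mul_comm, two_pow_mul_of_odd ht]
      exact two_pow_ne_zero κ
    · rw [pow_succ' 2 (κ + 1), hc, ZMod.natCast_self, mul_zero, r_zero, map_one]

/-- The case of an element `c` that acts on the rotations as the power map with exponent
`1 + 2 ^ κ`. -/
theorem isListed_of_modular (h : IsTwoExt i c τ (r t)) (hκ : 2 ≤ κ)
    (hr : ∀ x, τ (r x) = r ((1 + 2 ^ κ) * x)) (hsr : ∀ x, τ (sr x) = sr ((1 + 2 ^ κ) * x + k)) :
    IsListed G := by
  have ht : parity κ t = 0 := by
    have h1 := h.apply_self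
    rw [hr, r.injEq] at h1
    rcases parity_eq_zero_or_one t with hp | hp
    · exact hp
    · refine absurd ?_ (two_pow_ne_zero κ)
      linear_combination h1 - two_pow_mul_of_odd hp
  obtain ⟨q, hq⟩ := exists_mul_eq_of_even hκ ht
  have h2 := (h.change (r q)).congr (s' := 1) (fun _ => rfl) (by
    rw [hr, r_mul_r, r_mul_r, hq, r_zero])
  have hr' : ∀ x, r q * τ (r x) * (r q)⁻¹ = r ((1 + 2 ^ κ) * x) := fun x => by
    rw [hr, inv_r, r_mul_r, r_mul_r]
    congr 1
    ring
  have hsr' : ∀ x, r q * τ (sr x) * (r q)⁻¹ = sr ((1 + 2 ^ κ) * x + (k - 2 * q)) := fun x => by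
    rw [hsr, inv_r, r_mul_sr, sr_mul_r]
    congr 1
    ring
  have h3 := h2.apply_apply (sr 0)
  rw [hsr', hsr', mul_one, one_mul, sr.injEq] at h3
  have hk : 2 * (k - 2 * q) = 0 := two_mul_eq_zero_of_modular hκ (by linear_combination h3)
  have hklein : ∀ (j : DihedralGroup (2 ^ (κ + 1)) →* G) (c' : G),
      IsTwoExt j c' (dihedralPow (1 + 2 ^ κ)) 1 → IsListed G := fun j c' h4 => by
    obtain ⟨j', c'', h5⟩ := exists_isTwoExt_cycByKlein κ hκ
    exact Or.inl ⟨κ, hκ, Or.inr (Or.inr (Or.inr (Or.inr (Or.inr (Or.inr (Or.inr (Or.inr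
        (Or.inr (h4.nonempty_mulEquiv h5)))))))))⟩
  rcases two_mul_eq_zero_iff.1 hk with hk | hk
  · exact hklein i _ (h2.congr (fun m => by
      rcases m with x | x
      · exact hr' x
      · rw [hsr', hk, add_zero, dihedralPow_sr]) rfl)
  · -- `c` does not commute with `sr 0`, but with `sr 1`
    let σ : DihedralGroup (2 ^ (κ + 1)) ≃* DihedralGroup (2 ^ (κ + 1)) :=
      { toFun := fun m => match m with
          | r x => r x
          | sr x => sr (x + 1)
        invFun := fun m => match m with
          | r x => r x
          | sr x => sr (x - 1)
        left_inv := fun m => by rcases m with x | x <;> simp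
        right_inv := fun m => by rcases m with x | x <;> simp
        map_mul' := fun m m' => by
          rcases m with x | x <;> rcases m' with y | y
          · rfl
          · exact congrArg sr (by ring)
          · exact congrArg sr (by ring)
          · exact congrArg r (by ring) }
    have hσr : ∀ x, σ (r x) = r x := fun _ => rfl
    have hσsr : ∀ x, σ (sr x) = sr (x + 1) := fun _ => rfl
    refine hklein _ _ ((h2.comp σ).congr (fun m => ?_) (map_one σ.symm))
    rw [MulEquiv.symm_apply_eq]
    rcases m with x | x
    · rw [hσr, hr', dihedralPow_r, hσr]
    · rw [hσsr, hsr', hk, dihedralPow_sr, hσsr]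
      congr 1
      linear_combination two_mul_two_pow κ

/-- The square of an element outside of the dihedral group is a rotation, since `-1` is not a
square modulo `4`. -/
theorem exists_eq_r (h : IsTwoExt i c τ s) (hκ : 1 ≤ κ) (hw : parity κ w = 1)
    (hr : ∀ x, τ (r x) = r (w * x)) : ∃ t, s = r t ∧ w * w = 1 := by
  have h1 := h.apply_apply (r 1)
  rw [hr, hr] at h1
  rcases s with t | t
  · rw [r_mul_r, r_mul_r, r.injEq] at h1
    exact ⟨t, rfl, by linear_combination h1⟩
  · exfalso
    rw [r_mul_sr, sr_mul_r, sr.injEq] at h1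
    obtain ⟨y, hy⟩ := parity_eq_zero_iff.1 (show parity κ (w - 1) = 0 by
      rw [map_sub, hw, map_one, sub_self])
    have h2 : (1 + 2 * (y + y * y)) * 2 = 0 := by
      have hy' : w = 2 * y + 1 := by linear_combination hy
      rw [hy'] at h1
      linear_combination -h1
    have h3 : IsUnit (1 + 2 * (y + y * y)) := by
      rw [← parity_eq_one_iff, map_add, map_mul, parity_two, map_one, zero_mul, add_zero]
    exact two_ne_zero_of_pos hκ (h3.mul_right_eq_zero.1 h2)

/-- A group with a dihedral subgroup of index two: up to sign, `c` acts on the rotations with exponent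
`1` or `1 + 2 ^ κ`. -/
theorem isListed_of_dihedral {τ : DihedralGroup (2 ^ (κ + 1)) ≃* DihedralGroup (2 ^ (κ + 1))}
    (h : IsTwoExt i c τ s) (hκ : 1 ≤ κ) : IsListed G := by
  obtain ⟨v, k, hr, hs0⟩ := (isCyclicExt_dihedralGroup (2 ^ (κ + 1))).mulAut_apply 2
    (by exact_mod_cast two_ne_zero_of_pos hκ) (fun x => by rw [r_mul_sr, pow_two, sr_mul_self]) τ
  have hp := parity_unit v
  generalize (v : ZMod (2 ^ (κ + 1))) = v at hr hp
  have hsr : ∀ x, τ (sr x) = sr (v * x + -k) := fun x => by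
    have h1 : (sr x : DihedralGroup (2 ^ (κ + 1))) = sr 0 * r x := by rw [sr_mul_r, zero_add]
    rw [h1, map_mul, hs0, hr, r_mul_sr, sr_mul_r]
    congr 1
    ring
  obtain ⟨t, rfl, hv⟩ := h.exists_eq_r hκ hp hr
  -- multiplication of `c` by `sr 0` changes the sign of the exponent
  have h' := h.change (sr 0)
  have hr' : ∀ x, sr 0 * τ (r x) * (sr 0)⁻¹ = r (-v * x) := fun x => by
    rw [hr, inv_sr, sr_mul_r, sr_mul_sr]
    congr 1
    ring
  have hsr' : ∀ x, sr 0 * τ (sr x) * (sr 0)⁻¹ = sr (-v * x + k) := fun x => by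
    rw [hsr, inv_sr, sr_mul_sr, r_mul_sr]
    congr 1
    ring
  obtain ⟨t', ht', -⟩ := h'.exists_eq_r hκ (w := -v)
    (by rw [map_neg, hp]; decide) hr'
  have h'' := h'.congr (fun _ => rfl) ht'
  have hcases : v = 1 ∨ v = -1 ∨ 2 ≤ κ ∧
      (v = 1 + 2 ^ κ ∨ v = -1 + 2 ^ κ) := by
    obtain rfl | hκ := hκ.eq_or_lt
    · have h4 : ∀ x : ZMod (2 ^ (1 + 1)), x * x = 1 → x = 1 ∨ x = -1 := by decide
      exact (h4 _ hv).imp_right Or.inl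
    · rcases sq_eq_one_cases hv with h1 | h1 | h1 | h1
      · exact Or.inl h1
      · exact Or.inr (Or.inr ⟨hκ, Or.inl h1⟩)
      · exact Or.inr (Or.inl h1)
      · exact Or.inr (Or.inr ⟨hκ, Or.inr h1⟩)
  rcases hcases with h1 | h1 | ⟨hκ2, h1 | h1⟩
  · exact h.isListed_of_centralizes hκ (fun x => by rw [hr, h1, one_mul])
      (fun x => by rw [hsr, h1, one_mul])
  · exact h''.isListed_of_centralizes hκ (fun x => by rw [hr', h1, neg_neg, one_mul])
      (fun x => by rw [hsr', h1, neg_neg, one_mul])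
  · exact h.isListed_of_modular hκ2 (fun x => by rw [hr, h1]) (fun x => by rw [hsr, h1])
  · have h2 : -v = 1 + 2 ^ κ := by
      linear_combination -h1 - two_mul_two_pow κ
    exact h''.isListed_of_modular hκ2 (fun x => by rw [hr', h2]) (fun x => by rw [hsr', h2])

end Dihedral

/-- The groups of order eight with a Klein four-subgroup. -/
theorem isListed_of_klein {i : DihedralGroup (2 ^ (0 + 1)) →* G} {c : G}
    {τ : DihedralGroup (2 ^ (0 + 1)) → DihedralGroup (2 ^ (0 + 1))}
    {s : DihedralGroup (2 ^ (0 + 1))} (h : IsTwoExt i c τ s) (hG : Nat.card G = 2 ^ (1 + 2)) :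
    IsListed G := by
  have : Finite G := Nat.finite_of_card_ne_zero (by rw [hG]; positivity)
  by_cases hexp : ∀ g : G, g * g = 1
  · have h1 : IsTwoExt i c (dihedralPow 1) 1 := h.congr (fun m => by
      apply h.inj
      rw [dihedralPow_one]
      have h2 := h.conj m
      have h3 : c * i m * (c * i m) = 1 := hexp _
      have h4 : c * i m = i m * c := by
        have h5 : (c * i m)⁻¹ = c * i m := inv_eq_of_mul_eq_one_left h3
        rw [mul_inv_rev, inv_eq_of_mul_eq_one_left (hexp c),
          inv_eq_of_mul_eq_one_left (hexp (i m))] at h5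
        exact h5.symm
      rw [h4] at h2
      exact (mul_right_cancel h2).symm) (h.inj (by rw [← h.sq, hexp, map_one]))
    obtain ⟨e⟩ := h1.nonempty_mulEquiv (isTwoExt_dihedral_prod _)
    obtain ⟨e'⟩ := IsCyclicExt.nonempty_mulEquiv (n := 2 ^ (0 + 1)) (u := 1)
      (isCyclicExt_dihedralGroup (2 ^ (0 + 1))) (isCyclicExt_prod (2 ^ (0 + 1)))
    exact Or.inr (Or.inr (Or.inr (Or.inl
      ⟨e.trans ((e'.prodCongr (MulEquiv.refl (Cyc 2))).trans MulEquiv.prodAssoc)⟩)))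
  · push Not at hexp
    obtain ⟨g, hg⟩ := hexp
    have hdvd := orderOf_dvd_natCard g
    rw [hG, Nat.dvd_prime_pow Nat.prime_two] at hdvd
    obtain ⟨j, hj, ho⟩ := hdvd
    interval_cases j
    · exact absurd (by rw [orderOf_eq_one_iff.1 ho, mul_one]) hg
    · exact absurd (orderOf_eq_two_iff'.1 ho).1 hg
    · exact isListed_of_orderOf hG ho
    · refine isListed_of_orderOf hG (g := g ^ 2) ?_
      rw [orderOf_pow, ho]
      norm_num

end IsTwoExt

/-- A maximal subgroup of a finite `2`-group has index two. -/
theorem index_eq_two_of_isCoatom [Finite G] (hG : IsPGroup 2 G) {M : Subgroup G} (hM : IsCoatom M) :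
    M.index = 2 := by
  have : Fact (Nat.Prime 2) := ⟨Nat.prime_two⟩
  obtain ⟨n, hn⟩ := IsPGroup.iff_card.1 hG
  obtain ⟨m, hm⟩ := IsPGroup.iff_card.1 (hG.to_subgroup M)
  have hlt : m < n := by
    by_contra! h
    refine hM.1 (Subgroup.eq_top_of_le_card M ?_)
    rw [hn, hm]
    exact Nat.pow_le_pow_right (by norm_num) h
  obtain ⟨K, hK, hMK⟩ := Sylow.exists_subgroup_card_pow_succ
    (show 2 ^ (m + 1) ∣ Nat.card G by rw [hn]; exact pow_dvd_pow 2 hlt) hm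
  have hKtop : K = ⊤ := hM.2 K (lt_of_le_of_ne hMK fun h => by
    rw [← h, hm] at hK
    exact absurd (Nat.pow_right_injective le_rfl hK) (by omega))
  rw [hKtop, Subgroup.card_top] at hK
  have h1 := M.card_mul_index
  rw [hm, hK, pow_succ 2 m] at h1
  exact Nat.eq_of_mul_eq_mul_left (by positivity) h1

theorem isListed_of_isCoatom [Finite G] (hG : IsPGroup 2 G) (hG2 : Nat.card G ≠ 2)
    {M : Subgroup G} (hM : IsCoatom M) (h : IsCyclic M ∨ IsDihedralGroup M) : IsListed G := by
  have : Fact (Nat.Prime 2) := ⟨Nat.prime_two⟩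
  have hidx := index_eq_two_of_isCoatom hG hM
  obtain ⟨m, hm⟩ := IsPGroup.iff_card.1 (hG.to_subgroup M)
  have hcard : Nat.card G = 2 ^ m * 2 := by rw [← M.card_mul_index, hm, hidx]
  rcases h with h | ⟨n, hn, ⟨e⟩⟩
  · obtain ⟨κ, rfl⟩ : ∃ κ, m = κ + 1 := Nat.exists_eq_succ_of_ne_zero fun h0 => by
      rw [h0] at hcard
      exact hG2 hcard
    obtain ⟨g, hg⟩ := IsCyclic.exists_generator (α := M)
    refine isListed_of_orderOf (hcard.trans (pow_succ 2 (κ + 1)).symm) (g := (g : G)) ?_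
    rw [Subgroup.orderOf_coe, orderOf_eq_card_of_forall_mem_zpowers hg, hm]
  · obtain ⟨κ, rfl⟩ : ∃ κ, n = 2 ^ (κ + 1) := by
      have h1 : 2 * n = 2 ^ m := by
        rw [← hm, Nat.card_congr e.toEquiv, DihedralGroup.nat_card]
      obtain ⟨j, -, hj⟩ := (Nat.dvd_prime_pow Nat.prime_two).1 (Dvd.intro_left 2 h1)
      rcases j with - | j
      · omega
      · exact ⟨j, hj⟩
    obtain ⟨c, hc⟩ : ∃ c, c ∉ M := by
      by_contra! h
      exact hM.1 ((Subgroup.eq_top_iff' _).2 h)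
    obtain ⟨τ, s, h⟩ := isTwoExt_of_index_two hidx e.symm hc
    rcases Nat.eq_zero_or_pos κ with rfl | hκ
    · refine h.isListed_of_klein ?_
      have h1 : 2 ^ m = 4 := by rw [← hm, Nat.card_congr e.toEquiv, DihedralGroup.nat_card]; rfl
      rw [hcard, h1]; rfl
    · exact h.isListed_of_dihedral hκ

end Classification

theorem theorem1p1 (G : Type*) [Group G] :
    -- the classification
    (Finite G → IsPGroup 2 G → Nat.card G ≠ 2 →
      (∃ M : Subgroup G, IsCoatom M ∧ (IsCyclic M ∨ IsDihedralGroup M)) →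
      -- the general case
      (∃ (ℓ : ℕ) (hℓ : 2 ≤ ℓ),
        Nonempty (G ≃* Cyc (2 ^ ℓ)) ∨
        Nonempty (G ≃* Cyc 4 × Cyc 2) ∨
        Nonempty (G ≃* Cyc (2 ^ (ℓ + 1)) × Cyc 2) ∨
        Nonempty (G ≃* DihedralGroup (2 ^ ℓ)) ∨
        Nonempty (G ≃* SemiDihedral ℓ hℓ) ∨
        Nonempty (G ≃* ModularGrp ℓ hℓ) ∨
        Nonempty (G ≃* QuaternionGroup (2 ^ ℓ)) ∨
        IsCentralProduct G (QuaternionGroup (2 ^ ℓ)) (Cyc 4) ∨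
        Nonempty (G ≃* DihedralGroup (2 ^ ℓ) × Cyc 2) ∨
        Nonempty (G ≃* CycByKlein ℓ hℓ)) ∨
      -- the degenerate case
      Nonempty (G ≃* Cyc 2 × Cyc 2) ∨
      Nonempty (G ≃* QuaternionGroup 2) ∨
      Nonempty (G ≃* Cyc 2 × Cyc 2 × Cyc 2) ∨
      IsCentralProduct G (QuaternionGroup 2) (Cyc 4)) ∧
    -- the rows of the general case: `Aut(G)` is a `2`-group
    (∀ (ℓ : ℕ) (hℓ : 2 ≤ ℓ),
      (Nonempty (G ≃* Cyc (2 ^ ℓ)) →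
        IsPGroup 2 (MulAut G) ∧
        Nonempty (MulAut G ≃* Cyc (2 ^ (ℓ - 2)) × Cyc 2) ∧
        ¬ HasReversingTriple G ∧ ¬ HasRegularTriple G ∧ HasRotaryPair G) ∧
      (Nonempty (G ≃* Cyc 4 × Cyc 2) →
        IsPGroup 2 (MulAut G) ∧
        Nonempty (MulAut G ≃* DihedralGroup 4) ∧
        ¬ HasReversingTriple G ∧ ¬ HasRegularTriple G ∧ HasRotaryPair G) ∧
      (Nonempty (G ≃* Cyc (2 ^ (ℓ + 1)) × Cyc 2) →
        IsPGroup 2 (MulAut G) ∧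
        (∃ d : CentralGluing (Cyc (2 ^ (ℓ - 1))) (DihedralGroup 4), d.IsFull ∧
          Nonempty (MulAut G ≃* d.Product × Cyc 2)) ∧
        ¬ HasReversingTriple G ∧ ¬ HasRegularTriple G ∧ HasRotaryPair G) ∧
      (Nonempty (G ≃* DihedralGroup (2 ^ ℓ)) →
        IsPGroup 2 (MulAut G) ∧
        Nonempty (MulAut G ≃* Holomorph (Cyc (2 ^ ℓ))) ∧
        HasReversingTriple G ∧ HasRegularTriple G ∧ HasRotaryPair G) ∧
      (Nonempty (G ≃* SemiDihedral ℓ hℓ) →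
        IsPGroup 2 (MulAut G) ∧
        Nonempty (MulAut G ≃* CycByAut ℓ) ∧
        ¬ HasReversingTriple G ∧ ¬ HasRegularTriple G ∧ HasRotaryPair G) ∧
      (Nonempty (G ≃* ModularGrp ℓ hℓ) →
        IsPGroup 2 (MulAut G) ∧
        (∃ d : CentralGluing (Cyc (2 ^ (ℓ - 1))) (DihedralGroup 4), d.IsFull ∧
          Nonempty (MulAut G ≃* d.Product × Cyc 2)) ∧
        ¬ HasReversingTriple G ∧ ¬ HasRegularTriple G ∧ HasRotaryPair G) ∧
      (Nonempty (G ≃* QuaternionGroup (2 ^ ℓ)) →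
        IsPGroup 2 (MulAut G) ∧
        Nonempty (MulAut G ≃* Holomorph (Cyc (2 ^ (ℓ + 1)))) ∧
        ¬ HasReversingTriple G ∧ ¬ HasRegularTriple G ∧ ¬ HasRotaryPair G) ∧
      (IsCentralProduct G (QuaternionGroup (2 ^ ℓ)) (Cyc 4) →
        IsPGroup 2 (MulAut G) ∧
        Nonempty (MulAut G ≃* MulAut (QuaternionGroup (2 ^ ℓ)) × Cyc 2) ∧
        HasReversingTriple G ∧ ¬ HasRegularTriple G ∧ ¬ HasRotaryPair G) ∧
      (Nonempty (G ≃* DihedralGroup (2 ^ ℓ) × Cyc 2) →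
        IsPGroup 2 (MulAut G) ∧
        (∃ (H : Subgroup (MulAut G)) (_ : H.Normal),
          Nonempty (H ≃* CycByAut (ℓ - 1)) ∧
          Nonempty (MulAut G ⧸ H ≃* DihedralGroup 4 × Cyc 2)) ∧
        HasReversingTriple G ∧ HasRegularTriple G ∧ ¬ HasRotaryPair G) ∧
      (Nonempty (G ≃* CycByKlein ℓ hℓ) →
        IsPGroup 2 (MulAut G) ∧
        (∃ θ : Cyc 2 →* MulAut (MulAut (SemiDihedral ℓ hℓ) × Cyc 2),
          Nonempty (MulAut G ≃* (MulAut (SemiDihedral ℓ hℓ) × Cyc 2) ⋊[θ] Cyc 2)) ∧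
        HasReversingTriple G ∧ HasRegularTriple G ∧ ¬ HasRotaryPair G)) ∧
    -- the rows of the degenerate case: `Aut(G)` is not a `2`-group
    ((Nonempty (G ≃* Cyc 2 × Cyc 2) →
        ¬ IsPGroup 2 (MulAut G) ∧
        Nonempty (MulAut G ≃* Equiv.Perm (Fin 3)) ∧
        HasReversingTriple G ∧ HasRegularTriple G ∧ HasRotaryPair G) ∧
      (Nonempty (G ≃* QuaternionGroup 2) →
        ¬ IsPGroup 2 (MulAut G) ∧
        Nonempty (MulAut G ≃* Equiv.Perm (Fin 4)) ∧
        ¬ HasReversingTriple G ∧ ¬ HasRegularTriple G ∧ ¬ HasRotaryPair G) ∧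
      (Nonempty (G ≃* Cyc 2 × Cyc 2 × Cyc 2) →
        ¬ IsPGroup 2 (MulAut G) ∧
        Nonempty (MulAut G ≃* Matrix.GeneralLinearGroup (Fin 3) (ZMod 2)) ∧
        HasReversingTriple G ∧ HasRegularTriple G ∧ ¬ HasRotaryPair G) ∧
      (IsCentralProduct G (QuaternionGroup 2) (Cyc 4) →
        ¬ IsPGroup 2 (MulAut G) ∧
        Nonempty (MulAut G ≃* Equiv.Perm (Fin 4) × Cyc 2) ∧
        HasReversingTriple G ∧ ¬ HasRegularTriple G ∧ ¬ HasRotaryPair G)) := by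
  refine ⟨fun _ hG hG2 ⟨M, hM, h⟩ => isListed_of_isCoatom hG hG2 hM h, fun ℓ hℓ => ?_, ?_⟩
  · exact ⟨fun ⟨e⟩ => cyclic_properties hℓ e, fun ⟨e⟩ => four_prod_two_properties e,
      fun ⟨e⟩ => cyclic_prod_two_properties hℓ e, fun ⟨e⟩ => dihedral_properties hℓ e,
      fun ⟨e⟩ => semiDihedral_properties hℓ e, fun ⟨e⟩ => modularGrp_properties hℓ e,
      fun ⟨e⟩ => quaternion_properties hℓ e, fun h => quaternion_four_properties hℓ h,
      fun ⟨e⟩ => dihedral_prod_two_properties hℓ e, fun ⟨e⟩ => cycByKlein_properties hℓ e⟩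
  · exact ⟨fun ⟨e⟩ => klein_properties e, fun ⟨e⟩ => quaternion_eight_properties e,
      fun ⟨e⟩ => cube_properties e, fun h => quaternion_eight_four_properties h⟩
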